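/- **Setting.** Let $G=(-1,1)$ with the group operation $x\circ y=\frac{x+y}{1+xy}$ and the invariant measure $dG(x)=\frac{dx}{1-x^2}$; put $t(x)=\frac12\ln\frac{1+x}{1-x}$, so that $x=\tanh t$. Let $\mathbb S(G)=\{\varphi\circ t:\varphi\in\mathbb S(\mathbb R)\}$ be the image of the Schwartz space $\mathbb S(\mathbb R)$, with the transported topology, and $\mathbb S'(G)$ its dual; a function $f$ on $G$ is identified with the functional $v\mapsto\int_G fv\,dG$. The Fourier transform on $G$ is $$(\mathcal F_Gv)(\xi)=\int_{-1}^1\Big(\frac{1+y}{1-y}\Big)^{i\xi}v(y)\,\frac{dy}{1-y^2},\qquad \mathcal F_G:\mathbb S(G)\to\mathbb S(\mathbb R),$$ and is extended by duality to a bijection $\mathbb S'(G)\to\mathbb S'(\mathbb R)$; also $(\mathcal F_{\mathbb R}\varphi)(\xi)=\int_{\mathbb R}e^{i\xi t}\varphi(t)\,dt$. Write $\langle\xi\rangle^s=(1+\xi^2)^{s/2}$. For $1<p<\infty$ and $s\in\mathbb R$ let $$\mathbb H^s_p(G,dG)=\{f\in\mathbb S'(G):\ \mathcal F_G^{-1}\langle\xi\rangle^s\mathcal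 F_Gf\in\mathbb L_p(G,dG)\},\qquad \|f\|=\|\mathcal F_G^{-1}\langle\xi\rangle^s\mathcal F_Gf\,|\,\mathbb L_p(G,dG)\|.$$ For $a:\mathbb R\to\mathbb C$ let $W^0_{G,a}u=\mathcal F_G^{-1}a\,\mathcal F_Gu$, $u\in\mathbb S(G)$. The operator $W^0_{G,a}$ is *bounded* from $\mathbb H^s_p(G,dG)$ to $\mathbb H^\sigma_p(G,dG)$ if there is a (necessarily unique) bounded linear operator between these spaces, again denoted by $W^0_{G,a}$, such that for every $u\in\mathbb S(G)$ the tempered distribution $\mathcal F_GW^0_{G,a}u$ is the function $a\,\mathcal F_Gu$ (that is, $a\,\mathcal F_Gu\,\psi$ is integrable for all $\psi\in\mathbb S(\mathbb R)$, and its integral is the value of the distribution at $\psi$). In the same way, $\mathfrak M_p(\mathbb R)$ is the class of all $a:\mathbb R\to\mathbb C$ for which $W^0_a=\mathcal F_{\mathbb R}^{-1}a\,\mathcal F_{\mathbb R}$, given on $\mathbb S(\mathbb R)$, extends to a bounded operator in $\mathbb L_p(\mathbb R)$. Put $\mathfrak M^r_p(\mathbb R)=\{\langle\xi\rangle^ra(\xi):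 a\in\mathfrak M_p(\mathbb R)\}$. Let $\mathbb V_1(\mathbb R)$ be the class of complex functions of bounded variation on $\mathbb R$, and let $\mathbb W(\mathbb R)$ be the Wiener class of all functions $c+\mathcal F_{\mathbb R}k$ with $c\in\mathbb C$, $k\in\mathbb L_1(\mathbb R)$. **Theorem 3.5.** Let $1<p<\infty$, $s,r\in\mathbb R$ and $a:\mathbb R\to\mathbb C$. 1. The convolution operator $$W^0_{G,a}:\ \mathbb H^s_p(G,dG)\to\mathbb H^{s-r}_p(G,dG)\qquad(*)$$ is bounded if and only if $a\in\mathfrak M^r_p(\mathbb R)$. 2. If the operator $W^0_{G,a}$ is bounded in $(*)$ and Fredholm, then its symbol is elliptic: $$\operatorname*{ess\,inf}_{\xi\in\mathbb R}\big|\langle\xi\rangle^{-r}a(\xi)\big|>0.\qquad(**)$$ 3. If the function $a_{-r}(\xi)=\langle\xi\rangle^{-r}a(\xi)$ belongs to $\mathbb V_1(\mathbb R)$ or to $\mathbb W(\mathbb R)$, and the symbol is elliptic, i.e. $(**)$ holds, then $W^0_{G,a}$ is bounded and invertible in the setting $(*)$, and its inverse is $W^0_{G,a^{-1}}:\mathbb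 H^{s-r}_p(G,dG)\to\mathbb H^s_p(G,dG)$. -/

import Mathlib

open MeasureTheory Set
open scoped ENNReal SchwartzMap FourierTransform

noncomputable section

namespace LieConv

/-! ### The interval `G = (-1,1)`, its invariant measure and its characters -/

/-- The interval `G = (-1,1)`, the underlying set of the Lie group with the operation
`x ∘ y = (x + y) / (1 + x y)`. -/
abbrev G : Type := Ioo (-1 : ℝ) 1

/-- The invariant measure `dG(x) = dx / (1 - x²)`. -/
def dG : Measure G :=
  (Measure.comap (Subtype.val : G → ℝ) volume).withDensity fun x => ENNReal.ofReal (1 / (1 - (x : ℝ) ^ 2))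

/-- The characters `C(x,ξ) = ((1 + x) / (1 - x)) ^ (iξ)` of `G`. -/
def character (x : G) (ξ : ℝ) : ℂ :=
  (((1 + (x : ℝ)) / (1 - (x : ℝ)) : ℝ) : ℂ) ^ (Complex.I * (ξ : ℂ))

/-- `t(x) = (1/2) ln ((1 + x) / (1 - x))`. -/
def tG (x : G) : ℝ := 1 / 2 * Real.log ((1 + (x : ℝ)) / (1 - (x : ℝ)))

/-- `x(t) = tanh t`. -/
def xG (t : ℝ) : G := ⟨Real.tanh t, Real.neg_one_lt_tanh t, Real.tanh_lt_one t⟩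

lemma tG_eq_artanh (x : G) : tG x = Real.artanh x :=
  (Real.artanh_eq_half_log ⟨x.2.1.le, x.2.2.le⟩).symm

@[simp] lemma tG_xG (t : ℝ) : tG (xG t) = t := by
  rw [tG_eq_artanh]; exact Real.artanh_tanh t

@[simp] lemma xG_tG (x : G) : xG (tG x) = x := by
  rw [tG_eq_artanh]; exact Subtype.ext (Real.tanh_artanh x.2)

lemma character_eq_exp (x : G) (ξ : ℝ) :
    character x ξ = Complex.exp (Complex.I * (2 * ξ : ℝ) * (tG x : ℝ)) := by
  have h1 : 0 < 1 + (x : ℝ) := by linarith [x.2.1]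
  have h2 : 0 < 1 - (x : ℝ) := by linarith [x.2.2]
  have h3 : (((1 + (x : ℝ)) / (1 - (x : ℝ)) : ℝ) : ℂ) ≠ 0 := by
    exact_mod_cast (div_pos h1 h2).ne'
  rw [character, Complex.cpow_def_of_ne_zero h3, ← Complex.ofReal_log (div_pos h1 h2).le, tG]
  congr 1
  push_cast
  ring

lemma continuous_xG : Continuous xG := by
  refine Continuous.subtype_mk ?_ _
  have : Real.tanh = fun t => Real.sinh t / Real.cosh t := by
    ext t; exact Real.tanh_eq_sinh_div_cosh t
  rw [this]
  exact Real.continuous_sinh.div Real.continuous_cosh fun t => (Real.cosh_pos t).ne'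

lemma measurable_tG : Measurable tG := by
  unfold tG
  fun_prop

lemma hasDerivAt_tanh (t : ℝ) : HasDerivAt Real.tanh (1 - Real.tanh t ^ 2) t := by
  have h0 : Real.tanh = fun t => Real.sinh t / Real.cosh t := by
    ext t; exact Real.tanh_eq_sinh_div_cosh t
  have hc := (Real.cosh_pos t).ne'
  have h := (Real.hasDerivAt_sinh t).div (Real.hasDerivAt_cosh t) hc
  have h1 : (Real.cosh t * Real.cosh t - Real.sinh t * Real.sinh t) / Real.cosh t ^ 2
      = 1 - Real.tanh t ^ 2 := by
    rw [Real.tanh_eq_sinh_div_cosh]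
    field_simp
  rw [h1] at h
  rw [h0] at h ⊢
  exact h

/-- The change of variables `dt = dx / (1 - x²)`: the map `x(t) = tanh t` carries Lebesgue
measure on `ℝ` to `dG`. -/
lemma measurePreserving_xG : MeasurePreserving xG volume dG := by
  refine ⟨continuous_xG.measurable, ?_⟩
  ext s hs
  have hG : MeasurableSet (Ioo (-1 : ℝ) 1) := measurableSet_Ioo
  have hpre : MeasurableSet (xG ⁻¹' s) := continuous_xG.measurable hs
  rw [Measure.map_apply continuous_xG.measurable hs, dG, withDensity_apply _ hs]
  have himg : (Subtype.val '' s : Set ℝ) = Real.tanh '' (xG ⁻¹' s) := by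
    ext y
    constructor
    · rintro ⟨x, hx, rfl⟩
      refine ⟨tG x, by simpa using hx, ?_⟩
      exact congrArg Subtype.val (xG_tG x)
    · rintro ⟨t, ht, rfl⟩
      exact ⟨xG t, ht, rfl⟩
  have h1 : ∫⁻ x in s, ENNReal.ofReal (1 / (1 - (x : ℝ) ^ 2)) ∂(Measure.comap (Subtype.val : G → ℝ) volume)
      = ∫⁻ y in (Subtype.val '' s : Set ℝ), ENNReal.ofReal (1 / (1 - y ^ 2)) := by
    have hme : MeasurableEmbedding (Subtype.val : G → ℝ) := MeasurableEmbedding.subtype_coe hG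
    have hmap : (Measure.comap (Subtype.val : G → ℝ) volume).map Subtype.val =
        (volume : Measure ℝ).restrict (Ioo (-1) 1) :=
      map_comap_subtype_coe hG volume
    have hpi : (Subtype.val ⁻¹' (Subtype.val '' s : Set ℝ) : Set G) = s :=
      preimage_image_eq _ Subtype.val_injective
    have h2 := hme.restrict_map (Measure.comap (Subtype.val : G → ℝ) volume) (Subtype.val '' s)
    rw [hpi, hmap, Measure.restrict_restrict (hme.measurableSet_image.2 hs),
      inter_eq_left.2 (by rintro _ ⟨x, _, rfl⟩; exact x.2)] at h2
    rw [h2, hme.lintegral_map]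
  rw [h1, himg, lintegral_image_eq_lintegral_abs_deriv_mul hpre
    (fun t _ => (hasDerivAt_tanh t).hasDerivWithinAt) Real.tanh_injective.injOn]
  have h3 : ∀ t : ℝ, ENNReal.ofReal |1 - Real.tanh t ^ 2| *
      ENNReal.ofReal (1 / (1 - Real.tanh t ^ 2)) = 1 := by
    intro t
    have : 0 < 1 - Real.tanh t ^ 2 := by
      nlinarith [Real.neg_one_lt_tanh t, Real.tanh_lt_one t]
    rw [← ENNReal.ofReal_mul (abs_nonneg _), abs_of_pos this, mul_one_div_cancel this.ne',
      ENNReal.ofReal_one]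
  simp_rw [h3]
  simp

/-- `x(t) = tanh t` as an isomorphism of measurable spaces. -/
def xEquiv : ℝ ≃ᵐ G where
  toFun := xG
  invFun := tG
  left_inv := tG_xG
  right_inv := xG_tG
  measurable_toFun := continuous_xG.measurable
  measurable_invFun := measurable_tG

lemma integral_dG (f : G → ℂ) : ∫ y, f y ∂dG = ∫ t, f (xG t) :=
  (measurePreserving_xG.integral_comp xEquiv.measurableEmbedding f).symm

/-! ### The Schwartz spaces `𝕊(G)` and `𝕊'(G)` -/

/-- The pull back `(t_* φ)(x) = φ(t(x))` on Schwartz functions. -/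
def pullback : 𝓢(ℝ, ℂ) →ₗ[ℂ] (G → ℂ) where
  toFun φ := fun x => φ (tG x)
  map_add' _ _ := rfl
  map_smul' _ _ := rfl

lemma pullback_injective : Function.Injective pullback := by
  intro φ ψ h
  ext t
  have := congrFun h (xG t)
  simpa [pullback] using this

/-- `𝕊(G)`, the space of functions on `G` which is the image of `𝕊(ℝ)` under `t_*`. -/
def SchwartzG : Type := LinearMap.range pullback

instance : AddCommGroup SchwartzG := inferInstanceAs (AddCommGroup (LinearMap.range pullback))

instance : Module ℂ SchwartzG := inferInstanceAs (Module ℂ (LinearMap.range pullback))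

instance : CoeFun SchwartzG fun _ => G → ℂ := ⟨fun v => v.1⟩

/-- `t_* : 𝕊(ℝ) → 𝕊(G)` as a linear isomorphism. -/
def tStarLin : 𝓢(ℝ, ℂ) ≃ₗ[ℂ] SchwartzG := LinearEquiv.ofInjective pullback pullback_injective

/-- The topology of `𝕊(G)` is the one which `t_*` transports from `𝕊(ℝ)`. -/
instance : TopologicalSpace SchwartzG := TopologicalSpace.induced tStarLin.symm inferInstance

instance : IsTopologicalAddGroup SchwartzG := topologicalAddGroup_induced tStarLin.symm

instance : ContinuousSMul ℂ SchwartzG := continuousSMul_induced tStarLin.symm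

/-- `t_* : 𝕊(ℝ) → 𝕊(G)`, `(t_* φ)(x) = φ(t(x))`, with inverse `x_*`. -/
def tStar : 𝓢(ℝ, ℂ) ≃L[ℂ] SchwartzG where
  toLinearEquiv := tStarLin
  continuous_toFun := continuous_induced_rng.2 <| by
    convert continuous_id
    ext1 φ
    exact tStarLin.symm_apply_apply φ
  continuous_invFun := continuous_induced_dom

/-- `x_* : 𝕊(G) → 𝕊(ℝ)`, `(x_* v)(t) = v(tanh t)`. -/
def xStar : SchwartzG ≃L[ℂ] 𝓢(ℝ, ℂ) := tStar.symm

@[simp] lemma tStar_apply (φ : 𝓢(ℝ, ℂ)) (x : G) : tStar φ x = φ (tG x) := rfl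

@[simp] lemma xStar_apply (v : SchwartzG) (t : ℝ) : xStar v t = v (xG t) := by
  have h : tStar (xStar v) = v := tStar.apply_symm_apply v
  conv_rhs => rw [← h]
  simp

/-- `𝕊'(G)`, the space of continuous linear functionals on `𝕊(G)`. -/
abbrev DistG : Type := SchwartzG →Lₚₜ[ℂ] ℂ

/-! ### The Fourier transforms -/

/-- The dilation `(D_c ψ)(ξ) = ψ(c ξ)` on `𝕊(ℝ)`, for `c ≠ 0`. -/
def dilation (c : ℝ) (hc : c ≠ 0) : 𝓢(ℝ, ℂ) ≃L[ℂ] 𝓢(ℝ, ℂ) :=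
  ContinuousLinearEquiv.equivOfInverse
    (SchwartzMap.compCLMOfContinuousLinearEquiv ℂ
      (ContinuousLinearEquiv.unitsEquivAut ℝ (Units.mk0 c hc)))
    (SchwartzMap.compCLMOfContinuousLinearEquiv ℂ
      (ContinuousLinearEquiv.unitsEquivAut ℝ (Units.mk0 c hc)).symm)
    (fun φ => by ext x; simp [hc])
    (fun φ => by ext x; simp [hc])

@[simp] lemma dilation_apply (c : ℝ) (hc : c ≠ 0) (φ : 𝓢(ℝ, ℂ)) (ξ : ℝ) :
    dilation c hc φ ξ = φ (c * ξ) := by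
  simp [dilation, mul_comm]

lemma neg_inv_two_pi_ne_zero : -(1 / (2 * Real.pi)) ≠ 0 := by
  have := Real.pi_pos
  exact neg_ne_zero.2 (by positivity)

/-- The Fourier transform `(F_ℝ φ)(ξ) = ∫ exp(iξt) φ(t) dt` on `𝕊(ℝ)`, without a constant in front
of the integral and with the positive sign in the exponent. -/
def fourierR : 𝓢(ℝ, ℂ) ≃L[ℂ] 𝓢(ℝ, ℂ) :=
  (FourierTransform.fourierCLE ℂ 𝓢(ℝ, ℂ)).trans
    (dilation (-(1 / (2 * Real.pi))) neg_inv_two_pi_ne_zero)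

lemma fourierR_apply (φ : 𝓢(ℝ, ℂ)) (ξ : ℝ) :
    fourierR φ ξ = ∫ t : ℝ, Complex.exp (Complex.I * (ξ : ℂ) * (t : ℂ)) * φ t := by
  have hpi := Real.pi_ne_zero
  simp only [fourierR, ContinuousLinearEquiv.trans_apply, FourierTransform.fourierCLE_apply,
    dilation_apply, SchwartzMap.fourier_coe]
  rw [Real.fourier_real_eq_integral_exp_smul]
  congr 1
  ext t
  rw [smul_eq_mul]
  congr 2
  push_cast
  field_simp

/-- The Fourier transform `F_G : 𝕊(G) → 𝕊(ℝ)`. -/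
def fourierG : SchwartzG ≃L[ℂ] 𝓢(ℝ, ℂ) :=
  (xStar.trans fourierR).trans (dilation 2 two_ne_zero)

/-- `(F_G v)(ξ) = ∫ ((1+y)/(1-y))^(iξ) v(y) dG(y)`. -/
lemma fourierG_apply (v : SchwartzG) (ξ : ℝ) :
    fourierG v ξ = ∫ y, character y ξ * v y ∂dG := by
  rw [integral_dG]
  simp [fourierG, fourierR_apply, character_eq_exp]

/-- The transposed Fourier transform `𝕊(ℝ) → 𝕊(G)`. -/
def fourierGTr : 𝓢(ℝ, ℂ) ≃L[ℂ] SchwartzG :=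
  (fourierR.trans (dilation 2 two_ne_zero)).trans tStar

/-- The transposed Fourier transform is `ψ ↦ ∫ ((1+x)/(1-x))^(iξ) ψ(ξ) dξ`. -/
lemma fourierGTr_apply (ψ : 𝓢(ℝ, ℂ)) (x : G) :
    fourierGTr ψ x = ∫ ξ, character x ξ * ψ ξ := by
  simp only [fourierGTr, ContinuousLinearEquiv.trans_apply, tStar_apply, dilation_apply,
    fourierR_apply, character_eq_exp]
  congr 1
  ext t
  congr 2
  push_cast
  ring

/-- The Fourier transform on `𝕊'(ℝ)`, by duality; the kernel `exp(iξt)` is symmetric, so that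
`⟨F_ℝ f, ψ⟩ = ⟨f, F_ℝ ψ⟩`. -/
def fourierDistR : 𝓢'(ℝ, ℂ) →L[ℂ] 𝓢'(ℝ, ℂ) :=
  PointwiseConvergenceCLM.precomp ℂ (fourierR : 𝓢(ℝ, ℂ) →L[ℂ] 𝓢(ℝ, ℂ))

/-- The Fourier transform `F_G : 𝕊'(G) → 𝕊'(ℝ)`, by duality. -/
def fourierDistG : DistG →L[ℂ] 𝓢'(ℝ, ℂ) :=
  PointwiseConvergenceCLM.precomp ℂ (fourierGTr : 𝓢(ℝ, ℂ) →L[ℂ] SchwartzG)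

/-- The inverse Fourier transform `F_G⁻¹ : 𝕊'(ℝ) → 𝕊'(G)`. -/
def fourierDistGInv : 𝓢'(ℝ, ℂ) →L[ℂ] DistG :=
  PointwiseConvergenceCLM.precomp ℂ (fourierGTr.symm : SchwartzG →L[ℂ] 𝓢(ℝ, ℂ))

@[simp] lemma fourierDistG_apply (f : DistG) (ψ : 𝓢(ℝ, ℂ)) :
    fourierDistG f ψ = f (fourierGTr ψ) := rfl

@[simp] lemma fourierDistGInv_apply (f : 𝓢'(ℝ, ℂ)) (v : SchwartzG) :
    fourierDistGInv f v = f (fourierGTr.symm v) := rfl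

lemma fourierDistGInv_fourierDistG (f : DistG) : fourierDistGInv (fourierDistG f) = f := by
  ext v; simp

lemma fourierDistG_fourierDistGInv (f : 𝓢'(ℝ, ℂ)) : fourierDistG (fourierDistGInv f) = f := by
  ext v; simp

/-! ### Functions as distributions on `G` -/

/-- A Schwartz function on `G` as a distribution, `v ↦ ∫ u v dG`. -/
def SchwartzG.toDist (u : SchwartzG) : DistG :=
  PointwiseConvergenceCLM.precomp ℂ (xStar : SchwartzG →L[ℂ] 𝓢(ℝ, ℂ))
    (SchwartzMap.toTemperedDistributionCLM ℝ ℂ volume (xStar u))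

lemma SchwartzG.toDist_apply (u v : SchwartzG) : u.toDist v = ∫ y, u y * v y ∂dG := by
  have h : u.toDist v = ∫ t, xStar v t * xStar u t :=
    SchwartzMap.toTemperedDistributionCLM_apply_apply volume (xStar u) (xStar v)
  rw [h, integral_dG]
  simp [mul_comm]

/-- On Schwartz functions the distributional Fourier transform is the classical one. -/
lemma fourierDistG_toDist (u : SchwartzG) :
    fourierDistG u.toDist = SchwartzMap.toTemperedDistributionCLM ℝ ℂ volume (fourierG u) := by
  ext ψ
  have h1 : fourierDistG u.toDist ψ = ∫ t, xStar (fourierGTr ψ) t * xStar u t :=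
    SchwartzMap.toTemperedDistributionCLM_apply_apply volume (xStar u) (xStar (fourierGTr ψ))
  have h2 : SchwartzMap.toTemperedDistributionCLM ℝ ℂ volume (fourierG u) ψ
      = ∫ ξ, ψ ξ * fourierG u ξ :=
    SchwartzMap.toTemperedDistributionCLM_apply_apply volume (fourierG u) ψ
  rw [h1, h2]
  have hpi := Real.pi_ne_zero
  let L : ℝ →ₗ[ℝ] ℝ →ₗ[ℝ] ℝ := (-(1 / Real.pi)) • LinearMap.mul ℝ ℝ
  have hL : ∀ x y, L x y = -(1 / Real.pi) * (x * y) := fun x y => rfl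
  have key := VectorFourier.integral_fourierIntegral_smul_eq_flip (L := L) (μ := volume)
    (ν := volume) Real.continuous_fourierChar (by simp only [hL]; fun_prop) ψ.integrable
    (xStar u).integrable
  have hF : ∀ (φ : 𝓢(ℝ, ℂ)) (ξ : ℝ),
      VectorFourier.fourierIntegral Real.fourierChar volume L φ ξ = fourierR φ (2 * ξ) := by
    intro φ ξ
    rw [fourierR_apply, VectorFourier.fourierIntegral]
    congr 1
    ext t
    rw [Circle.smul_def, Real.fourierChar_apply, hL, smul_eq_mul]
    congr 2
    push_cast
    field_simp
  have hflip : L.flip = L := by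
    ext
    simp [L]
  rw [hflip] at key
  simp only [hF, smul_eq_mul] at key
  simpa [fourierGTr, fourierG] using key

variable (p : ℝ≥0∞) [Fact (1 ≤ p)]

/-- The isometry `x_* : L_p(G,dG) → L_p(ℝ)`. -/
def xStarLp : Lp ℂ p dG →ₗᵢ[ℂ] Lp ℂ p (volume : Measure ℝ) :=
  Lp.compMeasurePreservingₗᵢ ℂ xG measurePreserving_xG

/-- A function in `L_p(G,dG)` as a distribution, `v ↦ ∫ f v dG`. -/
def lpToDist : Lp ℂ p dG →ₗ[ℂ] DistG :=
  (PointwiseConvergenceCLM.precomp ℂ (xStar : SchwartzG →L[ℂ] 𝓢(ℝ, ℂ))).toLinearMap ∘ₗ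
    (Lp.toTemperedDistributionCLM ℂ volume p).toLinearMap ∘ₗ (xStarLp p).toLinearMap

lemma lpToDist_apply (f : Lp ℂ p dG) (v : SchwartzG) :
    lpToDist p f v = ∫ y, f y * v y ∂dG := by
  have h : lpToDist p f v = ∫ t, xStar v t * xStarLp p f t :=
    Lp.toTemperedDistribution_apply (xStarLp p f) (xStar v)
  rw [h, integral_dG]
  refine integral_congr_ae ?_
  filter_upwards [Lp.coeFn_compMeasurePreserving f measurePreserving_xG] with t ht
  have ht' : xStarLp p f t = f (xG t) := ht
  rw [ht', xStar_apply, mul_comm]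

lemma lpToDist_injective : Function.Injective (lpToDist p) := by
  have h1 : Function.Injective (Lp.toTemperedDistributionCLM ℂ (volume : Measure ℝ) p) :=
    LinearMap.ker_eq_bot.1 Lp.ker_toTemperedDistributionCLM_eq_bot
  have h2 : Function.Injective (fun T : 𝓢'(ℝ, ℂ) =>
      (PointwiseConvergenceCLM.precomp ℂ (xStar : SchwartzG →L[ℂ] 𝓢(ℝ, ℂ)) T : DistG)) := by
    intro f g hfg
    ext φ
    have h : f (xStar (xStar.symm φ)) = g (xStar (xStar.symm φ)) :=
      DFunLike.congr_fun hfg (xStar.symm φ)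
    simpa using h
  exact h2.comp (h1.comp (xStarLp p).injective)

/-! ### Bessel potential spaces on `G` -/

/-- `⟨ξ⟩ ^ r = (1 + ξ²) ^ (r/2)`. -/
def bracket (r ξ : ℝ) : ℝ := (1 + ξ ^ 2) ^ (r / 2)

lemma bracket_hasTemperateGrowth (r : ℝ) :
    Function.HasTemperateGrowth fun ξ : ℝ => (bracket r ξ : ℂ) := by
  have h := Function.hasTemperateGrowth_one_add_norm_sq_rpow ℝ (r / 2)
  simp only [Real.norm_eq_abs, sq_abs] at h
  unfold bracket
  fun_prop

lemma bracket_mul_bracket_neg (r : ℝ) :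
    (fun ξ : ℝ => (bracket r ξ : ℂ)) * (fun ξ : ℝ => (bracket (-r) ξ : ℂ)) = fun _ => 1 := by
  ext ξ
  have h : bracket r ξ * bracket (-r) ξ = 1 := by
    rw [bracket, bracket, ← Real.rpow_add (by positivity)]
    simp [neg_div]
  simp only [Pi.mul_apply]
  exact_mod_cast h

/-- The Bessel potential operator `Λ^s = F_G⁻¹ ⟨ξ⟩^s F_G` on `𝕊'(G)`. -/
def bessel (s : ℝ) : DistG →L[ℂ] DistG :=
  fourierDistGInv ∘L
    TemperedDistribution.smulLeftCLM ℂ (fun ξ : ℝ => (bracket s ξ : ℂ)) ∘L fourierDistG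

lemma bessel_apply (s : ℝ) (f : DistG) : bessel s f = fourierDistGInv
    (TemperedDistribution.smulLeftCLM ℂ (fun ξ : ℝ => (bracket s ξ : ℂ)) (fourierDistG f)) := rfl

lemma bessel_neg_bessel (s : ℝ) (f : DistG) : bessel (-s) (bessel s f) = f := by
  rw [bessel_apply, bessel_apply, fourierDistG_fourierDistGInv,
    TemperedDistribution.smulLeftCLM_smulLeftCLM_apply (bracket_hasTemperateGrowth _)
      (bracket_hasTemperateGrowth _)]
  rw [bracket_mul_bracket_neg, TemperedDistribution.smulLeftCLM_const, one_smul, fourierDistGInv_fourierDistG]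

lemma bessel_bessel_neg (s : ℝ) (f : DistG) : bessel s (bessel (-s) f) = f := by
  simpa using bessel_neg_bessel (-s) f

/-- The Bessel potential operator on `𝕊(G)`. -/
def besselS (s : ℝ) (u : SchwartzG) : SchwartzG :=
  fourierG.symm (SchwartzMap.smulLeftCLM ℂ (fun ξ : ℝ => (bracket s ξ : ℂ)) (fourierG u))

lemma bessel_toDist (s : ℝ) (u : SchwartzG) : bessel s u.toDist = (besselS s u).toDist := by
  have h : fourierDistG (bessel s u.toDist) = fourierDistG (besselS s u).toDist := by
    rw [bessel_apply, fourierDistG_fourierDistGInv, fourierDistG_toDist, fourierDistG_toDist]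
    ext ψ
    rw [TemperedDistribution.smulLeftCLM_apply_apply]
    have h1 := SchwartzMap.toTemperedDistributionCLM_apply_apply (volume : Measure ℝ) (fourierG u)
      (SchwartzMap.smulLeftCLM ℂ (fun ξ : ℝ => (bracket s ξ : ℂ)) ψ)
    have h2 := SchwartzMap.toTemperedDistributionCLM_apply_apply (volume : Measure ℝ)
      (fourierG (besselS s u)) ψ
    refine h1.trans (Eq.trans ?_ h2.symm)
    congr 1
    ext ξ
    simp [besselS, SchwartzMap.smulLeftCLM_apply_apply (bracket_hasTemperateGrowth s)]
    ring
  rw [← fourierDistGInv_fourierDistG (bessel s u.toDist), h, fourierDistGInv_fourierDistG]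

/-- The distributions `f ∈ 𝕊'(G)` with `Λ^s f ∈ L_p(G,dG)`. -/
def besselSubmodule (s : ℝ) : Submodule ℂ DistG :=
  (LinearMap.range (lpToDist p)).comap (bessel s).toLinearMap

/-- The Bessel potential space `H^s_p(G,dG)`, with the norm `‖f‖ = ‖Λ^s f‖` in `L_p(G,dG)`. -/
def BesselSpace (s : ℝ) : Type := besselSubmodule p s

instance (s : ℝ) : AddCommGroup (BesselSpace p s) := inferInstanceAs (AddCommGroup (besselSubmodule p s))

instance (s : ℝ) : Module ℂ (BesselSpace p s) := inferInstanceAs (Module ℂ (besselSubmodule p s))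

variable {p}

/-- An element of `H^s_p(G,dG)` as a distribution. -/
def BesselSpace.toDist {s : ℝ} : BesselSpace p s →ₗ[ℂ] DistG := (besselSubmodule p s).subtype

lemma BesselSpace.toDist_injective {s : ℝ} :
    Function.Injective (BesselSpace.toDist : BesselSpace p s →ₗ[ℂ] DistG) := Subtype.val_injective

variable (p) in
/-- `Λ^s` as a linear map from `H^s_p(G,dG)` to `L_p(G,dG)`. -/
def potential (s : ℝ) : BesselSpace p s →ₗ[ℂ] Lp ℂ p dG :=
  (LinearEquiv.ofInjective (lpToDist p) (lpToDist_injective p)).symm.toLinearMap ∘ₗ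
    ((bessel s).toLinearMap.restrict (p := besselSubmodule p s)
      (q := LinearMap.range (lpToDist p)) fun _ hf => hf)

lemma lpToDist_potential {s : ℝ} (f : BesselSpace p s) :
    lpToDist p (potential p s f) = bessel s f.toDist :=
  congrArg Subtype.val ((LinearEquiv.ofInjective (lpToDist p)
    (lpToDist_injective p)).apply_symm_apply ⟨bessel s f.toDist, f.2⟩)

lemma potential_injective (s : ℝ) : Function.Injective (potential p s) := by
  intro f g h
  have h' := congrArg (lpToDist p) h
  rw [lpToDist_potential, lpToDist_potential] at h'
  apply BesselSpace.toDist_injective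
  rw [← bessel_neg_bessel s f.toDist, h', bessel_neg_bessel]

instance (s : ℝ) : NormedAddCommGroup (BesselSpace p s) :=
  NormedAddCommGroup.induced _ _ (potential p s) (potential_injective s)

instance (s : ℝ) : NormedSpace ℂ (BesselSpace p s) := NormedSpace.induced ℂ _ _ (potential p s)

lemma BesselSpace.norm_eq {s : ℝ} (f : BesselSpace p s) : ‖f‖ = ‖potential p s f‖ := rfl

lemma potential_surjective (s : ℝ) : Function.Surjective (potential p s) := by
  intro g
  let f : BesselSpace p s := ⟨bessel (-s) (lpToDist p g), ⟨g, (bessel_bessel_neg s _).symm⟩⟩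
  refine ⟨f, lpToDist_injective p ?_⟩
  rw [lpToDist_potential]
  exact bessel_bessel_neg s _

instance (s : ℝ) : CompleteSpace (BesselSpace p s) :=
  (LinearIsometryEquiv.ofSurjective (σ₁₂ := RingHom.id ℂ) ⟨potential p s, fun _ => rfl⟩
    (potential_surjective s)).toIsometryEquiv.completeSpace_iff.2 inferInstance

variable (p) in
lemma exists_lpToDist_eq_toDist (u : SchwartzG) :
    ∃ g : Lp ℂ p dG, xStarLp p g = (xStar u).toLp p ∧ lpToDist p g = u.toDist := by
  have hmem : MemLp u p dG := by
    have h1 : MemLp (xStar u) p volume := (xStar u).memLp p volume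
    have h2 : (xStar u : ℝ → ℂ) = (u : G → ℂ) ∘ xG := by ext t; simp
    rw [h2] at h1
    rw [← measurePreserving_xG.map_eq]
    exact (xEquiv.measurableEmbedding.memLp_map_measure_iff).2 h1
  refine ⟨hmem.toLp u, ?_, ?_⟩
  · apply Lp.ext
    have h1 := Lp.coeFn_compMeasurePreserving (hmem.toLp u) measurePreserving_xG
    have h2 := measurePreserving_xG.quasiMeasurePreserving.ae_eq_comp hmem.coeFn_toLp
    have h3 := (xStar u).coeFn_toLp p (volume : Measure ℝ)
    filter_upwards [h1, h2, h3] with t ht1 ht2 ht3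
    have ht1' : xStarLp p (hmem.toLp u) t = hmem.toLp u (xG t) := ht1
    rw [ht1', ht3, xStar_apply]
    exact ht2
  · ext v
    rw [lpToDist_apply, SchwartzG.toDist_apply]
    refine integral_congr_ae ?_
    filter_upwards [hmem.coeFn_toLp] with y hy
    rw [hy]

variable (p) in
/-- The inclusion of `𝕊(G)` in `H^s_p(G,dG)`. -/
def SchwartzG.toH (s : ℝ) (u : SchwartzG) : BesselSpace p s :=
  ⟨u.toDist, by
    obtain ⟨g, -, hg⟩ := exists_lpToDist_eq_toDist p (besselS s u)
    exact ⟨g, hg.trans (bessel_toDist s u).symm⟩⟩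

/-! ### Multipliers and convolution operators -/

/-- The tempered distribution `F` is the function `f`: `f ψ` is integrable and `⟨F, ψ⟩ = ∫ f ψ` for
every Schwartz function `ψ`. -/
def IsFunction (F : 𝓢'(ℝ, ℂ)) (f : ℝ → ℂ) : Prop :=
  ∀ ψ : 𝓢(ℝ, ℂ), Integrable (fun ξ => f ξ * ψ ξ) ∧ F ψ = ∫ ξ, f ξ * ψ ξ

variable (p) in
/-- The class `𝔐_p(ℝ)` of Fourier `L_p(ℝ)`-multipliers: the functions `a` for which
`W⁰_a = F_ℝ⁻¹ a F_ℝ`, given on `𝕊(ℝ)`, extends to a bounded operator in `L_p(ℝ)`. -/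
def multipliers : Set (ℝ → ℂ) :=
  {a | ∃ T : Lp ℂ p (volume : Measure ℝ) →L[ℂ] Lp ℂ p (volume : Measure ℝ), ∀ φ : 𝓢(ℝ, ℂ),
    IsFunction (fourierDistR (Lp.toTemperedDistributionCLM ℂ volume p (T (φ.toLp p))))
      (fun ξ => a ξ * fourierR φ ξ)}

variable (p) in
/-- `𝔐^r_p(ℝ) = ⟨ξ⟩^r 𝔐_p(ℝ)`. -/
def multipliersOfOrder (r : ℝ) : Set (ℝ → ℂ) :=
  {b | ∃ a ∈ multipliers p, b = fun ξ => (bracket r ξ : ℂ) * a ξ}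

/-- The bounded operator `T : H^s_p(G,dG) → H^σ_p(G,dG)` is (the extension by continuity of) the
convolution operator `W⁰_{G,a} = F_G⁻¹ a F_G`: one has `F_G T u = a F_G u` for all `u ∈ 𝕊(G)`. -/
def IsConvolution {s σ : ℝ} (a : ℝ → ℂ) (T : BesselSpace p s →L[ℂ] BesselSpace p σ) : Prop :=
  ∀ u : SchwartzG, IsFunction (fourierDistG (T (u.toH p s)).toDist) (fun ξ => a ξ * fourierG u ξ)

lemma besselS_surjective (s : ℝ) : Function.Surjective (besselS s) := by
  intro u
  refine ⟨besselS (-s) u, fourierG.injective ?_⟩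
  ext ξ
  have h := congrFun (bracket_mul_bracket_neg s) ξ
  simp only [Pi.mul_apply] at h
  simp [besselS, SchwartzMap.smulLeftCLM_apply_apply (bracket_hasTemperateGrowth s),
    SchwartzMap.smulLeftCLM_apply_apply (bracket_hasTemperateGrowth (-s)), ← mul_assoc, h]

/-- `𝕊(G)` is dense in `H^s_p(G,dG)` for `p < ∞`. -/
lemma denseRange_toH (hp : p ≠ ∞) (s : ℝ) : DenseRange (SchwartzG.toH p s) := by
  let Φ : BesselSpace p s →ₗᵢ[ℂ] Lp ℂ p (volume : Measure ℝ) :=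
    (xStarLp p).comp ⟨potential p s, fun _ => rfl⟩
  have hΦ : ∀ u : SchwartzG, Φ (u.toH p s) = (xStar (besselS s u)).toLp p := by
    intro u
    obtain ⟨g, hg1, hg2⟩ := exists_lpToDist_eq_toDist p (besselS s u)
    rw [← hg1]
    refine congrArg (xStarLp p) (lpToDist_injective p ?_)
    rw [hg2, ← bessel_toDist]
    exact lpToDist_potential _
  intro f
  have hd := SchwartzMap.denseRange_toLpCLM (F := ℂ) (E := ℝ) (μ := volume) hp (Φ f)
  rw [Metric.mem_closure_range_iff] at hd ⊢
  intro ε hε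
  obtain ⟨φ, hφ⟩ := hd ε hε
  obtain ⟨u, hu⟩ := besselS_surjective s (xStar.symm φ)
  refine ⟨u, ?_⟩
  have h : Φ (u.toH p s) = φ.toLp p := by
    rw [hΦ, hu]
    simp
  rw [← Φ.dist_map, h]
  exact hφ

/-- There is at most one bounded operator which extends `W⁰_{G,a}`. -/
lemma IsConvolution.unique (hp : p ≠ ∞) {s σ : ℝ} {a : ℝ → ℂ} {T T' : BesselSpace p s →L[ℂ] BesselSpace p σ}
    (hT : IsConvolution a T) (hT' : IsConvolution a T') : T = T' := by
  have h : (T : BesselSpace p s → BesselSpace p σ) ∘ SchwartzG.toH p s = T' ∘ SchwartzG.toH p s := by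
    ext1 u
    apply BesselSpace.toDist_injective
    change BesselSpace.toDist (T (u.toH p s)) = BesselSpace.toDist (T' (u.toH p s))
    rw [← fourierDistGInv_fourierDistG (BesselSpace.toDist (T (u.toH p s))),
      ← fourierDistGInv_fourierDistG (BesselSpace.toDist (T' (u.toH p s)))]
    congr 1
    ext ψ
    exact (hT u ψ).2.trans (hT' u ψ).2.symm
  exact DFunLike.coe_injective ((denseRange_toH hp s).equalizer T.continuous T'.continuous h)

/-- The reduced symbol `a_{-r}(ξ) = ⟨ξ⟩^{-r} a(ξ)`. -/
def reduced (r : ℝ) (a : ℝ → ℂ) : ℝ → ℂ := fun ξ => (bracket (-r) ξ : ℂ) * a ξ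

/-- Ellipticity, `inf |⟨ξ⟩^{-r} a(ξ)| > 0`, with the essential infimum. -/
def IsElliptic (r : ℝ) (a : ℝ → ℂ) : Prop := ∃ c : ℝ, 0 < c ∧ ∀ᵐ ξ : ℝ, c ≤ ‖reduced r a ξ‖

/-- The Wiener class: the functions `c + F_ℝ k` with a constant `c` and `k ∈ L_1(ℝ)`. -/
def wienerClass : Set (ℝ → ℂ) :=
  {a | ∃ (c : ℂ) (k : ℝ → ℂ), Integrable k ∧
    ∀ ξ : ℝ, a ξ = c + ∫ t : ℝ, Complex.exp (Complex.I * (ξ : ℂ) * (t : ℂ)) * k t}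

end LieConv

end

open LieConv

open MeasureTheory Set
open scoped ENNReal SchwartzMap FourierTransform

noncomputable section

open scoped NNReal
open LieConv Filter Topology

namespace LieConv

/-! ### Fourier integrals of integrable functions -/

/-! A Bessel potential followed by the substitution x = tanh t maps H^s_p(G,dG) isometrically onto
L_p(ℝ) (`besselEquiv`). Under these isometries W⁰_{G,a} becomes the Fourier multiplier of L_p(ℝ)
with the symbol ⟨ξ⟩^{-r} a(ξ), up to a dilation of the frequency variable, which does not affect
multiplier norms (`isConvolution_iff`). The theorem is thus a statement about multipliers on the
line. Their quantitative form is `MulBound`: an essentially bounded symbol together with an L_p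
estimate on Schwartz functions.

Boundedness: a bounded extension with a given symbol is the same as a `MulBound`. The substantial
direction is that the symbol of a bounded operator is automatically essentially bounded. This
follows from testing on wave packets whose frequencies concentrate at a Lebesgue point of the symbol
(`IsSymbol.ae_norm_le`).

Fredholm implies elliptic: at a Lebesgue point η a narrow wave packet is almost an eigenfunction
with eigenvalue m(η), uniformly over its translates (`exists_packet_norm_le`). An operator K of
finite rank is small on some translate of any given function: n disjoint translates have a sum of
norm O(n^{1/p}), so their averages tend to 0, while K of the translates has a convergent subsequence
(`exists_norm_translate_le`). Hence RT = I + K forces a lower bound 1 ≤ ‖R‖ |m(η)|. The packet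
estimate interpolates between L² and L^∞ and needs p ≥ 2; for p ≤ 2 one uses TR = I + K and the
transpose of T in the conjugate space.

Invertibility: the symbol and its inverse both have to be multipliers, and multipliers with
reciprocal symbols are inverse operators (`IsSymbol.comp_eq_id`). The indicator of a half-line is a
multiplier by M. Riesz's argument with powers of the Cauchy integral for p ≤ 2, and by duality for p
≥ 2. Functions of bounded variation are bounded limits of step functions, and inversion away from 0
extends to a Lipschitz map, which preserves bounded variation. Symbols c + 𝓕 k are multipliers by
Young's inequality. For their inverses, k is replaced by a nearby Schwartz function g; powers of (c
+ 𝓕 g)⁻¹ have bounded variation with norms growing almost geometrically, so a Neumann series in the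
small remainder converges (`exists_mulBound_inv_add_fourier`). -/

lemma ae_eq_of_forall_integral_mul_schwartz {f g : ℝ → ℂ} (hf : LocallyIntegrable f)
    (hg : LocallyIntegrable g) (h : ∀ ψ : 𝓢(ℝ, ℂ), ∫ x, f x * ψ x = ∫ x, g x * ψ x) :
    f =ᵐ[volume] g := by
  refine ae_eq_of_integral_contDiff_smul_eq hf hg fun u hu hsu => ?_
  have h₁ : HasCompactSupport (fun x => (u x : ℂ)) := hsu.comp_left Complex.ofReal_zero
  have h₂ : ContDiff ℝ (⊤ : ℕ∞) (fun x => (u x : ℂ)) := Complex.ofRealCLM.contDiff.comp hu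
  have := h (h₁.toSchwartzMap h₂)
  simpa [mul_comm] using this

lemma integral_fourierInv_mul {f g : ℝ → ℂ} (hf : Integrable f) (hg : Integrable g) :
    ∫ x, 𝓕⁻ f x * g x = ∫ ξ, f ξ * 𝓕⁻ g ξ := by
  have h := VectorFourier.integral_fourierIntegral_smul_eq_flip (L := (-innerₗ ℝ)) (μ := volume)
    (ν := volume) Real.continuous_fourierChar (by simp only [LinearMap.neg_apply]; fun_prop) hf hg
  have hL : (-innerₗ ℝ : ℝ →ₗ[ℝ] ℝ →ₗ[ℝ] ℝ).flip = -innerₗ ℝ := by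
    ext; simp
  rw [hL] at h
  have h2 : ∀ (u : ℝ → ℂ) (x : ℝ),
      VectorFourier.fourierIntegral Real.fourierChar volume (-innerₗ ℝ) u x = 𝓕⁻ u x := by
    intro u x
    rw [Real.fourierInv_eq, VectorFourier.fourierIntegral]
    simp
  simpa only [h2, smul_eq_mul] using h

lemma norm_fourierInv_le (f : ℝ → ℂ) (x : ℝ) : ‖𝓕⁻ f x‖ ≤ ∫ ξ, ‖f ξ‖ := by
  rw [Real.fourierInv_eq]
  refine (norm_integral_le_integral_norm _).trans (le_of_eq ?_)
  simp

lemma continuous_fourierInv {f : ℝ → ℂ} (hf : Integrable f) : Continuous (𝓕⁻ f) := by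
  rw [Real.fourierInv_eq_fourier_comp_neg]
  exact VectorFourier.fourierIntegral_continuous Real.continuous_fourierChar
    (by fun_prop) hf.comp_neg

/-- On `L¹ ∩ L²` the Fourier integral represents the `L²` Fourier transform. -/
lemma fourierInv_toLp_ae_eq {f : ℝ → ℂ} (hf : Integrable f) (hf2 : MemLp f 2) :
    (𝓕⁻ (hf2.toLp f) : Lp ℂ 2 (volume : Measure ℝ)) =ᵐ[volume] 𝓕⁻ f := by
  set F := hf2.toLp f
  refine ae_eq_of_forall_integral_mul_schwartz
    ((Lp.memLp (𝓕⁻ F)).locallyIntegrable (by norm_num))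
    (continuous_fourierInv hf).locallyIntegrable fun ψ => ?_
  have h := DFunLike.congr_fun (Lp.fourierInv_toTemperedDistribution_eq F) ψ
  rw [TemperedDistribution.fourierInv_apply, Lp.toTemperedDistribution_apply,
    Lp.toTemperedDistribution_apply] at h
  have h2 := integral_fourierInv_mul hf ψ.integrable
  rw [h2]
  simp only [smul_eq_mul] at h
  simp_rw [mul_comm _ (ψ _)]
  rw [← h]
  refine integral_congr_ae ?_
  filter_upwards [hf2.coeFn_toLp] with x hx
  rw [SchwartzMap.fourierInv_coe, hx, mul_comm]

lemma eLpNorm_fourierInv_two {f : ℝ → ℂ} (hf : Integrable f) (hf2 : MemLp f 2) :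
    eLpNorm (𝓕⁻ f) 2 = eLpNorm f 2 := by
  rw [← eLpNorm_congr_ae (fourierInv_toLp_ae_eq hf hf2), ← Lp.enorm_def,
    ← eLpNorm_congr_ae hf2.coeFn_toLp, ← Lp.enorm_def]
  have h : ‖(𝓕⁻ (hf2.toLp f) : Lp ℂ 2 (volume : Measure ℝ))‖ = ‖hf2.toLp f‖ := by
    rw [← Lp.norm_fourier_eq, FourierTransform.fourier_fourierInv_eq]
  rw [← ofReal_norm, ← ofReal_norm, h]

lemma fourierInv_conj_neg (g : ℝ → ℂ) (x : ℝ) :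
    𝓕⁻ (fun ξ => (starRingEnd ℂ) (g (-ξ))) x = (starRingEnd ℂ) (𝓕⁻ g x) := by
  rw [Real.fourierInv_eq', Real.fourierInv_eq', ← integral_conj, ← integral_neg_eq_self]
  refine integral_congr_ae (.of_forall fun ξ => ?_)
  simp only [smul_eq_mul, neg_neg, map_mul, ← Complex.exp_conj, Complex.conj_ofReal, Complex.conj_I]
  congr 2
  simp

/-- Parseval's identity on `L¹ ∩ L²`. -/
lemma integral_fourierInv_mul_fourierInv {f g : ℝ → ℂ} (hf : Integrable f) (hf2 : MemLp f 2)
    (hg : Integrable g) (hg2 : MemLp g 2) :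
    ∫ x, 𝓕⁻ f x * 𝓕⁻ g x = ∫ ξ, f ξ * g (-ξ) := by
  -- The L² inner product conjugates its first argument; conjugating and reflecting `g` beforehand
  -- turns it into the bilinear integral.
  let G : ℝ → ℂ := fun ξ => (starRingEnd ℂ) (g (-ξ))
  have hG : Integrable G := (Complex.conjLIE : ℂ ≃ₗᵢ[ℝ] ℂ).toContinuousLinearEquiv.integrable_comp_iff.2
    hg.comp_neg
  have hG2 : MemLp G 2 := by
    have h1 : MemLp (fun ξ => g (-ξ)) 2 :=
      hg2.comp_measurePreserving (Measure.measurePreserving_neg volume)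
    exact h1.star
  have h := Lp.inner_fourier_eq (𝓕⁻ (hG2.toLp G) : Lp ℂ 2 (volume : Measure ℝ))
    (𝓕⁻ (hf2.toLp f) : Lp ℂ 2 (volume : Measure ℝ))
  rw [FourierTransform.fourier_fourierInv_eq, FourierTransform.fourier_fourierInv_eq,
    L2.inner_def, L2.inner_def] at h
  have h1 : ∫ x, 𝓕⁻ f x * 𝓕⁻ g x = ∫ a, inner ℂ ((𝓕⁻ (hG2.toLp G) : Lp ℂ 2 (volume : Measure ℝ)) a)
      ((𝓕⁻ (hf2.toLp f) : Lp ℂ 2 (volume : Measure ℝ)) a) := by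
    refine integral_congr_ae ?_
    filter_upwards [fourierInv_toLp_ae_eq hf hf2, fourierInv_toLp_ae_eq hG hG2] with x hx hx'
    rw [hx, hx', RCLike.inner_apply]
    have := fourierInv_conj_neg g x
    rw [this, Complex.conj_conj]
  rw [h1, ← h]
  refine integral_congr_ae ?_
  filter_upwards [hf2.coeFn_toLp, hG2.coeFn_toLp] with x hx hx'
  rw [hx, hx', RCLike.inner_apply, Complex.conj_conj]

lemma integral_fourier_mul {f g : ℝ → ℂ} (hf : Integrable f) (hg : Integrable g) :
    ∫ x, 𝓕 f x * g x = ∫ ξ, f ξ * 𝓕 g ξ := by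
  have h := VectorFourier.integral_fourierIntegral_smul_eq_flip (L := (innerₗ ℝ)) (μ := volume)
    (ν := volume) Real.continuous_fourierChar (by fun_prop) hf hg
  simpa using! h

/-! ### Scaling and Young's inequality -/

lemma eLpNorm_comp_mul_left {p : ℝ≥0∞} (hp : p ≠ ∞) {f : ℝ → ℂ} (hf : AEStronglyMeasurable f)
    {c : ℝ} (hc : c ≠ 0) :
    eLpNorm (fun x => f (c * x)) p = ENNReal.ofReal |c⁻¹| ^ (1 / p).toReal * eLpNorm f p := by
  have h := Real.map_volume_mul_left hc
  have hf' : AEStronglyMeasurable f (Measure.map (c * ·) volume) := by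
    rw [h]; exact hf.mono_ac Measure.smul_absolutelyContinuous
  have h2 := eLpNorm_map_measure (p := p) hf' (measurable_const_mul c).aemeasurable
  rw [h, eLpNorm_smul_measure_of_ne_top hp] at h2
  exact h2.symm

/-- Write a = a^{1/q} a^{1/p} and apply Hölder to a^{1/q} · (a^{1/p} b(x - ·)); Tonelli and
translation invariance then give the total power p/q + 1 = p of ∫ a. -/
lemma lintegral_lintegral_convolution_rpow_le {a b : ℝ → ℝ≥0∞} (ha : AEMeasurable a)
    (hb : AEMeasurable b) {p : ℝ} (hp : 1 < p) :
    ∫⁻ x, (∫⁻ t, a t * b (x - t)) ^ p ≤ (∫⁻ t, a t) ^ p * ∫⁻ x, b x ^ p := by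
  have hpq := Real.HolderConjugate.conjExponent hp
  set q := p.conjExponent
  have hp0 : 0 < p := by linarith
  have hb' : AEMeasurable (fun z : ℝ × ℝ => b (z.1 - z.2)) (volume.prod volume) :=
    hb.comp_quasiMeasurePreserving (quasiMeasurePreserving_sub volume volume)
  have h1 : ∀ x, (∫⁻ t, a t * b (x - t)) ^ p ≤
      (∫⁻ t, a t) ^ (p / q) * ∫⁻ t, a t * b (x - t) ^ p := by
    intro x
    have hbx : AEMeasurable (fun t => b (x - t)) :=
      hb.comp_quasiMeasurePreserving (Measure.measurePreserving_sub_left volume x).quasiMeasurePreserving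
    have h := ENNReal.lintegral_mul_le_Lp_mul_Lq volume hpq.symm (ha.pow_const (1 / q))
      ((ha.pow_const (1 / p)).mul hbx)
    have e1 : ∀ t, a t ^ (1 / q) * (a t ^ (1 / p) * b (x - t)) = a t * b (x - t) := by
      intro t
      rw [← mul_assoc, ← ENNReal.rpow_add_of_nonneg _ _ (by have := hpq.symm.pos; positivity)
        (by positivity)]
      have := hpq.inv_add_inv_eq_one
      rw [one_div, one_div, add_comm, this, ENNReal.rpow_one]
    have e2 : ∀ t, (a t ^ (1 / q)) ^ q = a t := by
      intro t
      rw [← ENNReal.rpow_mul, one_div, inv_mul_cancel₀ hpq.symm.ne_zero, ENNReal.rpow_one]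
    have e3 : ∀ t, (a t ^ (1 / p) * b (x - t)) ^ p = a t * b (x - t) ^ p := by
      intro t
      rw [ENNReal.mul_rpow_of_nonneg _ _ hp0.le, ← ENNReal.rpow_mul, one_div,
        inv_mul_cancel₀ hp0.ne', ENNReal.rpow_one]
    simp only [Pi.mul_apply, e1, e2, e3] at h
    calc _ ≤ ((∫⁻ t, a t) ^ (1 / q) * (∫⁻ t, a t * b (x - t) ^ p) ^ (1 / p)) ^ p := by gcongr
      _ = _ := by
        rw [ENNReal.mul_rpow_of_nonneg _ _ hp0.le, ← ENNReal.rpow_mul, ← ENNReal.rpow_mul,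
          one_div_mul_cancel hp0.ne', ENNReal.rpow_one, one_div_mul_eq_div]
  calc _ ≤ ∫⁻ x, (∫⁻ t, a t) ^ (p / q) * ∫⁻ t, a t * b (x - t) ^ p := lintegral_mono h1
    _ = (∫⁻ t, a t) ^ (p / q) * ∫⁻ x, ∫⁻ t, a t * b (x - t) ^ p := by
      rw [lintegral_const_mul'']
      exact ((ha.comp_snd).mul (hb'.pow_const p)).lintegral_prod_right'
    _ = (∫⁻ t, a t) ^ (p / q) * ((∫⁻ t, a t) * ∫⁻ x, b x ^ p) := by
      rw [lintegral_lintegral_swap ((ha.comp_snd).mul (hb'.pow_const p))]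
      congr 1
      rw [← lintegral_mul_const'' _ ha]
      refine lintegral_congr fun t => ?_
      rw [lintegral_const_mul'', lintegral_sub_right_eq_self (fun x => b x ^ p)]
      exact (hb.comp_quasiMeasurePreserving
        (measurePreserving_sub_right volume t).quasiMeasurePreserving).pow_const p
    _ = _ := by
      rw [← mul_assoc]
      congr 1
      nth_rewrite 2 [← ENNReal.rpow_one (∫⁻ t, a t)]
      rw [← ENNReal.rpow_add_of_nonneg _ _ (by have := hpq.symm.pos; positivity) zero_le_one]
      congr 1
      have := hpq.sub_one_mul_conj
      have := hpq.symm.ne_zero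
      field_simp
      linarith

/-- Young's inequality for the convolution with an integrable function. -/
lemma eLpNorm_convolution_le {p : ℝ≥0∞} (hp : 1 < p) (hp' : p ≠ ∞) {k g : ℝ → ℂ}
    (hk : AEStronglyMeasurable k) (hg : AEStronglyMeasurable g) :
    eLpNorm (fun x => ∫ t, k t * g (x - t)) p ≤ (∫⁻ t, ‖k t‖ₑ) * eLpNorm g p := by
  have hp1 : 1 < p.toReal := by
    rw [← ENNReal.toReal_one]; exact ENNReal.toReal_strict_mono hp' hp
  have hp0 : p ≠ 0 := (zero_lt_one.trans hp).ne'
  rw [eLpNorm_eq_lintegral_rpow_enorm_toReal hp0 hp', eLpNorm_eq_lintegral_rpow_enorm_toReal hp0 hp']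
  have h := lintegral_lintegral_convolution_rpow_le hk.enorm hg.enorm hp1
  calc _ ≤ (∫⁻ x, (∫⁻ t, ‖k t‖ₑ * ‖g (x - t)‖ₑ) ^ p.toReal) ^ (1 / p.toReal) := by
        gcongr with x
        refine (enorm_integral_le_lintegral_enorm _).trans (le_of_eq ?_)
        simp [enorm_mul]
    _ ≤ ((∫⁻ t, ‖k t‖ₑ) ^ p.toReal * ∫⁻ x, ‖g x‖ₑ ^ p.toReal) ^ (1 / p.toReal) := by gcongr
    _ = _ := by
      rw [ENNReal.mul_rpow_of_nonneg _ _ (by positivity), ← ENNReal.rpow_mul,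
        mul_one_div_cancel (by positivity), ENNReal.rpow_one]

/-- Interpolation between `L²` and `L^∞`. -/
lemma eLpNorm_le_of_two_of_bound {p : ℝ≥0∞} (hp : 2 ≤ p) (hp' : p ≠ ∞) {f : ℝ → ℂ} {D : ℝ≥0}
    (hf : ∀ x, ‖f x‖ₑ ≤ D) :
    eLpNorm f p ≤ (D : ℝ≥0∞) ^ (1 - 2 / p.toReal) * eLpNorm f 2 ^ (2 / p.toReal) := by
  have hp2 : 2 ≤ p.toReal := by
    simpa using (ENNReal.toReal_le_toReal (by norm_num) hp').2 hp
  have hp0 : p ≠ 0 := (lt_of_lt_of_le (by norm_num) hp).ne'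
  rw [eLpNorm_eq_lintegral_rpow_enorm_toReal hp0 hp', eLpNorm_eq_lintegral_rpow_enorm_toReal
    (by norm_num) (by norm_num), ENNReal.toReal_ofNat, ← ENNReal.rpow_mul]
  have h1 : ∫⁻ x, ‖f x‖ₑ ^ p.toReal ≤ (D : ℝ≥0∞) ^ (p.toReal - 2) * ∫⁻ x, ‖f x‖ₑ ^ (2 : ℝ) := by
    rw [← lintegral_const_mul' _ _ (ENNReal.rpow_ne_top_of_nonneg (by linarith) ENNReal.coe_ne_top)]
    refine lintegral_mono fun x => ?_
    calc ‖f x‖ₑ ^ p.toReal = ‖f x‖ₑ ^ (p.toReal - 2) * ‖f x‖ₑ ^ (2 : ℝ) := by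
          rw [← ENNReal.rpow_add_of_nonneg _ _ (by linarith) (by norm_num), sub_add_cancel]
      _ ≤ _ := by
          gcongr
          exact hf x
  calc _ ≤ ((D : ℝ≥0∞) ^ (p.toReal - 2) * ∫⁻ x, ‖f x‖ₑ ^ (2 : ℝ)) ^ (1 / p.toReal) := by gcongr
    _ = _ := by
      rw [ENNReal.mul_rpow_of_nonneg _ _ (by positivity), ← ENNReal.rpow_mul]
      congr 2
      · field_simp
      · field_simp

/-! ### Fourier multipliers with bounded symbols -/

/-- `𝓕⁻¹ m 𝓕 φ` as a Fourier integral. -/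
def mulOp (m : ℝ → ℂ) (φ : 𝓢(ℝ, ℂ)) : ℝ → ℂ := 𝓕⁻ (fun ξ => m ξ * 𝓕 φ ξ)

/-- Measurable, essentially bounded functions. -/
structure IsBddSymbol (m : ℝ → ℂ) : Prop where
  meas : AEStronglyMeasurable m
  bdd : ∃ B : ℝ, ∀ᵐ ξ, ‖m ξ‖ ≤ B

/-- The bounded function `m` is a Fourier multiplier of `L_p(ℝ)` with norm at most `C`. -/
structure MulBound (p : ℝ≥0∞) (C : ℝ≥0) (m : ℝ → ℂ) : Prop extends IsBddSymbol m where
  bound : ∀ φ : 𝓢(ℝ, ℂ), eLpNorm (mulOp m φ) p ≤ C * eLpNorm φ p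

namespace IsBddSymbol

variable {m m₁ m₂ : ℝ → ℂ}

lemma const (c : ℂ) : IsBddSymbol (fun _ => c) :=
  ⟨aestronglyMeasurable_const, ‖c‖, .of_forall fun _ => le_rfl⟩

lemma add (h₁ : IsBddSymbol m₁) (h₂ : IsBddSymbol m₂) : IsBddSymbol (fun ξ => m₁ ξ + m₂ ξ) := by
  obtain ⟨B₁, hB₁⟩ := h₁.bdd
  obtain ⟨B₂, hB₂⟩ := h₂.bdd
  refine ⟨h₁.meas.add h₂.meas, B₁ + B₂, ?_⟩
  filter_upwards [hB₁, hB₂] with ξ h1 h2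
  exact (norm_add_le _ _).trans (add_le_add h1 h2)

lemma mul (h₁ : IsBddSymbol m₁) (h₂ : IsBddSymbol m₂) : IsBddSymbol (fun ξ => m₁ ξ * m₂ ξ) := by
  obtain ⟨B₁, hB₁⟩ := h₁.bdd
  obtain ⟨B₂, hB₂⟩ := h₂.bdd
  refine ⟨h₁.meas.mul h₂.meas, B₁ * B₂, ?_⟩
  filter_upwards [hB₁, hB₂] with ξ h1 h2
  rw [norm_mul]
  exact mul_le_mul h1 h2 (norm_nonneg _) ((norm_nonneg _).trans h1)

lemma congr (h : IsBddSymbol m₁) (e : m₁ =ᵐ[volume] m₂) : IsBddSymbol m₂ := by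
  obtain ⟨B, hB⟩ := h.bdd
  refine ⟨h.meas.congr e, B, ?_⟩
  filter_upwards [hB, e] with ξ h1 h2
  rwa [← h2]

lemma comp_mul_left (h : IsBddSymbol m) {c : ℝ} (hc : c ≠ 0) : IsBddSymbol (fun ξ => m (c * ξ)) := by
  obtain ⟨B, hB⟩ := h.bdd
  have hq : Measure.QuasiMeasurePreserving (fun ξ : ℝ => c * ξ) := by
    refine ⟨measurable_const_mul c, ?_⟩
    rw [Real.map_volume_mul_left hc]
    exact Measure.smul_absolutelyContinuous
  exact ⟨h.meas.comp_quasiMeasurePreserving hq, B, hq.ae hB⟩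

lemma comp_sub_right (h : IsBddSymbol m) (η : ℝ) : IsBddSymbol (fun ξ => m (ξ - η)) := by
  obtain ⟨B, hB⟩ := h.bdd
  have hq := (measurePreserving_sub_right (volume : Measure ℝ) η).quasiMeasurePreserving
  exact ⟨h.meas.comp_quasiMeasurePreserving hq, B, hq.ae hB⟩

lemma integrable_mul (h : IsBddSymbol m) {f : ℝ → ℂ} (hf : Integrable f) :
    Integrable (fun ξ => m ξ * f ξ) := by
  obtain ⟨B, hB⟩ := h.bdd
  exact hf.bdd_mul h.meas hB

lemma memLp_mul (h : IsBddSymbol m) {p : ℝ≥0∞} {f : ℝ → ℂ} (hf : MemLp f p) :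
    MemLp (fun ξ => m ξ * f ξ) p := by
  obtain ⟨B, hB⟩ := h.bdd
  refine MemLp.of_le_mul hf (h.meas.mul hf.1) (c := B) ?_
  filter_upwards [hB] with ξ h1
  rw [norm_mul]
  gcongr

lemma continuous_mulOp (h : IsBddSymbol m) (φ : 𝓢(ℝ, ℂ)) : Continuous (mulOp m φ) :=
  continuous_fourierInv (h.integrable_mul (𝓕 φ).integrable)

/-- For p ≥ 2 no multiplier property is needed: the function is in L² by Plancherel and bounded as
the Fourier integral of an integrable function. This supplies the a priori finiteness in the duality
argument. -/
lemma memLp_mulOp (h : IsBddSymbol m) (φ : 𝓢(ℝ, ℂ)) {p : ℝ≥0∞} (hp : 2 ≤ p)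
    (hp' : p ≠ ∞) : MemLp (mulOp m φ) p := by
  have hi := h.integrable_mul (𝓕 φ).integrable
  have h2 : MemLp (mulOp m φ) 2 := by
    have h2 := h.memLp_mul ((𝓕 φ).memLp 2)
    refine ⟨(h.continuous_mulOp φ).aestronglyMeasurable, ?_⟩
    rw [mulOp, eLpNorm_fourierInv_two hi h2]
    exact h2.2
  refine ⟨h2.1, (eLpNorm_le_of_two_of_bound (D := (∫ ξ, ‖m ξ * 𝓕 φ ξ‖).toNNReal) hp hp'
    fun x => ?_).trans_lt (ENNReal.mul_lt_top ?_ ?_)⟩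
  · rw [← ofReal_norm]
    exact ENNReal.ofReal_le_ofReal (norm_fourierInv_le _ x)
  · refine ENNReal.rpow_lt_top_of_nonneg ?_ ENNReal.coe_ne_top
    have hp2 : 2 ≤ p.toReal := by
      simpa using (ENNReal.toReal_le_toReal (by norm_num) hp').2 hp
    rw [sub_nonneg, div_le_one (by linarith)]
    exact hp2
  · exact ENNReal.rpow_lt_top_of_nonneg (by positivity) h2.2.ne

lemma integral_mulOp_mul_fourier (h : IsBddSymbol m) (φ ψ : 𝓢(ℝ, ℂ)) :
    ∫ x, mulOp m φ x * 𝓕 ψ x = ∫ ξ, m ξ * 𝓕 φ ξ * ψ ξ := by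
  rw [mulOp, integral_fourierInv_mul (h.integrable_mul (𝓕 φ).integrable) (𝓕 ψ).integrable]
  simp_rw [← SchwartzMap.fourierInv_coe, FourierTransform.fourierInv_fourier_eq]

lemma integral_mulOp_mul (h : IsBddSymbol m) (φ ψ : 𝓢(ℝ, ℂ)) :
    ∫ x, mulOp m φ x * ψ x = ∫ ξ, m ξ * 𝓕 φ ξ * 𝓕⁻ ψ ξ := by
  rw [← h.integral_mulOp_mul_fourier φ (𝓕⁻ ψ), FourierTransform.fourier_fourierInv_eq]

lemma fourier_neg_eq (φ : 𝓢(ℝ, ℂ)) (ξ : ℝ) : 𝓕 φ (-ξ) = 𝓕⁻ φ ξ := by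
  rw [SchwartzMap.fourierInv_coe, Real.fourierInv_eq_fourier_neg, SchwartzMap.fourier_coe]

/-- The transpose of a Fourier multiplier has the reflected symbol. -/
lemma integral_mulOp_mul_eq (h : IsBddSymbol m) (φ ψ : 𝓢(ℝ, ℂ)) :
    ∫ x, mulOp m φ x * ψ x = ∫ x, φ x * mulOp (fun ξ => m (-ξ)) ψ x := by
  have h' : IsBddSymbol (fun ξ => m (-ξ)) := by simpa using h.comp_mul_left (c := -1) (by norm_num)
  simp_rw [mul_comm (φ _)]
  rw [h.integral_mulOp_mul, h'.integral_mulOp_mul, ← integral_neg_eq_self]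
  refine integral_congr_ae (.of_forall fun ξ => ?_)
  simp only [fourier_neg_eq, ← fourier_neg_eq _ (-ξ), neg_neg]
  ring

/-- The image of a Schwartz function under a multiplier need not be Schwartz, so multipliers cannot
simply be iterated. This form of Parseval's identity produces the product of two symbols without
composing the operators. -/
lemma integral_mulOp_mul_mulOp (h₁ : IsBddSymbol m₁) (h₂ : IsBddSymbol m₂) (φ ψ : 𝓢(ℝ, ℂ)) :
    ∫ x, mulOp m₁ φ x * mulOp m₂ ψ x = ∫ ξ, m₁ ξ * 𝓕 φ ξ * (m₂ (-ξ) * 𝓕⁻ ψ ξ) := by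
  rw [mulOp, mulOp, integral_fourierInv_mul_fourierInv (h₁.integrable_mul (𝓕 φ).integrable)
    (h₁.memLp_mul ((𝓕 φ).memLp 2)) (h₂.integrable_mul (𝓕 ψ).integrable)
    (h₂.memLp_mul ((𝓕 ψ).memLp 2))]
  simp_rw [fourier_neg_eq]

end IsBddSymbol

lemma mulOp_congr {m₁ m₂ : ℝ → ℂ} (h : m₁ =ᵐ[volume] m₂) (φ : 𝓢(ℝ, ℂ)) :
    mulOp m₁ φ = mulOp m₂ φ := by
  ext x
  refine Real.fourierInv_congr_ae ?_ x
  filter_upwards [h] with ξ hξ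
  rw [hξ]

lemma mulOp_const (c : ℂ) (φ : 𝓢(ℝ, ℂ)) : mulOp (fun _ => c) φ = fun x => c * φ x := by
  ext x
  have h : 𝓕⁻ (𝓕 φ) x = φ x := by rw [FourierTransform.fourierInv_fourier_eq]
  rw [← h, SchwartzMap.fourierInv_coe, mulOp, Real.fourierInv_eq', Real.fourierInv_eq',
    ← integral_const_mul]
  refine integral_congr_ae (.of_forall fun ξ => ?_)
  simp only [smul_eq_mul]
  ring

lemma mulOp_add {m₁ m₂ : ℝ → ℂ} (h₁ : IsBddSymbol m₁) (h₂ : IsBddSymbol m₂) (φ : 𝓢(ℝ, ℂ)) :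
    mulOp (fun ξ => m₁ ξ + m₂ ξ) φ = mulOp m₁ φ + mulOp m₂ φ := by
  ext x
  simp only [mulOp, Pi.add_apply, Real.fourierInv_eq]
  rw [← integral_add]
  · simp only [add_mul, smul_add]
  · simpa using (Real.fourierIntegral_convergent_iff (μ := volume) (-x)).2
      (h₁.integrable_mul (𝓕 φ).integrable)
  · simpa using (Real.fourierIntegral_convergent_iff (μ := volume) (-x)).2
      (h₂.integrable_mul (𝓕 φ).integrable)

lemma mulOp_const_mul (c : ℂ) (m : ℝ → ℂ) (φ : 𝓢(ℝ, ℂ)) :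
    mulOp (fun ξ => c * m ξ) φ = c • mulOp m φ := by
  ext x
  simp only [mulOp, Pi.smul_apply, Real.fourierInv_eq]
  rw [← integral_smul]
  refine integral_congr_ae (.of_forall fun ξ => ?_)
  simp only [Circle.smul_def, smul_eq_mul]
  ring

/-- `φ(x) exp(-2πixη)` -/
def modulate (η : ℝ) (φ : 𝓢(ℝ, ℂ)) : 𝓢(ℝ, ℂ) := 𝓕⁻ (SchwartzMap.compSubConstCLM ℂ (-η) (𝓕 φ))

lemma fourier_modulate (η : ℝ) (φ : 𝓢(ℝ, ℂ)) (ξ : ℝ) : 𝓕 (modulate η φ) ξ = 𝓕 φ (ξ + η) := by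
  rw [modulate, FourierTransform.fourier_fourierInv_eq, SchwartzMap.compSubConstCLM_apply,
    sub_neg_eq_add]

lemma fourierInv_comp_sub (f : ℝ → ℂ) (η x : ℝ) :
    𝓕⁻ (fun ξ => f (ξ - η)) x = Real.fourierChar (x * η) • 𝓕⁻ f x := by
  rw [Real.fourierInv_eq, Real.fourierInv_eq,
    ← integral_add_right_eq_self _ η, Circle.smul_def, ← integral_smul]
  refine integral_congr_ae (.of_forall fun ξ => ?_)
  simp only [add_sub_cancel_right, Real.inner_apply, Circle.smul_def, smul_smul]
  rw [← Circle.coe_mul, ← AddChar.map_add_eq_mul]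
  congr 3
  ring

lemma norm_modulate (η : ℝ) (φ : 𝓢(ℝ, ℂ)) (x : ℝ) : ‖modulate η φ x‖ = ‖φ x‖ := by
  rw [modulate, SchwartzMap.fourierInv_coe]
  have : (SchwartzMap.compSubConstCLM ℂ (-η) (𝓕 φ) : ℝ → ℂ) = fun ξ => (𝓕 φ) (ξ - (-η)) := rfl
  rw [this, fourierInv_comp_sub, Circle.norm_smul, ← SchwartzMap.fourierInv_coe,
    FourierTransform.fourierInv_fourier_eq]

/-- Shifting the symbol modulates both input and output by unimodular factors, so shifts preserve
multiplier norms. -/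
lemma norm_mulOp_comp_sub (m : ℝ → ℂ) (η : ℝ) (φ : 𝓢(ℝ, ℂ)) (x : ℝ) :
    ‖mulOp (fun ξ => m (ξ - η)) φ x‖ = ‖mulOp m (modulate η φ) x‖ := by
  have : (fun ξ => m (ξ - η) * 𝓕 φ ξ) = fun ξ => (fun ξ => m ξ * 𝓕 (modulate η φ) ξ) (ξ - η) := by
    ext ξ
    simp [fourier_modulate]
  rw [mulOp, this, fourierInv_comp_sub (fun ξ => m ξ * 𝓕 (modulate η φ) ξ), Circle.norm_smul, mulOp]

lemma fourier_dilation (c : ℝ) (hc : c ≠ 0) (φ : 𝓢(ℝ, ℂ)) (ξ : ℝ) :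
    𝓕 (dilation c hc φ) ξ = |c⁻¹| * 𝓕 φ (ξ / c) := by
  simp only [SchwartzMap.fourier_coe, Real.fourier_real_eq, dilation_apply]
  have h := Measure.integral_comp_mul_left
    (fun v => Real.fourierChar (-(v * (ξ / c))) • φ v) c
  rw [← Complex.real_smul, ← h]
  refine integral_congr_ae (.of_forall fun t => ?_)
  have : c * t * (ξ / c) = t * ξ := by field_simp
  simp only [this]

lemma mulOp_comp_mul_left (m : ℝ → ℂ) {c : ℝ} (hc : c ≠ 0) (φ : 𝓢(ℝ, ℂ)) (x : ℝ) :
    mulOp (fun ξ => m (c * ξ)) φ x = mulOp m (dilation c hc φ) (c⁻¹ * x) := by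
  simp only [mulOp, Real.fourierInv_eq, fourier_dilation, Real.inner_apply]
  have h := Measure.integral_comp_mul_left
    (fun ξ => Real.fourierChar (ξ * (c⁻¹ * x)) • (m ξ * 𝓕 φ (ξ / c))) c
  have h2 : ∫ ξ, Real.fourierChar (ξ * (c⁻¹ * x)) • (m ξ * (|c⁻¹| * 𝓕 φ (ξ / c))) =
      |c⁻¹| • ∫ ξ, Real.fourierChar (ξ * (c⁻¹ * x)) • (m ξ * 𝓕 φ (ξ / c)) := by
    rw [← integral_smul]
    refine integral_congr_ae (.of_forall fun t => ?_)
    simp only [Circle.smul_def, Complex.real_smul, smul_eq_mul]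
    ring
  rw [h2, ← h]
  refine integral_congr_ae (.of_forall fun t => ?_)
  simp only
  have : c * t * (c⁻¹ * x) = t * x := by field_simp
  rw [mul_div_cancel_left₀ _ hc, this]

/-- The symbol `𝓕 k · m` corresponds to the convolution with `k`. -/
lemma mulOp_fourier_mul {k m : ℝ → ℂ} (hk : Integrable k) (hm : IsBddSymbol m) (φ : 𝓢(ℝ, ℂ))
    (x : ℝ) : mulOp (fun ξ => 𝓕 k ξ * m ξ) φ x = ∫ t, k t * mulOp m φ (x - t) := by
  have hi := hm.integrable_mul (𝓕 φ).integrable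
  have hi' : Integrable (fun ξ => Real.fourierChar (ξ * x) • (m ξ * 𝓕 φ ξ)) := by
    simpa [mul_comm x] using (Real.fourierIntegral_convergent_iff (μ := volume) (-x)).2 hi
  have h := integral_fourier_mul hk hi'
  simp only [mulOp, Real.fourierInv_eq, Real.inner_apply]
  refine Eq.trans ?_ (h.trans ?_)
  · refine integral_congr_ae (.of_forall fun ξ => ?_)
    simp only [Circle.smul_def, smul_eq_mul]
    ring
  · refine integral_congr_ae (.of_forall fun t => ?_)
    simp only [Real.fourier_real_eq]
    congr 2
    ext ξ
    simp only [Circle.smul_def, smul_smul]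
    rw [← Circle.coe_mul, ← AddChar.map_add_eq_mul]
    congr 3
    ring

/-! ### Operations that preserve Fourier multipliers -/

namespace MulBound

variable {p : ℝ≥0∞} {C C₁ C₂ : ℝ≥0} {m m₁ m₂ : ℝ → ℂ}

lemma congr (h : MulBound p C m₁) (e : m₁ =ᵐ[volume] m₂) : MulBound p C m₂ :=
  ⟨h.toIsBddSymbol.congr e, fun φ => by rw [← mulOp_congr e]; exact h.bound φ⟩

lemma mono (h : MulBound p C₁ m) (hC : C₁ ≤ C₂) : MulBound p C₂ m :=
  ⟨h.toIsBddSymbol, fun φ => (h.bound φ).trans (by gcongr)⟩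

lemma const (p : ℝ≥0∞) (c : ℂ) : MulBound p ‖c‖₊ (fun _ => c) := by
  refine ⟨.const c, fun φ => ?_⟩
  rw [mulOp_const]
  exact (eLpNorm_const_smul_le (c := c) (f := φ)).trans (by rfl)

lemma add (hp : 1 ≤ p) (h₁ : MulBound p C₁ m₁) (h₂ : MulBound p C₂ m₂) :
    MulBound p (C₁ + C₂) (fun ξ => m₁ ξ + m₂ ξ) := by
  refine ⟨h₁.toIsBddSymbol.add h₂.toIsBddSymbol, fun φ => ?_⟩
  rw [mulOp_add h₁.toIsBddSymbol h₂.toIsBddSymbol]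
  refine (eLpNorm_add_le (h₁.continuous_mulOp φ).aestronglyMeasurable
    (h₂.continuous_mulOp φ).aestronglyMeasurable hp).trans ?_
  push_cast
  rw [add_mul]
  exact add_le_add (h₁.bound φ) (h₂.bound φ)

lemma const_mul (c : ℂ) (h : MulBound p C m) : MulBound p (‖c‖₊ * C) (fun ξ => c * m ξ) := by
  refine ⟨(IsBddSymbol.const c).mul h.toIsBddSymbol, fun φ => ?_⟩
  rw [mulOp_const_mul]
  refine eLpNorm_const_smul_le.trans ?_
  push_cast
  rw [mul_assoc]
  exact mul_le_mul_right (h.bound φ) _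

lemma sum (hp : 1 ≤ p) {ι : Type*} (s : Finset ι) {f : ι → ℝ → ℂ} {C : ι → ℝ≥0}
    (h : ∀ i, MulBound p (C i) (f i)) : MulBound p (∑ i ∈ s, C i) (fun ξ => ∑ i ∈ s, f i ξ) := by
  classical
  induction s using Finset.induction_on with
  | empty => simpa using const p 0
  | insert i s hi ih =>
    simp only [Finset.sum_insert hi]
    exact (h i).add hp ih

lemma comp_mul_left (hp : p ≠ ∞) (h : MulBound p C m) {c : ℝ} (hc : c ≠ 0) :
    MulBound p C (fun ξ => m (c * ξ)) := by
  refine ⟨h.toIsBddSymbol.comp_mul_left hc, fun φ => ?_⟩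
  have e : mulOp (fun ξ => m (c * ξ)) φ = fun x => mulOp m (dilation c hc φ) (c⁻¹ * x) :=
    funext (mulOp_comp_mul_left m hc φ)
  rw [e, eLpNorm_comp_mul_left hp (h.continuous_mulOp _).aestronglyMeasurable (inv_ne_zero hc)]
  have h2 : eLpNorm (dilation c hc φ) p = ENNReal.ofReal |c⁻¹| ^ (1 / p).toReal * eLpNorm φ p := by
    rw [← eLpNorm_comp_mul_left hp φ.continuous.aestronglyMeasurable hc]
    congr 1
    ext x
    simp
  -- Input and output are dilated by reciprocal factors, so the two Jacobian powers cancel and the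
  -- bound stays exactly `C`.
  have h3 : ENNReal.ofReal |c⁻¹⁻¹| ^ (1 / p).toReal * ENNReal.ofReal |c⁻¹| ^ (1 / p).toReal = 1 := by
    rw [← ENNReal.mul_rpow_of_nonneg _ _ ENNReal.toReal_nonneg, ← ENNReal.ofReal_mul (abs_nonneg _),
      ← abs_mul, inv_mul_cancel₀ (inv_ne_zero hc)]
    simp
  calc _ ≤ ENNReal.ofReal |c⁻¹⁻¹| ^ (1 / p).toReal *
        (C * (ENNReal.ofReal |c⁻¹| ^ (1 / p).toReal * eLpNorm φ p)) := by
        rw [← h2]; gcongr; exact h.bound _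
    _ = (ENNReal.ofReal |c⁻¹⁻¹| ^ (1 / p).toReal * ENNReal.ofReal |c⁻¹| ^ (1 / p).toReal) *
        (C * eLpNorm φ p) := by ring
    _ = _ := by rw [h3, one_mul]

lemma comp_neg (hp : p ≠ ∞) (h : MulBound p C m) : MulBound p C (fun ξ => m (-ξ)) := by
  simpa using h.comp_mul_left hp (c := -1) (by norm_num)

lemma comp_sub_right (h : MulBound p C m) (η : ℝ) : MulBound p C (fun ξ => m (ξ - η)) := by
  refine ⟨h.toIsBddSymbol.comp_sub_right η, fun φ => ?_⟩
  rw [eLpNorm_congr_norm_ae (.of_forall (norm_mulOp_comp_sub m η φ)),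
    ← eLpNorm_congr_norm_ae (.of_forall (norm_modulate η φ))]
  exact h.bound _

lemma fourier_mul (hp : 1 < p) (hp' : p ≠ ∞) (h : MulBound p C m) {k : ℝ → ℂ} (hk : Integrable k) :
    MulBound p ((∫⁻ t, ‖k t‖ₑ).toNNReal * C) (fun ξ => 𝓕 k ξ * m ξ) := by
  have hk' : IsBddSymbol (𝓕 k) :=
    ⟨(VectorFourier.fourierIntegral_continuous Real.continuous_fourierChar
      (by fun_prop) hk).aestronglyMeasurable, ∫ t, ‖k t‖, .of_forall fun ξ =>
      VectorFourier.norm_fourierIntegral_le_integral_norm _ _ _ _ _⟩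
  refine ⟨hk'.mul h.toIsBddSymbol, fun φ => ?_⟩
  rw [funext (mulOp_fourier_mul hk h.toIsBddSymbol φ)]
  refine (eLpNorm_convolution_le hp hp' hk.1 (h.continuous_mulOp φ).aestronglyMeasurable).trans ?_
  push_cast
  rw [ENNReal.coe_toNNReal hk.2.ne, mul_assoc]
  exact mul_le_mul_right (h.bound φ) _

lemma fourier (hp : 1 < p) (hp' : p ≠ ∞) {k : ℝ → ℂ} (hk : Integrable k) :
    MulBound p (∫⁻ t, ‖k t‖ₑ).toNNReal (𝓕 k) := by
  simpa using (const p 1).fourier_mul hp hp' hk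

/-- Multiplier classes are closed under bounded pointwise convergence. -/
lemma of_tendsto {f : ℕ → ℝ → ℂ} (h : ∀ n, MulBound p C (f n)) {B : ℝ}
    (hB : ∀ n, ∀ᵐ ξ, ‖f n ξ‖ ≤ B) (hlim : ∀ᵐ ξ, Tendsto (fun n => f n ξ) atTop (𝓝 (m ξ))) :
    MulBound p C m := by
  have hm : IsBddSymbol m := by
    refine ⟨aestronglyMeasurable_of_tendsto_ae atTop (fun n => (h n).meas) hlim, B, ?_⟩
    filter_upwards [hlim, ae_all_iff.2 hB] with ξ h1 h2
    exact le_of_tendsto h1.norm (.of_forall h2)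
  refine ⟨hm, fun φ => ?_⟩
  -- Fatou's lemma for the L_p norm; the outputs converge at every point by dominated convergence
  -- with the majorant B |𝓕 φ|.
  refine Lp.eLpNorm_le_of_ae_tendsto (u := atTop) (.of_forall fun n => (h n).bound φ)
    (fun n => ((h n).continuous_mulOp φ).aestronglyMeasurable) (.of_forall fun x => ?_)
  simp only [mulOp, Real.fourierInv_eq]
  refine tendsto_integral_of_dominated_convergence (fun ξ => B * ‖𝓕 φ ξ‖) (fun n => ?_)
    ((𝓕 φ).integrable.norm.const_mul B) (fun n => ?_) ?_
  · simpa using ((Real.fourierIntegral_convergent_iff (μ := volume) (-x)).2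
      ((h n).integrable_mul (𝓕 φ).integrable)).1
  · filter_upwards [hB n] with ξ hξ
    rw [Circle.norm_smul, norm_mul]
    gcongr
  · filter_upwards [hlim] with ξ hξ
    exact ((hξ.mul_const _).const_smul _)

end MulBound

/-! ### The Cauchy integral in the upper half-plane -/

/-- The Cauchy integral `(i/2π) ∫ f(t) / (z - t) dt`. -/
def cauchyIntegral (f : ℝ → ℂ) (z : ℂ) : ℂ := ∫ t : ℝ, f t * (Complex.I / (2 * Real.pi) / (z - t))

/-- Riesz's inequality behind the boundedness of the Hilbert transform. -/
lemma exists_norm_rpow_le_re {p : ℝ} (hp : 1 < p) (hp2 : p ≤ 2) : ∃ A B : ℝ, 0 ≤ A ∧ 0 ≤ B ∧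
    ∀ w : ℂ, 0 < w.re → ‖w‖ ^ p ≤ A * w.re ^ p - B * (w ^ (p : ℂ)).re := by
  have hπ := Real.pi_pos
  -- This angle is below π/2 while p θ₀ exceeds π/2, so cos θ₀ > 0 > cos(p θ₀). The constant `B`
  -- normalises -B cos(p θ₀) to 1, and `A` is chosen so that A cos(θ₀)^p = 1 + B.
  set θ₀ := Real.pi * (1 + p) / (4 * p) with hθ₀
  have hpθ : p * θ₀ = Real.pi * (1 + p) / 4 := by rw [hθ₀]; field_simp
  have hθpos : 0 < θ₀ := by positivity
  have hθlt : θ₀ < Real.pi / 2 := by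
    rw [hθ₀, div_lt_div_iff₀ (by positivity) (by norm_num)]
    nlinarith
  have hc0 : 0 < -Real.cos (p * θ₀) := by
    rw [Left.neg_pos_iff]
    apply Real.cos_neg_of_pi_div_two_lt_of_lt <;> rw [hpθ] <;> nlinarith
  have hc1 : 0 < Real.cos θ₀ := Real.cos_pos_of_mem_Ioo ⟨by linarith, hθlt⟩
  set B := 1 / -Real.cos (p * θ₀) with hB
  have hBpos : 0 < B := by positivity
  set A := (1 + B) / Real.cos θ₀ ^ p with hA
  have hApos : 0 < A := by positivity
  refine ⟨A, B, hApos.le, hBpos.le, fun w hw => ?_⟩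
  have hw0 : w ≠ 0 := by rintro rfl; simp at hw
  have harg : |w.arg| < Real.pi / 2 := Complex.abs_arg_lt_pi_div_two_iff.2 (.inl hw)
  have hcos : 0 < Real.cos w.arg := Real.cos_pos_of_mem_Ioo (abs_lt.1 harg)
  have hre : w.re = ‖w‖ * Real.cos w.arg := by
    rw [Complex.cos_arg hw0]; field_simp [norm_ne_zero_iff.2 hw0]
  rw [Complex.cpow_ofReal_re, hre, Real.mul_rpow (norm_nonneg _) hcos.le]
  have key : 1 ≤ A * Real.cos w.arg ^ p - B * Real.cos (w.arg * p) := by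
    rw [← Real.cos_abs w.arg, ← Real.cos_abs (w.arg * p), abs_mul, abs_of_pos (by linarith : 0 < p)]
    -- For small arguments the `A` term absorbs `B`. For large ones the `B` term alone contributes
    -- at least 1, because cos decreases on [p θ₀, pπ/2], an interval inside [0, π] as p ≤ 2.
    rcases le_total |w.arg| θ₀ with h | h
    · have h1 : Real.cos θ₀ ≤ Real.cos |w.arg| :=
        Real.cos_le_cos_of_nonneg_of_le_pi (abs_nonneg _) (by linarith) h
      have h2 : Real.cos θ₀ ^ p ≤ Real.cos |w.arg| ^ p := by gcongr
      have h3 : 1 + B ≤ A * Real.cos |w.arg| ^ p := by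
        calc 1 + B = A * Real.cos θ₀ ^ p := by
              rw [hA, div_mul_cancel₀]; positivity
          _ ≤ _ := by gcongr
      have h4 := Real.cos_le_one (|w.arg| * p)
      nlinarith
    · have h1 : Real.cos (|w.arg| * p) ≤ Real.cos (p * θ₀) := by
        apply Real.cos_le_cos_of_nonneg_of_le_pi (by positivity)
        · nlinarith
        · nlinarith
      have h2 : B * Real.cos (|w.arg| * p) ≤ -1 := by
        calc _ ≤ B * Real.cos (p * θ₀) := by gcongr
          _ = -1 := by
            have : Real.cos (p * θ₀) ≠ 0 := by intro h0; rw [h0] at hc0; simp at hc0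
            rw [hB, one_div, inv_neg, neg_mul, inv_mul_cancel₀ this]
      have h3 : 0 ≤ A * Real.cos |w.arg| ^ p := by
        have : 0 ≤ Real.cos |w.arg| := by rw [Real.cos_abs]; exact hcos.le
        positivity
      linarith
  have hwp : 0 ≤ ‖w‖ ^ p := by positivity
  nlinarith

lemma integrable_complex_ofReal {u : ℝ → ℝ} (hu : Integrable u) :
    Integrable fun t => (u t : ℂ) := hu.ofReal

lemma im_le_norm_sub_ofReal (z : ℂ) (t : ℝ) : z.im ≤ ‖z - t‖ := by
  have := (le_abs_self _).trans (Complex.abs_im_le_norm (z - t))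
  simpa using this

lemma norm_cauchyKernel (z : ℂ) (t : ℝ) :
    ‖Complex.I / (2 * Real.pi) / (z - t)‖ = 1 / (2 * Real.pi) * ‖z - t‖⁻¹ := by
  have := Real.pi_pos
  simp [abs_of_pos this]
  ring

lemma continuous_cauchyKernel {z : ℂ} (hz : 0 < z.im) :
    Continuous fun t : ℝ => Complex.I / (2 * Real.pi) / (z - t) := by
  refine continuous_const.div (by fun_prop) fun t h => ?_
  have := im_le_norm_sub_ofReal z t
  rw [h, norm_zero] at this
  linarith

lemma norm_cauchyKernel_le {z : ℂ} {d : ℝ} (hd : 0 < d) {t : ℝ} (h : d ≤ ‖z - t‖) :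
    ‖Complex.I / (2 * Real.pi) / (z - t)‖ ≤ 1 / (2 * Real.pi) * d⁻¹ := by
  rw [norm_cauchyKernel]
  have := Real.pi_pos
  gcongr

lemma integrable_mul_cauchyKernel {f : ℝ → ℂ} (hf : Integrable f) {z : ℂ} (hz : 0 < z.im) :
    Integrable fun t : ℝ => f t * (Complex.I / (2 * Real.pi) / (z - t)) := by
  exact hf.mul_bdd (continuous_cauchyKernel hz).aestronglyMeasurable
    (.of_forall fun t => norm_cauchyKernel_le hz (im_le_norm_sub_ofReal z t))

lemma cauchyIntegral_add {f g : ℝ → ℂ} (hf : Integrable f) (hg : Integrable g) {z : ℂ}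
    (hz : 0 < z.im) :
    cauchyIntegral (fun t => f t + g t) z = cauchyIntegral f z + cauchyIntegral g z := by
  rw [cauchyIntegral, cauchyIntegral, cauchyIntegral,
    ← integral_add (integrable_mul_cauchyKernel hf hz) (integrable_mul_cauchyKernel hg hz)]
  simp only [add_mul]

lemma cauchyIntegral_const_mul (c : ℂ) (f : ℝ → ℂ) (z : ℂ) :
    cauchyIntegral (fun t => c * f t) z = c * cauchyIntegral f z := by
  rw [cauchyIntegral, cauchyIntegral, ← integral_const_mul]
  simp only [mul_assoc]

lemma differentiableAt_cauchyIntegral {f : ℝ → ℂ} (hf : Integrable f) {z₀ : ℂ} (hz : 0 < z₀.im) :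
    DifferentiableAt ℂ (cauchyIntegral f) z₀ := by
  have hy : 0 < z₀.im / 2 := by linarith
  have him : ∀ z ∈ Metric.ball z₀ (z₀.im / 2), z₀.im / 2 ≤ z.im := by
    intro z hz'
    have h1 := (abs_le.1 (Complex.abs_im_le_norm (z - z₀))).1
    rw [Metric.mem_ball, dist_eq_norm] at hz'
    rw [Complex.sub_im] at h1
    linarith
  have hne : ∀ z ∈ Metric.ball z₀ (z₀.im / 2), ∀ t : ℝ, z - t ≠ 0 := by
    intro z hz' t h
    have := im_le_norm_sub_ofReal z t
    rw [h, norm_zero] at this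
    linarith [him z hz']
  refine (hasDerivAt_integral_of_dominated_loc_of_deriv_le (μ := volume) (𝕜 := ℂ)
    (F := fun z t => f t * (Complex.I / (2 * Real.pi) / (z - t)))
    (F' := fun z t => f t * (-(Complex.I / (2 * Real.pi)) / (z - t) ^ 2))
    (bound := fun t => ‖f t‖ * (1 / (2 * Real.pi) * ((z₀.im / 2) ^ 2)⁻¹))
    (Metric.ball_mem_nhds z₀ hy) ?_ (integrable_mul_cauchyKernel hf hz) ?_ ?_ ?_ ?_).2.differentiableAt
  · filter_upwards [Metric.ball_mem_nhds z₀ hy] with z hz'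
    exact (integrable_mul_cauchyKernel hf (by linarith [him z hz'])).1
  · refine hf.1.mul (Continuous.aestronglyMeasurable ?_)
    exact continuous_const.div (by fun_prop) fun t =>
      pow_ne_zero 2 (hne z₀ (Metric.mem_ball_self hy) t)
  · refine .of_forall fun t z hz' => ?_
    have := Real.pi_pos
    rw [norm_mul, norm_div, norm_neg, norm_pow, div_eq_mul_inv]
    have h1 : ‖Complex.I / (2 * Real.pi)‖ = 1 / (2 * Real.pi) := by simp [abs_of_pos this]
    rw [h1]
    have h2 := (him z hz').trans (im_le_norm_sub_ofReal z t)
    gcongr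
  · exact hf.norm.mul_const _
  · refine .of_forall fun t z hz' => ?_
    have h := ((hasDerivAt_const z (Complex.I / (2 * Real.pi))).div
      ((hasDerivAt_id z).sub_const (t : ℂ)) (hne z hz' t)).const_mul (f t)
    simpa using! h

/-- The Poisson kernel with total mass `1/2`. -/
def poissonKernel (ε t : ℝ) : ℝ := 1 / (2 * Real.pi) * (ε / (t ^ 2 + ε ^ 2))

lemma cauchyKernel_re (x ε t : ℝ) :
    (Complex.I / (2 * Real.pi) / ((x + ε * Complex.I : ℂ) - t)).re = poissonKernel ε (x - t) := by
  have h1 : Complex.I / (2 * Real.pi) = (1 / (2 * Real.pi) : ℝ) * Complex.I := by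
    push_cast; ring
  rw [h1, mul_div_assoc, Complex.re_ofReal_mul, poissonKernel, Complex.div_re]
  simp [Complex.normSq_apply]
  ring_nf

lemma poissonKernel_pos {ε : ℝ} (hε : 0 < ε) (t : ℝ) : 0 < poissonKernel ε t := by
  have := Real.pi_pos
  unfold poissonKernel
  positivity

lemma lintegral_poissonKernel_le {ε : ℝ} (hε : 0 < ε) :
    ∫⁻ t, ‖((poissonKernel ε t : ℝ) : ℂ)‖ₑ ≤ 1 := by
  have hπ := Real.pi_pos
  have e : ∀ t, poissonKernel ε t = (1 / (2 * Real.pi) * ε⁻¹) * (1 + (ε⁻¹ * t) ^ 2)⁻¹ := by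
    intro t
    unfold poissonKernel
    field_simp
    ring
  have hint : Integrable (poissonKernel ε) := by
    rw [funext e]
    exact ((integrable_inv_one_add_sq.comp_mul_left' (inv_ne_zero hε.ne'))).const_mul _
  have h1 : ∀ t, ‖((poissonKernel ε t : ℝ) : ℂ)‖ₑ = ENNReal.ofReal (poissonKernel ε t) := by
    intro t
    rw [← ofReal_norm, Complex.norm_real, Real.norm_of_nonneg (poissonKernel_pos hε t).le]
  simp_rw [h1]
  rw [← ofReal_integral_eq_lintegral_ofReal hint (.of_forall fun t => (poissonKernel_pos hε t).le),
    ENNReal.ofReal_le_one]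
  simp_rw [e]
  rw [integral_const_mul, Measure.integral_comp_mul_left (fun t => (1 + t ^ 2)⁻¹),
    integral_univ_inv_one_add_sq, inv_inv, abs_of_pos hε, smul_eq_mul]
  field_simp
  norm_num

/-- The contour integral of `F ^ p` over a horizontal line vanishes. -/
lemma norm_integral_cauchyIntegral_cpow_le {f : ℝ → ℂ} (hf : Integrable f) {M : ℝ} (hM : 0 < M)
    (hsupp : ∀ t, M < |t| → f t = 0) (hre : ∀ z : ℂ, 0 < z.im → 0 < (cauchyIntegral f z).re)
    {p : ℝ} (hp : 1 < p) {ε R : ℝ} (hε : 0 < ε) (hR : 2 * M ≤ R) :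
    ‖∫ x in (-R)..R, cauchyIntegral f (x + ε * Complex.I) ^ (p : ℂ)‖ ≤
      4 * (1 / Real.pi * ∫ t, ‖f t‖) ^ p * R ^ (1 - p) := by
  have hπ := Real.pi_pos
  have hR0 : 0 < R := by linarith
  set K := (1 / Real.pi * ∫ t, ‖f t‖) with hK
  have hK0 : 0 ≤ K := by
    have : 0 ≤ ∫ t, ‖f t‖ := integral_nonneg fun _ => norm_nonneg _
    positivity
  -- At distance at least R/2 from the support the Cauchy kernel is at most 1/(πR), which explains
  -- the factor 1/π in `K`.
  have hbound : ∀ z : ℂ, (∀ t : ℝ, |t| ≤ M → R / 2 ≤ ‖z - t‖) → 0 < z.im →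
      ‖cauchyIntegral f z ^ (p : ℂ)‖ ≤ (K / R) ^ p := by
    intro z hz hzi
    rw [Complex.norm_cpow_real]
    gcongr
    calc ‖cauchyIntegral f z‖ ≤ ∫ t, ‖f t‖ * (1 / (2 * Real.pi) * (R / 2)⁻¹) := by
          refine norm_integral_le_of_norm_le (hf.norm.mul_const _) (.of_forall fun t => ?_)
          rw [norm_mul]
          by_cases ht : |t| ≤ M
          · gcongr
            exact norm_cauchyKernel_le (by linarith) (hz t ht)
          · rw [hsupp t (not_le.1 ht)]; simp
      _ = K / R := by
          rw [integral_mul_const, hK]; field_simp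
  -- The positive real part keeps the Cauchy integral off the branch cut, so its power is
  -- holomorphic on the rectangle over [-R, R] with heights from ε to ε + R.
  have hdiff : DifferentiableOn ℂ (fun z => cauchyIntegral f z ^ (p : ℂ))
      (uIcc (-R + ε * Complex.I : ℂ).re (R + (ε + R) * Complex.I : ℂ).re ×ℂ
        uIcc (-R + ε * Complex.I : ℂ).im (R + (ε + R) * Complex.I : ℂ).im) := by
    intro z hz
    have hz' := hz.2
    simp only [Complex.add_im, Complex.neg_im, Complex.ofReal_im, neg_zero, Complex.mul_im,
      Complex.ofReal_re, Complex.I_im, mul_one, Complex.I_re, mul_zero, add_zero, zero_add,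
      Complex.add_re] at hz'
    rw [mem_preimage, uIcc_of_le (by linarith)] at hz'
    have hzi : 0 < z.im := by linarith [hz'.1]
    exact ((differentiableAt_cauchyIntegral hf hzi).cpow_const
      (.inl (hre z hzi))).differentiableWithinAt
  have h := Complex.integral_boundary_rect_eq_zero_of_differentiableOn _ _ _ hdiff
  simp only [Complex.add_im, Complex.neg_im, Complex.ofReal_im, neg_zero, Complex.mul_im,
      Complex.ofReal_re, Complex.I_im, mul_one, Complex.I_re, mul_zero, add_zero, zero_add,
      Complex.add_re, Complex.neg_re, Complex.mul_re, sub_self, smul_eq_mul] at h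
  push_cast at h
  have htop : ‖∫ x in (-R)..R, cauchyIntegral f (x + (ε + R) * Complex.I) ^ (p : ℂ)‖ ≤
      (K / R) ^ p * |R - -R| := by
    refine intervalIntegral.norm_integral_le_of_norm_le_const fun x _ => hbound _ (fun t _ => ?_) ?_
    · have := im_le_norm_sub_ofReal (x + (ε + R) * Complex.I) t
      simp at this
      linarith
    · simp; linarith
  have hside : ∀ a : ℝ, |a| = R →
      ‖∫ y in ε..(ε + R), cauchyIntegral f (a + y * Complex.I) ^ (p : ℂ)‖ ≤
      (K / R) ^ p * |ε + R - ε| := by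
    intro a ha
    refine intervalIntegral.norm_integral_le_of_norm_le_const fun y hy => hbound _ (fun t ht => ?_) ?_
    · have h1 := Complex.abs_re_le_norm (a + y * Complex.I - t)
      simp at h1
      have h2 := abs_sub_abs_le_abs_sub a t
      linarith
    · rw [uIoc_of_le (by linarith)] at hy
      simp
      linarith [hy.1]
  have hl := hside (-R) (by rw [abs_neg, abs_of_pos hR0])
  have hr := hside R (abs_of_pos hR0)
  push_cast at hl
  rw [abs_of_pos (by linarith)] at htop hl hr
  have e : ∫ x in (-R)..R, cauchyIntegral f (x + ε * Complex.I) ^ (p : ℂ) =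
      (∫ x in (-R)..R, cauchyIntegral f (x + (ε + R) * Complex.I) ^ (p : ℂ)) -
      Complex.I * (∫ y in ε..(ε + R), cauchyIntegral f (R + y * Complex.I) ^ (p : ℂ)) +
      Complex.I * (∫ y in ε..(ε + R), cauchyIntegral f (-R + y * Complex.I) ^ (p : ℂ)) := by
    linear_combination h
  rw [e]
  refine (norm_add_le _ _).trans ?_
  have h1 := norm_sub_le (∫ x in (-R)..R, cauchyIntegral f (x + (ε + R) * Complex.I) ^ (p : ℂ))
    (Complex.I * (∫ y in ε..(ε + R), cauchyIntegral f (R + y * Complex.I) ^ (p : ℂ)))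
  rw [norm_mul, Complex.norm_I, one_mul] at h1 ⊢
  -- The three remaining sides of the rectangle have total length 2R + R + R = 4R, and the integrand
  -- on them is at most (K/R)^p.
  have e2 : 4 * K ^ p * R ^ (1 - p) = 4 * ((K / R) ^ p * R) := by
    rw [Real.div_rpow hK0 hR0.le, Real.rpow_sub hR0, Real.rpow_one]
    ring
  rw [e2]
  linarith

/-- For real `u` the real part is a convolution with the Poisson kernel, whose mass is at most 1,
and Young's inequality applies. Only the imaginary part needs Riesz's argument. -/
lemma eLpNorm_re_cauchyIntegral_le {p : ℝ≥0∞} (hp : 1 < p) (hp' : p ≠ ∞) {u : ℝ → ℝ}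
    (hu : Integrable u) {ε : ℝ} (hε : 0 < ε) :
    eLpNorm (fun x : ℝ => (cauchyIntegral (fun t => (u t : ℂ)) (x + ε * Complex.I)).re) p ≤
      eLpNorm u p := by
  have hk : Continuous (poissonKernel ε) := by
    unfold poissonKernel
    refine continuous_const.mul (continuous_const.div (by fun_prop) fun t => ?_)
    positivity
  have h := eLpNorm_convolution_le hp hp' (k := fun t => ((poissonKernel ε t : ℝ) : ℂ))
    (g := fun t => (u t : ℂ)) (Complex.continuous_ofReal.comp hk).aestronglyMeasurable
    hu.ofReal.1
  have e1 : eLpNorm (fun t => (u t : ℂ)) p = eLpNorm u p :=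
    eLpNorm_congr_norm_ae (.of_forall fun t => Complex.norm_real _)
  rw [e1] at h
  refine (le_of_eq ?_).trans (h.trans (mul_le_of_le_one_left' (lintegral_poissonKernel_le hε)))
  refine eLpNorm_congr_norm_ae (.of_forall fun x => ?_)
  rw [← Complex.norm_real]
  congr 1
  have hi := integrable_mul_cauchyKernel (f := fun t => (u t : ℂ)) hu.ofReal
    (z := x + ε * Complex.I) (by simpa using hε)
  have h2 := Complex.reCLM.integral_comp_comm hi
  simp only [Complex.reCLM_apply, Complex.re_ofReal_mul, cauchyKernel_re] at h2
  rw [cauchyIntegral, ← h2, ← integral_sub_left_eq_self _ _ x, ← integral_complex_ofReal]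
  refine integral_congr_ae (.of_forall fun t => ?_)
  simp [mul_comm]

lemma cauchyIntegral_re_pos {u : ℝ → ℝ} (hu : Integrable u) (hu0 : ∀ t, 0 ≤ u t)
    (hpos : 0 < ∫ t, u t) {z : ℂ} (hz : 0 < z.im) :
    0 < (cauchyIntegral (fun t => (u t : ℂ)) z).re := by
  have hi := integrable_mul_cauchyKernel (f := fun t => (u t : ℂ)) hu.ofReal hz
  have h2 := Complex.reCLM.integral_comp_comm hi
  have hz' : z = z.re + z.im * Complex.I := (Complex.re_add_im z).symm
  have hre : ∀ t : ℝ, (Complex.I / (2 * Real.pi) / (z - t)).re = poissonKernel z.im (z.re - t) := by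
    intro t
    rw [← cauchyKernel_re, ← hz']
  have hi2 := hi.re
  simp only [RCLike.re_eq_complex_re, Complex.re_ofReal_mul, hre] at hi2
  simp only [Complex.reCLM_apply, Complex.re_ofReal_mul, hre] at h2
  rw [cauchyIntegral, ← h2, integral_pos_iff_support_of_nonneg _ hi2]
  · rw [integral_pos_iff_support_of_nonneg hu0 hu] at hpos
    convert hpos using 2
    ext t
    simp [(poissonKernel_pos hz (z.re - t)).ne']
  · exact fun t => mul_nonneg (hu0 t) (poissonKernel_pos hz _).le

lemma continuous_cauchyIntegral_horizontal {f : ℝ → ℂ} (hf : Integrable f) {ε : ℝ} (hε : 0 < ε) :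
    Continuous fun x : ℝ => cauchyIntegral f (x + ε * Complex.I) := by
  rw [continuous_iff_continuousAt]
  intro x
  have h := (differentiableAt_cauchyIntegral hf (z₀ := x + ε * Complex.I)
    (by simpa using hε)).continuousAt
  exact ContinuousAt.comp (f := fun x : ℝ => (x + ε * Complex.I : ℂ)) h (by fun_prop)

/-- M. Riesz's theorem for nonnegative functions with compact support. -/
lemma lintegral_cauchyIntegral_le {p : ℝ} (hp : 1 < p) {A B : ℝ} (hA : 0 ≤ A) (hB : 0 ≤ B)
    (hAB : ∀ w : ℂ, 0 < w.re → ‖w‖ ^ p ≤ A * w.re ^ p - B * (w ^ (p : ℂ)).re)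
    {u : ℝ → ℝ} (hu : Integrable u) (hu0 : ∀ t, 0 ≤ u t) {M : ℝ} (hM : 0 < M)
    (hsupp : ∀ t, M < |t| → u t = 0) {ε : ℝ} (hε : 0 < ε) :
    ∫⁻ x : ℝ, ‖cauchyIntegral (fun t => (u t : ℂ)) (x + ε * Complex.I)‖ₑ ^ p ≤
      ENNReal.ofReal A * ∫⁻ x : ℝ,
        ‖(cauchyIntegral (fun t => (u t : ℂ)) (x + ε * Complex.I)).re‖ₑ ^ p := by
  have hp0 : 0 < p := by linarith
  -- The zero function is set aside because strict positivity of the real part, needed for the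
  -- complex power, fails for it.
  rcases (integral_nonneg hu0 : 0 ≤ ∫ t, u t).eq_or_lt with h0 | hpos
  · have hz : u =ᵐ[volume] 0 := (integral_eq_zero_iff_of_nonneg hu0 hu).1 h0.symm
    have hF : ∀ z, cauchyIntegral (fun t => (u t : ℂ)) z = 0 := by
      intro z
      rw [cauchyIntegral, integral_eq_zero_of_ae]
      filter_upwards [hz] with t ht
      simp [ht]
    simp [hF, hp0]
  set f : ℝ → ℂ := fun t => (u t : ℂ)
  have hf : Integrable f := hu.ofReal
  set F : ℝ → ℂ := fun x => cauchyIntegral f (x + ε * Complex.I)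
  have hFc : Continuous F := continuous_cauchyIntegral_horizontal hf hε
  have hre : ∀ z : ℂ, 0 < z.im → 0 < (cauchyIntegral f z).re := fun z hz =>
    cauchyIntegral_re_pos hu hu0 hpos hz
  have hFre : ∀ x, 0 < (F x).re := fun x => hre _ (by simpa using hε)
  have hsl : ∀ x, F x ∈ Complex.slitPlane := fun x => .inl (hFre x)
  have hFp : Continuous fun x => F x ^ (p : ℂ) := by
    rw [continuous_iff_continuousAt]
    exact fun x => hFc.continuousAt.cpow continuousAt_const (hsl x)
  have hn : Continuous fun x => ‖F x‖ ^ p := hFc.norm.rpow_const fun x => .inr hp0.le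
  have hr : Continuous fun x => (F x).re ^ p :=
    (Complex.continuous_re.comp hFc).rpow_const fun x => .inr hp0.le
  set K := (1 / Real.pi * ∫ t, ‖f t‖)
  set D : ℝ → ℝ := fun R => B * (4 * K ^ p * R ^ (1 - p))
  -- Integrating `hAB` over [-R, R] leaves the integral of Re F^p, which the contour estimate bounds
  -- by a multiple of R^{1-p}; this vanishes as R → ∞ because p > 1.
  have key : ∀ R : ℝ, 2 * M ≤ R → ∫⁻ x in Ioc (-R) R, ‖F x‖ₑ ^ p ≤
      ENNReal.ofReal A * (∫⁻ x, ‖(F x).re‖ₑ ^ p) + ENNReal.ofReal (D R) := by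
    intro R hR
    have hR0 : -R ≤ R := by linarith
    have h1 : ∫ x in (-R)..R, ‖F x‖ ^ p ≤ A * (∫ x in (-R)..R, (F x).re ^ p) + D R := by
      have h2 := norm_integral_cauchyIntegral_cpow_le hf hM
        (fun t ht => by simp [f, hsupp t ht]) hre hp hε hR
      have h3 : (∫ x in (-R)..R, (F x ^ (p : ℂ)).re) = (∫ x in (-R)..R, F x ^ (p : ℂ)).re :=
        Complex.reCLM.intervalIntegral_comp_comm (hFp.intervalIntegrable _ _)
      have h4 : -(∫ x in (-R)..R, (F x ^ (p : ℂ)).re) ≤ 4 * K ^ p * R ^ (1 - p) := by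
        rw [h3]
        exact (neg_le_abs _).trans ((Complex.abs_re_le_norm _).trans h2)
      calc ∫ x in (-R)..R, ‖F x‖ ^ p
          ≤ ∫ x in (-R)..R, (A * (F x).re ^ p - B * (F x ^ (p : ℂ)).re) := by
            refine intervalIntegral.integral_mono_on hR0 (hn.intervalIntegrable _ _)
              (Continuous.intervalIntegrable ?_ _ _) fun x _ => hAB _ (hFre x)
            exact (hr.const_mul A).sub ((Complex.continuous_re.comp hFp).const_mul B)
        _ = A * (∫ x in (-R)..R, (F x).re ^ p) + B * -(∫ x in (-R)..R, (F x ^ (p : ℂ)).re) := by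
            rw [intervalIntegral.integral_sub, intervalIntegral.integral_const_mul,
              intervalIntegral.integral_const_mul]
            · ring
            · exact (hr.const_mul A).intervalIntegrable _ _
            · exact ((Complex.continuous_re.comp hFp).const_mul B).intervalIntegrable _ _
        _ ≤ _ := by
            have := mul_le_mul_of_nonneg_left h4 hB
            linarith
    have e1 : ∫⁻ x in Ioc (-R) R, ‖F x‖ₑ ^ p = ENNReal.ofReal (∫ x in (-R)..R, ‖F x‖ ^ p) := by
      rw [intervalIntegral.integral_of_le hR0, ofReal_integral_eq_lintegral_ofReal
        (hn.integrableOn_Ioc) (.of_forall fun x => by positivity)]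
      refine lintegral_congr fun x => ?_
      rw [← ofReal_norm, ENNReal.ofReal_rpow_of_nonneg (norm_nonneg _) hp0.le]
    have e2 : ENNReal.ofReal (∫ x in (-R)..R, (F x).re ^ p) ≤ ∫⁻ x, ‖(F x).re‖ₑ ^ p := by
      rw [intervalIntegral.integral_of_le hR0, ofReal_integral_eq_lintegral_ofReal
        (hr.integrableOn_Ioc) (.of_forall fun x => by have := hFre x; positivity)]
      refine (setLIntegral_le_lintegral _ _).trans (le_of_eq (lintegral_congr fun x => ?_))
      rw [← ofReal_norm, Real.norm_of_nonneg (hFre x).le,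
        ENNReal.ofReal_rpow_of_nonneg (hFre x).le hp0.le]
    rw [e1]
    refine (ENNReal.ofReal_le_ofReal h1).trans (ENNReal.ofReal_add_le.trans ?_)
    rw [ENNReal.ofReal_mul hA]
    gcongr
  have hD : Tendsto (fun n : ℕ => ENNReal.ofReal (D n)) atTop (𝓝 0) := by
    have h1 : Tendsto (fun n : ℕ => D n) atTop (𝓝 0) := by
      have h2 : Tendsto (fun x : ℝ => x ^ (-(p - 1))) atTop (𝓝 0) :=
        tendsto_rpow_neg_atTop (by linarith)
      have h3 := ((h2.comp tendsto_natCast_atTop_atTop).const_mul (4 * K ^ p)).const_mul B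
      simpa [D] using h3
    simpa using ENNReal.tendsto_ofReal h1
  have hcov : AECover volume atTop (fun n : ℕ => Ioc (-(n : ℝ)) n) :=
    aecover_Ioc (tendsto_neg_atTop_atBot.comp tendsto_natCast_atTop_atTop)
      tendsto_natCast_atTop_atTop
  have hlim := hcov.lintegral_tendsto_of_countably_generated (f := fun x => ‖F x‖ₑ ^ p)
    (hFc.measurable.enorm.pow_const p).aemeasurable
  refine le_of_tendsto_of_tendsto hlim ((tendsto_const_nhds.add hD).trans (by rw [add_zero])) ?_
  filter_upwards [tendsto_natCast_atTop_atTop.eventually_ge_atTop (2 * M)] with n hn'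
  exact key n hn'

/-- The compact support in Riesz's estimate is removed by truncating `u` to growing intervals: the
constant is independent of the support, so Fatou's lemma passes to the limit. -/
lemma exists_eLpNorm_cauchyIntegral_nonneg_le {p : ℝ≥0∞} (hp : 1 < p) (hp2 : p ≤ 2) :
    ∃ C : ℝ≥0, ∀ (u : ℝ → ℝ), Integrable u → (∀ t, 0 ≤ u t) → ∀ ε : ℝ, 0 < ε →
      eLpNorm (fun x : ℝ => cauchyIntegral (fun t => (u t : ℂ)) (x + ε * Complex.I)) p ≤
        C * eLpNorm u p := by
  have hpt : p ≠ ∞ := (hp2.trans_lt (by norm_num)).ne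
  have hp0 : p ≠ 0 := (zero_lt_one.trans hp).ne'
  have hp1 : 1 < p.toReal := by
    rw [← ENNReal.toReal_one]; exact ENNReal.toReal_strict_mono hpt hp
  have hp2' : p.toReal ≤ 2 := by
    simpa using (ENNReal.toReal_le_toReal hpt (by norm_num)).2 hp2
  obtain ⟨A, B, hA, hB, hAB⟩ := exists_norm_rpow_le_re hp1 hp2'
  have hbd : ∀ (u : ℝ → ℝ), Integrable u → (∀ t, 0 ≤ u t) → ∀ M : ℝ, 0 < M →
      (∀ t, M < |t| → u t = 0) → ∀ ε : ℝ, 0 < ε →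
      eLpNorm (fun x : ℝ => cauchyIntegral (fun t => (u t : ℂ)) (x + ε * Complex.I)) p ≤
        (A.toNNReal ^ (1 / p.toReal) : ℝ≥0) * eLpNorm u p := by
    intro u hu hu0 M hM hsupp ε hε
    have h1 := lintegral_cauchyIntegral_le hp1 hA hB hAB hu hu0 hM hsupp hε
    refine le_trans ?_ (mul_le_mul_right (eLpNorm_re_cauchyIntegral_le hp hpt hu hε) _)
    rw [eLpNorm_eq_lintegral_rpow_enorm_toReal hp0 hpt,
      eLpNorm_eq_lintegral_rpow_enorm_toReal hp0 hpt,
      ENNReal.coe_rpow_of_nonneg _ (by positivity), ← ENNReal.mul_rpow_of_nonneg _ _ (by positivity)]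
    gcongr
    exact h1
  refine ⟨A.toNNReal ^ (1 / p.toReal), fun u hu hu0 ε hε => ?_⟩
  let v : ℕ → ℝ → ℝ := fun n => (Icc (-(n + 1 : ℝ)) (n + 1)).indicator u
  have hv : ∀ n, Integrable (v n) := fun n => hu.indicator measurableSet_Icc
  refine Lp.eLpNorm_le_of_ae_tendsto (u := atTop)
    (f := fun n (x : ℝ) => cauchyIntegral (fun t => (v n t : ℂ)) (x + ε * Complex.I))
    (.of_forall fun n => ?_) (fun n =>
      (continuous_cauchyIntegral_horizontal (integrable_complex_ofReal (hv n)) hε).aestronglyMeasurable)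
    (.of_forall fun x => ?_)
  · refine (hbd (v n) (hv n) (fun t => indicator_nonneg (fun t _ => hu0 t) t) (n + 1)
      (by positivity) (fun t ht => ?_) ε hε).trans ?_
    · refine indicator_of_notMem (fun h => ?_) _
      exact absurd (abs_le.2 h) (not_le.2 ht)
    · gcongr
      exact eLpNorm_indicator_le _
  · refine tendsto_integral_of_dominated_convergence
      (fun t => ‖u t‖ * (1 / (2 * Real.pi) * ε⁻¹)) (fun n => ?_) (hu.norm.mul_const _)
      (fun n => .of_forall fun t => ?_) (.of_forall fun t => ?_)
    · exact (integrable_mul_cauchyKernel (integrable_complex_ofReal (hv n)) (by simpa using hε)).1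
    · rw [norm_mul, Complex.norm_real]
      gcongr
      · exact norm_indicator_le_norm_self _ _
      · exact norm_cauchyKernel_le hε (by
          simpa using im_le_norm_sub_ofReal (x + ε * Complex.I) t)
    · refine Tendsto.mul_const _ ((Complex.continuous_ofReal.tendsto _).comp ?_)
      refine tendsto_const_nhds.congr' ?_
      filter_upwards [tendsto_natCast_atTop_atTop.eventually_ge_atTop |t|] with n hn
      refine (indicator_of_mem ?_ _).symm
      have := abs_le.1 hn
      constructor <;> linarith

/-- Real and imaginary parts are each split into positive and negative parts, whence the factor 4.
-/
lemma exists_eLpNorm_cauchyIntegral_le {p : ℝ≥0∞} (hp : 1 < p) (hp2 : p ≤ 2) :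
    ∃ C : ℝ≥0, ∀ (f : ℝ → ℂ), Integrable f → ∀ ε : ℝ, 0 < ε →
      eLpNorm (fun x : ℝ => cauchyIntegral f (x + ε * Complex.I)) p ≤ C * eLpNorm f p := by
  obtain ⟨C, hC⟩ := exists_eLpNorm_cauchyIntegral_nonneg_le hp hp2
  have hreal : ∀ (u : ℝ → ℝ), Integrable u → ∀ ε : ℝ, 0 < ε →
      eLpNorm (fun x : ℝ => cauchyIntegral (fun t => (u t : ℂ)) (x + ε * Complex.I)) p ≤
        (2 * C : ℝ≥0) * eLpNorm u p := by
    intro u hu ε hε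
    have hz : ∀ x : ℝ, 0 < (x + ε * Complex.I : ℂ).im := fun x => by simpa using hε
    have hup := integrable_complex_ofReal hu.pos_part
    have hun := integrable_complex_ofReal hu.neg_part
    have e : (fun x : ℝ => cauchyIntegral (fun t => (u t : ℂ)) (x + ε * Complex.I)) =
        (fun x : ℝ => cauchyIntegral (fun t => ((max (u t) 0 : ℝ) : ℂ)) (x + ε * Complex.I)) +
        (-1 : ℂ) • fun x : ℝ => cauchyIntegral (fun t => ((max (-u t) 0 : ℝ) : ℂ)) (x + ε * Complex.I) := by
      ext x
      simp only [Pi.add_apply, Pi.smul_apply, smul_eq_mul]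
      rw [← cauchyIntegral_const_mul, ← cauchyIntegral_add hup (hun.const_mul _) (hz x)]
      congr 1
      ext t
      have : u t = max (u t) 0 - max (-u t) 0 := by
        rcases le_total 0 (u t) with h | h
        · rw [max_eq_left h, max_eq_right (by linarith)]; ring
        · rw [max_eq_right h, max_eq_left (by linarith)]; ring
      nth_rewrite 1 [this]
      push_cast
      ring
    have hle : ∀ t, ‖max (u t) 0‖ ≤ ‖u t‖ ∧ ‖max (-u t) 0‖ ≤ ‖u t‖ := by
      intro t
      simp only [Real.norm_eq_abs]
      constructor <;> rw [abs_of_nonneg (le_max_right _ _)]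
      · exact max_le (le_abs_self _) (abs_nonneg _)
      · exact max_le (neg_le_abs _) (abs_nonneg _)
    rw [e]
    refine (eLpNorm_add_le
      (continuous_cauchyIntegral_horizontal hup hε).aestronglyMeasurable
      ((continuous_cauchyIntegral_horizontal hun hε).aestronglyMeasurable.const_smul _)
      hp.le).trans ?_
    rw [eLpNorm_const_smul]
    simp only [enorm_neg, enorm_one, one_mul]
    refine (add_le_add (hC _ hu.pos_part (fun t => le_max_right _ _) ε hε)
      (hC _ hu.neg_part (fun t => le_max_right _ _) ε hε)).trans ?_
    push_cast
    rw [mul_assoc, two_mul]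
    gcongr
    · exact eLpNorm_mono fun t => (hle t).1
    · exact eLpNorm_mono fun t => (hle t).2
  refine ⟨4 * C, fun f hf ε hε => ?_⟩
  have hz : ∀ x : ℝ, 0 < (x + ε * Complex.I : ℂ).im := fun x => by simpa using hε
  have hfr : Integrable fun t => (f t).re := hf.re
  have hfi : Integrable fun t => (f t).im := hf.im
  have hfr' := integrable_complex_ofReal hfr
  have hfi' := integrable_complex_ofReal hfi
  have e : (fun x : ℝ => cauchyIntegral f (x + ε * Complex.I)) =
      (fun x : ℝ => cauchyIntegral (fun t => (((f t).re : ℝ) : ℂ)) (x + ε * Complex.I)) +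
      Complex.I • fun x : ℝ => cauchyIntegral (fun t => (((f t).im : ℝ) : ℂ)) (x + ε * Complex.I) := by
    ext x
    simp only [Pi.add_apply, Pi.smul_apply, smul_eq_mul]
    rw [← cauchyIntegral_const_mul, ← cauchyIntegral_add hfr' (hfi'.const_mul _) (hz x)]
    congr 1
    ext t
    rw [mul_comm]
    exact (Complex.re_add_im _).symm
  rw [e]
  refine (eLpNorm_add_le
    (continuous_cauchyIntegral_horizontal hfr' hε).aestronglyMeasurable
    ((continuous_cauchyIntegral_horizontal hfi' hε).aestronglyMeasurable.const_smul _)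
    hp.le).trans ?_
  rw [eLpNorm_const_smul]
  have hI : ‖Complex.I‖ₑ = 1 := by rw [← ofReal_norm]; simp
  rw [hI, one_mul]
  refine (add_le_add (hreal _ hfr ε hε) (hreal _ hfi ε hε)).trans ?_
  have h1 : eLpNorm (fun t => (f t).re) p ≤ eLpNorm f p :=
    eLpNorm_mono fun t => Complex.abs_re_le_norm _
  have h2 : eLpNorm (fun t => (f t).im) p ≤ eLpNorm f p :=
    eLpNorm_mono fun t => Complex.abs_im_le_norm _
  refine (add_le_add (mul_le_mul_right h1 _) (mul_le_mul_right h2 _)).trans (le_of_eq ?_)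
  push_cast
  ring

/-! ### Half-lines as multipliers -/

/-- The symbol of `φ ↦ cauchyIntegral φ (· + iε)`. -/
def halfLineExp (ε : ℝ) : ℝ → ℂ :=
  (Ioi (0 : ℝ)).indicator fun ξ => Complex.exp (-(2 * Real.pi * ε : ℝ) * ξ)

lemma norm_halfLineExp_le {ε : ℝ} (hε : 0 < ε) (ξ : ℝ) : ‖halfLineExp ε ξ‖ ≤ 1 := by
  unfold halfLineExp
  by_cases h : ξ ∈ Ioi (0 : ℝ)
  · rw [indicator_of_mem h, Complex.norm_exp]
    have := Real.pi_pos
    have h' : 0 < ξ := h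
    have : 0 ≤ 2 * Real.pi * ε * ξ := by positivity
    simp
    linarith
  · rw [indicator_of_notMem h]; simp

lemma integrable_halfLineExp {ε : ℝ} (hε : 0 < ε) : Integrable (halfLineExp ε) := by
  have := Real.pi_pos
  unfold halfLineExp
  rw [integrable_indicator_iff measurableSet_Ioi]
  exact integrableOn_exp_mul_complex_Ioi (a := -(2 * Real.pi * ε : ℝ))
    (by rw [← Complex.ofReal_neg, Complex.ofReal_re]; simp; positivity) 0

lemma fourierInv_halfLineExp {ε : ℝ} (hε : 0 < ε) (y : ℝ) :
    𝓕⁻ (halfLineExp ε) y = Complex.I / (2 * Real.pi) / (y + ε * Complex.I) := by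
  have hπ := Real.pi_pos
  rw [Real.fourierInv_eq']
  set a : ℂ := -(2 * Real.pi * ε : ℝ) + 2 * Real.pi * y * Complex.I with ha
  have h1 : ∀ ξ : ℝ, Complex.exp ((2 * Real.pi * inner ℝ ξ y : ℝ) * Complex.I) • halfLineExp ε ξ =
      (Ioi (0 : ℝ)).indicator (fun ξ : ℝ => Complex.exp (a * ξ)) ξ := by
    intro ξ
    unfold halfLineExp
    by_cases h : ξ ∈ Ioi (0 : ℝ)
    · rw [indicator_of_mem h, indicator_of_mem h, smul_eq_mul, ← Complex.exp_add]
      congr 1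
      simp [ha]
      ring
    · rw [indicator_of_notMem h, indicator_of_notMem h, smul_zero]
  have hre : a.re = -(2 * Real.pi * ε) := by simp [ha]
  have hane : a ≠ 0 := by
    intro h
    rw [h] at hre
    simp at hre
    rcases hre with h | h
    all_goals linarith
  simp_rw [h1]
  rw [integral_indicator measurableSet_Ioi, integral_exp_mul_complex_Ioi
    (by rw [hre]; simp; positivity)]
  have hne : (y + ε * Complex.I : ℂ) ≠ 0 := by
    intro h
    have := congrArg Complex.im h
    simp at this
    linarith
  have hpi : (Real.pi : ℂ) ≠ 0 := by exact_mod_cast hπ.ne'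
  have ha2 : a = 2 * Real.pi * Complex.I * (y + ε * Complex.I) := by
    rw [ha]; push_cast; ring_nf; simp
  rw [ha2]
  simp only [Complex.ofReal_zero, mul_zero, Complex.exp_zero]
  field_simp
  rw [Complex.I_sq]
  ring

/-- The inverse Fourier transform of the truncated exponential is the Cauchy kernel, and the
multiplication formula moves it onto `φ`. -/
lemma mulOp_halfLineExp {ε : ℝ} (hε : 0 < ε) (φ : 𝓢(ℝ, ℂ)) :
    mulOp (halfLineExp ε) φ = fun x : ℝ => cauchyIntegral φ (x + ε * Complex.I) := by
  ext x
  have hi := integrable_halfLineExp hε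
  have hi' : Integrable (fun ξ => Real.fourierChar (ξ * x) • halfLineExp ε ξ) := by
    simpa [mul_comm x] using (Real.fourierIntegral_convergent_iff (μ := volume) (-x)).2 hi
  have h := integral_fourier_mul φ.integrable hi'
  rw [mulOp, Real.fourierInv_eq, cauchyIntegral]
  refine Eq.trans ?_ (h.trans ?_)
  · refine integral_congr_ae (.of_forall fun ξ => ?_)
    simp only [Circle.smul_def, smul_eq_mul, Real.inner_apply, SchwartzMap.fourier_coe]
    ring
  · refine integral_congr_ae (.of_forall fun t => ?_)
    have e : (x + ε * Complex.I - t : ℂ) = ((x - t : ℝ) : ℂ) + ε * Complex.I := by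
      push_cast; ring
    simp only [e]
    rw [← fourierInv_halfLineExp hε, Real.fourierInv_eq, Real.fourier_real_eq]
    congr 2
    ext ξ
    simp only [Circle.smul_def, smul_smul]
    rw [← Circle.coe_mul, ← AddChar.map_add_eq_mul]
    congr 3
    simp
    ring

/-- The damped symbols tend boundedly to the indicator as ε → 0, and Riesz's bound is uniform in ε.
-/
lemma exists_mulBound_Ioi_of_le_two {p : ℝ≥0∞} (hp : 1 < p) (hp2 : p ≤ 2) :
    ∃ C : ℝ≥0, MulBound p C ((Ioi (0 : ℝ)).indicator fun _ => 1) := by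
  obtain ⟨C, hC⟩ := exists_eLpNorm_cauchyIntegral_le hp hp2
  have hpos : ∀ n : ℕ, (0 : ℝ) < 1 / (n + 1) := fun n => by positivity
  refine ⟨C, MulBound.of_tendsto (f := fun n : ℕ => halfLineExp (1 / (n + 1))) (B := 1)
    (fun n => ⟨⟨(integrable_halfLineExp (hpos n)).1, 1,
      .of_forall (norm_halfLineExp_le (hpos n))⟩, fun φ => ?_⟩)
    (fun n => .of_forall (norm_halfLineExp_le (hpos n))) (.of_forall fun ξ => ?_)⟩
  · rw [mulOp_halfLineExp (hpos n)]
    exact hC _ φ.integrable _ (hpos n)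
  · unfold halfLineExp
    by_cases h : ξ ∈ Ioi (0 : ℝ)
    · simp only [indicator_of_mem h]
      have h1 : Tendsto (fun n : ℕ => (1 / (n + 1) : ℝ)) atTop (𝓝 0) :=
        tendsto_one_div_add_atTop_nhds_zero_nat
      have hc : Continuous fun ε : ℝ => Complex.exp (-(2 * Real.pi * ε : ℝ) * ξ) := by fun_prop
      have := (hc.tendsto 0).comp h1
      simpa [Function.comp_def] using this
    · simp only [indicator_of_notMem h]
      exact tendsto_const_nhds

/-! ### Duality -/

lemma exists_holderConjugate {p : ℝ≥0∞} (hp : 1 < p) (hp' : p ≠ ∞) :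
    ∃ q : ℝ≥0∞, 1 < q ∧ q ≠ ∞ ∧ p.HolderConjugate q ∧ (2 ≤ p → q ≤ 2) ∧ (p ≤ 2 → 2 ≤ q) := by
  have hr : 1 < p.toReal := by
    rw [← ENNReal.toReal_one]; exact ENNReal.toReal_strict_mono hp' hp
  have hc := Real.HolderConjugate.conjExponent hr
  have hpr : ENNReal.ofReal p.toReal = p := ENNReal.ofReal_toReal hp'
  have h := hc.ennrealOfReal
  rw [hpr] at h
  have h2 : ENNReal.ofReal 2 = 2 := by simp
  refine ⟨_, ?_, ENNReal.ofReal_ne_top, h, fun h' => ?_, fun h' => ?_⟩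
  · rw [← ENNReal.ofReal_one]
    exact (ENNReal.ofReal_lt_ofReal_iff hc.symm.pos).2 hc.symm.lt
  · rw [← hpr, ← h2, ENNReal.ofReal_le_ofReal_iff (by linarith)] at h'
    rw [← h2]
    refine ENNReal.ofReal_le_ofReal ?_
    rw [Real.conjExponent, div_le_iff₀ (by linarith)]
    linarith
  · rw [← hpr, ← h2, ENNReal.ofReal_le_ofReal_iff (by norm_num)] at h'
    rw [← h2]
    refine ENNReal.ofReal_le_ofReal ?_
    rw [Real.conjExponent, le_div_iff₀ (by linarith)]
    linarith

section Pairing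

variable {p q : ℝ≥0∞} [Fact (1 ≤ p)] [Fact (1 ≤ q)] [p.HolderConjugate q]

/-- The bilinear pairing `∫ f g` of `L_p(ℝ)` and `L_q(ℝ)`. -/
def pairing (p q : ℝ≥0∞) [Fact (1 ≤ p)] [Fact (1 ≤ q)] [p.HolderConjugate q] :
    Lp ℂ p (volume : Measure ℝ) →L[ℂ] Lp ℂ q (volume : Measure ℝ) →L[ℂ] ℂ :=
  (ContinuousLinearMap.mul ℂ ℂ).lpPairing volume p q

lemma pairing_apply (f : Lp ℂ p (volume : Measure ℝ)) (g : Lp ℂ q (volume : Measure ℝ)) :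
    pairing p q f g = ∫ x, f x * g x :=
  ContinuousLinearMap.lpPairing_eq_integral _ _ _

lemma pairing_toLp {f g : ℝ → ℂ} (hf : MemLp f p) (hg : MemLp g q) :
    pairing p q (hf.toLp f) (hg.toLp g) = ∫ x, f x * g x := by
  rw [pairing_apply]
  refine integral_congr_ae ?_
  filter_upwards [hf.coeFn_toLp, hg.coeFn_toLp] with x h1 h2
  rw [h1, h2]

lemma norm_pairing_le (f : Lp ℂ p (volume : Measure ℝ)) (g : Lp ℂ q (volume : Measure ℝ)) :
    ‖pairing p q f g‖ ≤ ‖f‖ * ‖g‖ := by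
  rw [pairing_apply]
  have h1 := (ContinuousLinearMap.mul ℂ ℂ).norm_holder_apply_apply_le (r := 1) f g
  have h2 : ∫ x, f x * g x = ∫ x, (ContinuousLinearMap.mul ℂ ℂ).holder 1 f g x := by
    refine integral_congr_ae ?_
    filter_upwards [(ContinuousLinearMap.mul ℂ ℂ).coeFn_holder (r := 1) f g] with x hx
    rw [hx]
    rfl
  rw [h2, ← L1.integral_eq_integral]
  refine (L1.norm_integral_le _).trans (h1.trans ?_)
  have h3 : ‖ContinuousLinearMap.mul ℂ ℂ‖ ≤ 1 := ContinuousLinearMap.opNorm_mul_le ℂ ℂ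
  calc _ ≤ 1 * ‖f‖ * ‖g‖ := by gcongr
    _ = _ := by rw [one_mul]

lemma norm_integral_mul_le {f g : ℝ → ℂ} (hf : MemLp f p) (hg : MemLp g q) :
    ‖∫ x, f x * g x‖ ≤ (eLpNorm f p).toReal * (eLpNorm g q).toReal := by
  rw [← pairing_toLp hf hg]
  refine (norm_pairing_le _ _).trans (le_of_eq ?_)
  rw [Lp.norm_toLp, Lp.norm_toLp]

/-- The norm of `g ∈ L_q` is attained in the duality with Schwartz functions. -/
lemma eLpNorm_le_of_forall_schwartz (hp : p ≠ ∞) (hq2 : 2 ≤ q) (hq : q ≠ ∞) {g : ℝ → ℂ}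
    (hg : MemLp g q) {K : ℝ} (hK : 0 ≤ K) (h : ∀ ψ : 𝓢(ℝ, ℂ), ‖∫ x, ψ x * g x‖ ≤ K * (eLpNorm ψ p).toReal) :
    eLpNorm g q ≤ ENNReal.ofReal K := by
  have hq2' : 2 ≤ q.toReal := by
    simpa using (ENNReal.toReal_le_toReal (by norm_num) hq).2 hq2
  have hpq : p.toReal.HolderConjugate q.toReal := ENNReal.HolderConjugate.toReal_of_ne_top hp hq
  have hp0 : p ≠ 0 := (zero_lt_one.trans_le (Fact.out : 1 ≤ p)).ne'
  have hq0 : q ≠ 0 := (zero_lt_one.trans_le (Fact.out : 1 ≤ q)).ne'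
  have hdense : ∀ f : Lp ℂ p (volume : Measure ℝ), ‖pairing p q f (hg.toLp g)‖ ≤ K * ‖f‖ := by
    intro f
    refine (SchwartzMap.denseRange_toLpCLM (F := ℂ) (E := ℝ) (μ := volume) hp).induction_on
      (p := fun f => ‖pairing p q f (hg.toLp g)‖ ≤ K * ‖f‖) f ?_ fun ψ => ?_
    · exact isClosed_le (((pairing p q).flip _).continuous.norm) (by fun_prop)
    · have := h ψ
      rw [← pairing_toLp (ψ.memLp p) hg] at this
      simpa [SchwartzMap.toLp, Lp.norm_toLp] using! this
  -- The extremal function of Hölder's inequality: w g = |g|^q and |w|^p = |g|^q. For q ≥ 2 the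
  -- exponent q - 2 is nonnegative, so the power is continuous at 0.
  set w : ℝ → ℂ := fun x => (starRingEnd ℂ) (g x) * ((‖g x‖ ^ (q.toReal - 2) : ℝ) : ℂ)
  have hwn : ∀ x, ‖w x‖ ^ p.toReal = ‖g x‖ ^ q.toReal := by
    intro x
    have e : ‖w x‖ = ‖g x‖ ^ (q.toReal - 1) := by
      simp only [w, norm_mul, RCLike.norm_conj, Complex.norm_real]
      rw [Real.norm_of_nonneg (by positivity)]
      rcases (norm_nonneg (g x)).eq_or_lt with h0 | h0
      · rw [← h0, zero_mul, Real.zero_rpow (by linarith)]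
      · nth_rewrite 1 [← Real.rpow_one ‖g x‖]
        rw [← Real.rpow_add h0]
        congr 1
        ring
    rw [e, ← Real.rpow_mul (norm_nonneg _), hpq.symm.sub_one_mul_conj]
  have hwm : AEStronglyMeasurable w := by
    refine (Complex.continuous_conj.comp_aestronglyMeasurable hg.1).mul
      (Complex.continuous_ofReal.comp_aestronglyMeasurable ?_)
    exact (Real.continuous_rpow_const (by linarith)).comp_aestronglyMeasurable hg.1.norm
  have hint : Integrable fun x => ‖g x‖ ^ q.toReal := hg.integrable_norm_rpow hq0 hq
  have hw : MemLp w p := by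
    rw [← integrable_norm_rpow_iff hwm hp0 hp]
    simpa only [hwn] using hint
  have h1 := hdense (hw.toLp w)
  rw [pairing_toLp, Lp.norm_toLp, hw.eLpNorm_eq_integral_rpow_norm hp0 hp] at h1
  simp_rw [hwn] at h1
  have e1 : ∫ x, w x * g x = ((∫ x, ‖g x‖ ^ q.toReal : ℝ) : ℂ) := by
    rw [← integral_complex_ofReal]
    refine integral_congr_ae (.of_forall fun x => ?_)
    simp only [w]
    rw [mul_right_comm, mul_comm (_ : ℂ) (g x), Complex.mul_conj, Complex.normSq_eq_norm_sq,
      ← Complex.ofReal_mul]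
    congr 1
    rcases (norm_nonneg (g x)).eq_or_lt with h0 | h0
    · rw [← h0, Real.zero_rpow (by linarith : q.toReal ≠ 0)]; simp
    · rw [← Real.rpow_natCast, ← Real.rpow_add h0]
      congr 1
      push_cast
      ring
  set N := ∫ x, ‖g x‖ ^ q.toReal
  have hN : 0 ≤ N := integral_nonneg fun x => by positivity
  rw [e1, Complex.norm_real, Real.norm_of_nonneg hN, ENNReal.toReal_ofReal (by positivity)] at h1
  rw [hg.eLpNorm_eq_integral_rpow_norm hq0 hq]
  apply ENNReal.ofReal_le_ofReal
  change N ^ q.toReal⁻¹ ≤ K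
  rcases hN.eq_or_lt with h0 | h0
  · rw [← h0, Real.zero_rpow (inv_ne_zero (by linarith))]
    exact hK
  -- The inequality now reads N ≤ K N^{1/p}; dividing by N^{1/p} leaves N^{1/q} ≤ K.
  · have e2 : N = N ^ q.toReal⁻¹ * N ^ p.toReal⁻¹ := by
      rw [← Real.rpow_add h0, add_comm, hpq.inv_add_inv_eq_one, Real.rpow_one]
    nth_rewrite 1 [e2] at h1
    exact le_of_mul_le_mul_right h1 (by positivity)

/-- The transpose has the reflected symbol, and the L_q norm is recovered by testing against
Schwartz functions. The condition q ≥ 2 ensures in advance that the function tested lies in L_q. -/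
lemma MulBound.dual (hp : p ≠ ∞) (hq2 : 2 ≤ q) (hq : q ≠ ∞) {C : ℝ≥0} {m : ℝ → ℂ}
    (h : MulBound p C m) : MulBound q C (fun ξ => m (-ξ)) := by
  have h' : IsBddSymbol (fun ξ => m (-ξ)) := by
    simpa using h.toIsBddSymbol.comp_mul_left (c := -1) (by norm_num)
  refine ⟨h', fun φ => ?_⟩
  have hφ := φ.memLp q
  have e : (C : ℝ≥0∞) * eLpNorm φ q = ENNReal.ofReal (C * (eLpNorm φ q).toReal) := by
    rw [ENNReal.ofReal_mul C.coe_nonneg, ENNReal.ofReal_coe_nnreal, ENNReal.ofReal_toReal hφ.2.ne]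
  rw [e]
  refine eLpNorm_le_of_forall_schwartz hp hq2 hq (h'.memLp_mulOp φ hq2 hq) (by positivity)
    fun ψ => ?_
  have hψ := ψ.memLp p
  have hm : MemLp (mulOp m ψ) p :=
    ⟨(h.continuous_mulOp ψ).aestronglyMeasurable,
      (h.bound ψ).trans_lt (ENNReal.mul_lt_top ENNReal.coe_lt_top hψ.2)⟩
  rw [← h.integral_mulOp_mul_eq]
  refine (norm_integral_mul_le hm hφ).trans ?_
  have h1 := ENNReal.toReal_mono (ENNReal.mul_lt_top ENNReal.coe_lt_top hψ.2).ne (h.bound ψ)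
  rw [ENNReal.toReal_mul, ENNReal.coe_toReal] at h1
  calc _ ≤ C * (eLpNorm ψ p).toReal * (eLpNorm φ q).toReal := by gcongr
    _ = _ := by ring

end Pairing

/-! ### Functions of bounded variation -/

/-- For p ≥ 2 duality gives the reflected half-line, and subtracting its indicator from 1 gives the
positive half-line up to the point 0. -/
lemma exists_mulBound_Ioi {p : ℝ≥0∞} (hp : 1 < p) (hp' : p ≠ ∞) :
    ∃ C : ℝ≥0, MulBound p C ((Ioi (0 : ℝ)).indicator fun _ => 1) := by
  rcases le_total p 2 with h | h
  · exact exists_mulBound_Ioi_of_le_two hp h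
  · obtain ⟨q, hq1, hq', hpq, hq2, -⟩ := exists_holderConjugate hp hp'
    have := hpq.symm
    obtain ⟨C, hC⟩ := exists_mulBound_Ioi_of_le_two hq1 (hq2 h)
    have : Fact (1 ≤ p) := ⟨hp.le⟩
    have : Fact (1 ≤ q) := ⟨hq1.le⟩
    have h1 := hC.dual hq' h hp'
    have h2 := (MulBound.const p 1).add hp.le (h1.const_mul (-1))
    refine ⟨_, h2.congr ?_⟩
    have h0 : ∀ᵐ ξ : ℝ, ξ ≠ 0 := by
      simp [ae_iff, measure_singleton]
    filter_upwards [h0] with ξ hξ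
    rcases lt_or_gt_of_ne hξ with h | h
    · simp [indicator, h, not_lt.2 h.le]
    · simp [indicator, h, not_lt.2 h.le]

/-- Step functions which approximate `b`. -/
def stepApprox (b : ℝ → ℂ) (n : ℕ) (ξ : ℝ) : ℂ :=
  b (-n) + ∑ i ∈ Finset.range (2 * n * (n + 1)),
    (b (-n + (i + 1 : ℕ) / (n + 1)) - b (-n + (i : ℕ) / (n + 1))) *
      (Ioi (0 : ℝ)).indicator (fun _ => 1) (ξ - (-n + (i + 1 : ℕ) / (n + 1)))

/-- The increments telescope up to the last grid point strictly below `ξ`, so the step function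
takes the value of `b` at that point. -/
lemma exists_stepApprox_eq (b : ℝ → ℂ) {n : ℕ} {ξ : ℝ} (hξ : |ξ| < n) :
    ∃ t, |t - ξ| ≤ 1 / (n + 1) ∧ stepApprox b n ξ = b t := by
  obtain ⟨h1, h2⟩ := abs_lt.1 hξ
  have hn : (0 : ℝ) < n + 1 := by positivity
  set x : ℝ := (ξ + n) * (n + 1) with hx
  have hx0 : 0 < x := mul_pos (by linarith) hn
  -- Here `x` is the position of `ξ` in grid units counted from -n. The half-lines are open, so `j`
  -- is the largest integer strictly below `x`, hence one less than the ceiling.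
  obtain ⟨j, hj⟩ : ∃ j, ⌈x⌉₊ = j + 1 := ⟨⌈x⌉₊ - 1, by have := Nat.ceil_pos.2 hx0; omega⟩
  have hlt : ∀ i : ℕ, (0 : ℝ) < ξ - (-n + (i + 1 : ℕ) / (n + 1)) ↔ i < j := by
    intro i
    have h3 : (i + 1 < ⌈x⌉₊) ↔ ((i + 1 : ℕ) : ℝ) < x := Nat.lt_ceil
    rw [hj, add_lt_add_iff_right] at h3
    rw [h3, hx, ← div_lt_iff₀ hn]
    constructor <;> intro h <;> linarith
  have hjle : j ≤ 2 * n * (n + 1) := by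
    have h3 : ⌈x⌉₊ ≤ 2 * n * (n + 1) := by
      rw [Nat.ceil_le, hx]
      push_cast
      gcongr
      linarith
    omega
  have hjx : (j : ℝ) < x := Nat.lt_ceil.1 (by omega)
  have hxj : x ≤ (j + 1 : ℕ) := Nat.ceil_le.1 hj.le
  refine ⟨-n + (j : ℕ) / (n + 1), ?_, ?_⟩
  · rw [abs_le]
    have e1 : (j : ℝ) / (n + 1) < ξ + n := by rwa [div_lt_iff₀ hn]
    have e2 : ξ + n ≤ ((j + 1 : ℕ) : ℝ) / (n + 1) := by rwa [le_div_iff₀ hn]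
    push_cast at e2
    rw [add_div] at e2
    have : 0 < 1 / (n + 1 : ℝ) := by positivity
    constructor <;> linarith
  · unfold stepApprox
    have e : ∀ i : ℕ, (b (-n + (i + 1 : ℕ) / (n + 1)) - b (-n + (i : ℕ) / (n + 1))) *
        (Ioi (0 : ℝ)).indicator (fun _ => 1) (ξ - (-n + (i + 1 : ℕ) / (n + 1))) =
        if i < j then b (-n + (i + 1 : ℕ) / (n + 1)) - b (-n + (i : ℕ) / (n + 1)) else 0 := by
      intro i
      simp only [indicator, mem_Ioi, hlt]
      split_ifs <;> simp
    rw [Finset.sum_congr rfl fun i _ => e i, ← Finset.sum_filter]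
    have e2 : (Finset.range (2 * n * (n + 1))).filter (fun i => i < j) = Finset.range j := by
      ext i
      simp only [Finset.mem_filter, Finset.mem_range]
      omega
    rw [e2, Finset.sum_range_sub (fun i : ℕ => b (-n + (i : ℝ) / (n + 1)))]
    simp

lemma sum_nnnorm_le_eVariationOn {b : ℝ → ℂ} (hb : BoundedVariationOn b univ) (n N : ℕ) :
    ∑ i ∈ Finset.range N, ‖b (-n + (i + 1 : ℕ) / (n + 1)) - b (-n + (i : ℕ) / (n + 1))‖₊ ≤
      (eVariationOn b univ).toNNReal := by
  rw [← ENNReal.coe_le_coe, ENNReal.coe_toNNReal hb]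
  refine le_trans (le_of_eq ?_) (eVariationOn.sum_le (n := N)
    (u := fun i : ℕ => (-n + (i : ℝ) / (n + 1))) (fun i j hij => ?_) fun i => mem_univ _)
  · push_cast
    refine Finset.sum_congr rfl fun i _ => ?_
    rw [edist_eq_enorm_sub]
    rfl
  · have : (i : ℝ) ≤ j := by exact_mod_cast hij
    simp only
    gcongr

/-- Stechkin's theorem: functions of bounded variation are Fourier multipliers. -/
lemma MulBound.of_boundedVariation {p : ℝ≥0∞} (hp : 1 < p) {C : ℝ≥0}
    (hC : MulBound p C ((Ioi (0 : ℝ)).indicator fun _ => 1)) {b : ℝ → ℂ}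
    (hb : BoundedVariationOn b univ) {S : ℝ≥0} (hS : ∀ ξ, ‖b ξ‖₊ ≤ S) :
    MulBound p (S + (eVariationOn b univ).toNNReal * C) b := by
  refine MulBound.of_tendsto (f := stepApprox b) (B := S + (eVariationOn b univ).toNNReal)
    (fun n => ?_) (fun n => .of_forall fun ξ => ?_) ?_
  · have h1 := (MulBound.const p (b (-n))).add hp.le (MulBound.sum hp.le
      (Finset.range (2 * n * (n + 1))) fun i : ℕ =>
        (hC.comp_sub_right (-n + (i + 1 : ℕ) / (n + 1))).const_mul
          (b (-n + (i + 1 : ℕ) / (n + 1)) - b (-n + (i : ℕ) / (n + 1))))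
    refine h1.mono (add_le_add (hS _) ?_)
    rw [← Finset.sum_mul]
    gcongr
    exact sum_nnnorm_le_eVariationOn hb n _
  · refine (norm_add_le _ _).trans (add_le_add (hS _) ((norm_sum_le _ _).trans ?_))
    refine le_trans ?_ (NNReal.coe_le_coe.2 (sum_nnnorm_le_eVariationOn hb n (2 * n * (n + 1))))
    push_cast
    refine Finset.sum_le_sum fun i _ => ?_
    rw [norm_mul]
    refine mul_le_of_le_one_right (norm_nonneg _) ?_
    exact (norm_indicator_le_norm_self _ _).trans (by simp)
  -- A function of bounded variation is differentiable, hence continuous, almost everywhere, and the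
  -- step functions sample `b` within 1/(n+1) of the point.
  · filter_upwards [hb.locallyBoundedVariationOn.ae_differentiableAt] with ξ hξ
    have hc := hξ.continuousAt
    rw [Metric.continuousAt_iff] at hc
    rw [Metric.tendsto_atTop]
    intro ε hε
    obtain ⟨δ, hδ, h⟩ := hc ε hε
    obtain ⟨N₁, hN₁⟩ := exists_nat_gt |ξ|
    obtain ⟨N₂, hN₂⟩ := exists_nat_one_div_lt hδ
    refine ⟨max N₁ N₂, fun n hn => ?_⟩
    have h1 : (N₁ : ℝ) ≤ n := by exact_mod_cast (le_max_left _ _).trans hn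
    have h2 : (N₂ : ℝ) ≤ n := by exact_mod_cast (le_max_right _ _).trans hn
    obtain ⟨t, ht, he⟩ := exists_stepApprox_eq b (hN₁.trans_le h1)
    rw [he]
    refine h (ht.trans_lt (lt_of_le_of_lt ?_ hN₂))
    gcongr

lemma nnnorm_le_of_boundedVariationOn {b : ℝ → ℂ} (hb : BoundedVariationOn b univ) (ξ : ℝ) :
    ‖b ξ‖₊ ≤ ‖b 0‖₊ + (eVariationOn b univ).toNNReal := by
  have h1 := hb.dist_le (mem_univ ξ) (mem_univ 0)
  rw [← NNReal.coe_le_coe]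
  push_cast
  have h2 : ‖b ξ‖ ≤ ‖b 0‖ + dist (b ξ) (b 0) := by
    rw [dist_eq_norm]; exact norm_le_norm_add_norm_sub' _ _
  exact h2.trans (by gcongr)

lemma exists_mulBound_of_boundedVariation {p : ℝ≥0∞} (hp : 1 < p) (hp' : p ≠ ∞) {b : ℝ → ℂ}
    (hb : BoundedVariationOn b univ) : ∃ C, MulBound p C b := by
  obtain ⟨C, hC⟩ := exists_mulBound_Ioi hp hp'
  exact ⟨_, hC.of_boundedVariation hp hb (nnnorm_le_of_boundedVariationOn hb)⟩

/-- A Lipschitz continuous extension of `z ↦ z⁻¹` from `‖z‖ ≥ c` to the plane. -/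
def lipInv (c : ℝ) (z : ℂ) : ℂ := (starRingEnd ℂ) z / ((max ‖z‖ c ^ 2 : ℝ) : ℂ)

lemma lipInv_eq_inv {c : ℝ} {z : ℂ} (hz : c ≤ ‖z‖) : lipInv c z = z⁻¹ := by
  rw [lipInv, max_eq_left hz, Complex.inv_def, Complex.normSq_eq_norm_sq, div_eq_mul_inv,
    Complex.ofReal_inv]

lemma lipschitzWith_lipInv {c : ℝ} (hc : 0 < c) :
    LipschitzWith (3 / c ^ 2).toNNReal (lipInv c) := by
  refine LipschitzWith.of_dist_le_mul fun z w => ?_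
  rw [Real.coe_toNNReal _ (by positivity), dist_eq_norm, dist_eq_norm]
  set M := max ‖z‖ c
  set N := max ‖w‖ c
  have hM : c ≤ M := le_max_right _ _
  have hN : c ≤ N := le_max_right _ _
  have hM0 : 0 < M := hc.trans_le hM
  have hN0 : 0 < N := hc.trans_le hN
  have hMN : |N - M| ≤ ‖z - w‖ := by
    refine (abs_max_sub_max_le_abs _ _ _).trans ?_
    rw [abs_sub_comm]
    exact abs_norm_sub_norm_le z w
  -- The second term, with |w| ≤ N and |N - M| ≤ |z - w|, contributes 1/M² + 1/(MN); together with
  -- 1/M² from the first this makes three summands of at most 1/c², hence the constant 3/c².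
  have e : lipInv c z - lipInv c w = (starRingEnd ℂ) (z - w) * ((1 / M ^ 2 : ℝ) : ℂ) +
      (starRingEnd ℂ) w * (((N - M) * (N + M) / (M ^ 2 * N ^ 2) : ℝ) : ℂ) := by
    have hMc : (M : ℂ) ≠ 0 := by exact_mod_cast hM0.ne'
    have hNc : (N : ℂ) ≠ 0 := by exact_mod_cast hN0.ne'
    simp only [lipInv, map_sub]
    change _ / ((M ^ 2 : ℝ) : ℂ) - _ / ((N ^ 2 : ℝ) : ℂ) = _
    push_cast
    field_simp
    ring
  have e2 : |(N - M) * (N + M) / (M ^ 2 * N ^ 2)| = |N - M| * (N + M) / (M ^ 2 * N ^ 2) := by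
    rw [abs_div, abs_mul, abs_of_pos (by positivity : 0 < N + M),
      abs_of_pos (by positivity : 0 < M ^ 2 * N ^ 2)]
  rw [e]
  refine (norm_add_le _ _).trans ?_
  rw [norm_mul, norm_mul, RCLike.norm_conj, RCLike.norm_conj, Complex.norm_real, Complex.norm_real,
    Real.norm_eq_abs, Real.norm_eq_abs, e2, abs_of_pos (by positivity : 0 < 1 / M ^ 2)]
  have h1 : ‖w‖ ≤ N := le_max_left _ _
  have h2 : 1 / M ^ 2 ≤ 1 / c ^ 2 := by gcongr
  have h3 : 1 / (M * N) ≤ 1 / c ^ 2 := by rw [pow_two]; gcongr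
  calc _ ≤ ‖z - w‖ * (1 / M ^ 2) + N * (‖z - w‖ * (N + M) / (M ^ 2 * N ^ 2)) := by gcongr
    _ = ‖z - w‖ * (1 / M ^ 2 + 1 / M ^ 2 + 1 / (M * N)) := by field_simp; ring
    _ ≤ ‖z - w‖ * (1 / c ^ 2 + 1 / c ^ 2 + 1 / c ^ 2) := by gcongr
    _ = _ := by ring

/-- The lower bound holds only almost everywhere, so the pointwise inverse may itself fail to have
bounded variation. The composition with `lipInv` has it and agrees with the inverse almost
everywhere. -/
lemma exists_mulBound_inv_of_boundedVariation {p : ℝ≥0∞} (hp : 1 < p) (hp' : p ≠ ∞) {b : ℝ → ℂ}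
    (hb : BoundedVariationOn b univ) {c : ℝ} (hc : 0 < c) (h : ∀ᵐ ξ, c ≤ ‖b ξ‖) :
    ∃ C, MulBound p C (fun ξ => (b ξ)⁻¹) := by
  obtain ⟨C, hC⟩ := exists_mulBound_of_boundedVariation hp hp'
    ((lipschitzWith_lipInv hc).comp_boundedVariationOn hb)
  refine ⟨C, hC.congr ?_⟩
  filter_upwards [h] with ξ hξ
  exact lipInv_eq_inv hξ

/-! ### The Wiener class -/

lemma boundedVariationOn_schwartz (f : 𝓢(ℝ, ℂ)) : BoundedVariationOn f univ := by
  set f' := SchwartzMap.derivCLM ℝ ℂ f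
  have hd : ∀ x, HasDerivAt f (f' x) x := fun x => f.differentiableAt.hasDerivAt
  have hi : Integrable fun x => ‖f' x‖ := f'.integrable.norm
  have hc : Continuous f' := f'.continuous
  set I := ∫ x, ‖f' x‖
  refine ne_top_of_le_ne_top (ENNReal.ofReal_ne_top (r := I)) (iSup_le ?_)
  rintro ⟨n, u, hu, -⟩
  simp only
  have h1 : ∀ i, ‖f (u (i + 1)) - f (u i)‖ ≤ ∫ x in (u i)..(u (i + 1)), ‖f' x‖ := by
    intro i
    rw [← intervalIntegral.integral_eq_sub_of_hasDerivAt (fun x _ => hd x)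
      (hc.intervalIntegrable _ _)]
    exact intervalIntegral.norm_integral_le_integral_norm (hu (Nat.le_succ i))
  calc ∑ i ∈ Finset.range n, edist (f (u (i + 1))) (f (u i))
      = ENNReal.ofReal (∑ i ∈ Finset.range n, ‖f (u (i + 1)) - f (u i)‖) := by
        rw [ENNReal.ofReal_sum_of_nonneg fun i _ => norm_nonneg _]
        refine Finset.sum_congr rfl fun i _ => ?_
        rw [edist_eq_enorm_sub, ofReal_norm]
    _ ≤ ENNReal.ofReal I := by
        refine ENNReal.ofReal_le_ofReal ((Finset.sum_le_sum fun i _ => h1 i).trans ?_)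
        rw [intervalIntegral.sum_integral_adjacent_intervals fun i _ =>
          hc.norm.intervalIntegrable _ _, intervalIntegral.integral_of_le (hu (Nat.zero_le n))]
        exact setIntegral_le_integral hi (.of_forall fun x => norm_nonneg _)

lemma exists_schwartz_lintegral_sub_lt {k : ℝ → ℂ} (hk : Integrable k) {η : ℝ} (hη : 0 < η) :
    ∃ h : 𝓢(ℝ, ℂ), ∫⁻ t, ‖k t - h t‖ₑ < ENNReal.ofReal η := by
  have hk' : MemLp k 1 := memLp_one_iff_integrable.2 hk
  have hd := SchwartzMap.denseRange_toLpCLM (F := ℂ) (E := ℝ) (μ := volume) (p := 1)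
    ENNReal.one_ne_top (hk'.toLp k)
  rw [Metric.mem_closure_range_iff] at hd
  obtain ⟨h, hh⟩ := hd η hη
  refine ⟨h, ?_⟩
  have e : SchwartzMap.toLpCLM ℝ ℂ 1 (volume : Measure ℝ) h = (h.memLp 1).toLp h := rfl
  have hh' : dist (hk'.toLp k) ((h.memLp 1).toLp h) < η := hh
  rw [dist_eq_norm, ← MemLp.toLp_sub, Lp.norm_toLp, eLpNorm_one_eq_lintegral_enorm] at hh'
  have hfin : ∫⁻ t, ‖(k - h) t‖ₑ ≠ ∞ := (hk.sub h.integrable).2.ne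
  exact (ENNReal.lt_ofReal_iff_toReal_lt hfin).2 hh'

lemma norm_pow_sub_pow_le {u v : ℂ} {ρ : ℝ} (hu : ‖u‖ ≤ ρ) (hv : ‖v‖ ≤ ρ) (n : ℕ) :
    ‖u ^ (n + 1) - v ^ (n + 1)‖ ≤ (n + 1) * ρ ^ n * ‖u - v‖ := by
  have hρ : 0 ≤ ρ := (norm_nonneg u).trans hu
  induction n with
  | zero => simp
  | succ n ih =>
    have e : u ^ (n + 1 + 1) - v ^ (n + 1 + 1) =
        u ^ (n + 1) * (u - v) + (u ^ (n + 1) - v ^ (n + 1)) * v := by ring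
    rw [e]
    refine (norm_add_le _ _).trans ?_
    rw [norm_mul, norm_mul, norm_pow]
    calc _ ≤ ρ ^ (n + 1) * ‖u - v‖ + ((n + 1) * ρ ^ n * ‖u - v‖) * ρ := by gcongr
      _ = _ := by push_cast; ring

lemma eVariationOn_le_of_forall_norm_le {f g : ℝ → ℂ} {K : ℝ≥0}
    (h : ∀ x y, ‖f x - f y‖ ≤ K * ‖g x - g y‖) :
    eVariationOn f univ ≤ K * eVariationOn g univ := by
  refine iSup_le ?_
  rintro ⟨n, u, hu, -⟩
  simp only
  calc ∑ i ∈ Finset.range n, edist (f (u (i + 1))) (f (u i))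
      ≤ ∑ i ∈ Finset.range n, K * edist (g (u (i + 1))) (g (u i)) := by
        refine Finset.sum_le_sum fun i _ => ?_
        rw [edist_eq_enorm_sub, edist_eq_enorm_sub, ← ofReal_norm, ← ofReal_norm,
          ← ENNReal.ofReal_coe_nnreal, ← ENNReal.ofReal_mul K.coe_nonneg]
        exact ENNReal.ofReal_le_ofReal (h _ _)
    _ ≤ _ := by
        rw [← Finset.mul_sum]
        gcongr
        exact eVariationOn.sum_le hu fun i => mem_univ _

/-- Powers of the inverse of `c + 𝓕 h`, for a Schwartz function `h`, are multipliers with norms of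
almost geometric growth. -/
lemma MulBound.inv_pow {p : ℝ≥0∞} (hp : 1 < p) {C : ℝ≥0}
    (hC : MulBound p C ((Ioi (0 : ℝ)).indicator fun _ => 1)) {b : ℝ → ℂ}
    (hb : BoundedVariationOn b univ) {μ : ℝ≥0} (hμ : 0 < μ) (h : ∀ ξ, μ ≤ ‖b ξ‖₊) (n : ℕ) :
    MulBound p (μ⁻¹ ^ (n + 1) + (n + 1) * μ⁻¹ ^ (n + 2) * (eVariationOn b univ).toNNReal * C)
      (fun ξ => ((b ξ)⁻¹) ^ (n + 1)) := by
  have hinv : ∀ ξ, ‖(b ξ)⁻¹‖ ≤ (μ⁻¹ : ℝ≥0) := by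
    intro ξ
    rw [norm_inv, NNReal.coe_inv]
    have : (μ : ℝ) ≤ ‖b ξ‖ := h ξ
    gcongr
  have hb0 : ∀ ξ, b ξ ≠ 0 := fun ξ h0 => by
    have := h ξ
    rw [h0, nnnorm_zero] at this
    exact absurd this (not_le.2 hμ)
  -- Taking powers on the disc of radius μ⁻¹ costs (n+1) μ^{-n} and inversion costs μ^{-2}. The
  -- linear factor n + 1 is harmless for the geometric series that uses this bound.
  have hlip : ∀ x y, ‖((b x)⁻¹) ^ (n + 1) - ((b y)⁻¹) ^ (n + 1)‖ ≤
      ((n + 1) * μ⁻¹ ^ (n + 2) : ℝ≥0) * ‖b x - b y‖ := by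
    intro x y
    refine (norm_pow_sub_pow_le (hinv x) (hinv y) n).trans ?_
    have e : (b x)⁻¹ - (b y)⁻¹ = -((b x)⁻¹ * (b x - b y) * (b y)⁻¹) := by
      have := hb0 x
      have := hb0 y
      field_simp
      ring
    rw [e, norm_neg, norm_mul, norm_mul]
    calc _ ≤ (n + 1) * ((μ⁻¹ : ℝ≥0) : ℝ) ^ n * (((μ⁻¹ : ℝ≥0) : ℝ) * ‖b x - b y‖ * ((μ⁻¹ : ℝ≥0) : ℝ)) := by
          gcongr
          · exact hinv x
          · exact hinv y
      _ = _ := by push_cast; ring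
  have hv := eVariationOn_le_of_forall_norm_le hlip
  have hbv : BoundedVariationOn (fun ξ => ((b ξ)⁻¹) ^ (n + 1)) univ :=
    ne_top_of_le_ne_top (ENNReal.mul_ne_top ENNReal.coe_ne_top hb) hv
  refine (hC.of_boundedVariation hp hbv (S := μ⁻¹ ^ (n + 1)) fun ξ => ?_).mono ?_
  · rw [nnnorm_pow]
    gcongr
    exact hinv ξ
  · gcongr
    have := ENNReal.toNNReal_mono (ENNReal.mul_ne_top ENNReal.coe_ne_top hb) hv
    rwa [ENNReal.toNNReal_mul, ENNReal.toNNReal_coe] at this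

lemma norm_fourier_le (k : ℝ → ℂ) (ξ : ℝ) : ‖𝓕 k ξ‖ ≤ ∫ t, ‖k t‖ :=
  VectorFourier.norm_fourierIntegral_le_integral_norm _ _ _ _ _

lemma fourier_sub {f g : ℝ → ℂ} (hf : Integrable f) (hg : Integrable g) (ξ : ℝ) :
    𝓕 (fun t => f t - g t) ξ = 𝓕 f ξ - 𝓕 g ξ := by
  simp only [Real.fourier_eq]
  rw [← integral_sub ((Real.fourierIntegral_convergent_iff ξ).2 hf)
    ((Real.fourierIntegral_convergent_iff ξ).2 hg)]
  simp only [smul_sub]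

/-- A form of Wiener's lemma for Fourier multipliers. -/
lemma exists_mulBound_inv_add_fourier {p : ℝ≥0∞} (hp : 1 < p) (hp' : p ≠ ∞) (c : ℂ) {k : ℝ → ℂ}
    (hk : Integrable k) {δ : ℝ} (hδ : 0 < δ) (h : ∀ ξ, δ ≤ ‖c + 𝓕 k ξ‖) :
    ∃ C, MulBound p C (fun ξ => (c + 𝓕 k ξ)⁻¹) := by
  obtain ⟨C₀, hC₀⟩ := exists_mulBound_Ioi hp hp'
  -- With an L_1 error below δ/3 the perturbation satisfies |E| ≤ δ/3 and the main part keeps |b| ≥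
  -- 2δ/3, so the ratio is at most 1/2.
  obtain ⟨g, hg⟩ := exists_schwartz_lintegral_sub_lt hk (η := δ / 3) (by positivity)
  have hki : Integrable (fun t => k t - g t) := hk.sub g.integrable
  set η := (∫⁻ t, ‖k t - g t‖ₑ).toNNReal with hη
  set E : ℝ → ℂ := 𝓕 (fun t => k t - g t)
  have hηδ : (η : ℝ) ≤ δ / 3 := by
    have := ENNReal.toReal_mono ENNReal.ofReal_ne_top hg.le
    rwa [ENNReal.toReal_ofReal (by positivity)] at this
  have hE : ∀ ξ, ‖E ξ‖ ≤ δ / 3 := by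
    intro ξ
    refine (norm_fourier_le _ ξ).trans (le_trans (le_of_eq ?_) hηδ)
    rw [integral_norm_eq_lintegral_enorm hki.1]
    rfl
  set b : ℝ → ℂ := fun ξ => c + 𝓕 g ξ
  have hbE : ∀ ξ, c + 𝓕 k ξ = b ξ + E ξ := by
    intro ξ
    have := fourier_sub hk g.integrable ξ
    simp only [b, E, SchwartzMap.fourier_coe]
    rw [this]
    ring
  set μ : ℝ≥0 := (2 * δ / 3).toNNReal
  have hμ : (μ : ℝ) = 2 * δ / 3 := Real.coe_toNNReal _ (by positivity)
  have hμ0 : 0 < μ := by rw [← NNReal.coe_pos, hμ]; positivity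
  have hbμ : ∀ ξ, (μ : ℝ) ≤ ‖b ξ‖ := by
    intro ξ
    have h1 := h ξ
    rw [hbE] at h1
    have h2 := norm_add_le (b ξ) (E ξ)
    have h3 := hE ξ
    rw [hμ]
    linarith
  have hbv : BoundedVariationOn b univ := by
    refine ne_top_of_le_ne_top (ENNReal.mul_ne_top (ENNReal.coe_ne_top (r := 1))
      (boundedVariationOn_schwartz (𝓕 g))) (eVariationOn_le_of_forall_norm_le fun x y => ?_)
    simp [b]
  set V := (eVariationOn b univ).toNNReal
  -- The power of `E` and the power of b⁻¹ are decoupled so that the induction runs on `j` alone,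
  -- each factor `E` costing `η` by Young's inequality. Only n = j is used below.
  have hterm : ∀ n : ℕ, ∀ j : ℕ, MulBound p
      (η ^ j * (μ⁻¹ ^ (n + 1) + (n + 1) * μ⁻¹ ^ (n + 2) * V * C₀))
      (fun ξ => E ξ ^ j * ((b ξ)⁻¹) ^ (n + 1)) := by
    intro n j
    induction j with
    | zero => simpa using hC₀.inv_pow hp hbv hμ0 hbμ n
    | succ j ih =>
      have := ih.fourier_mul hp hp' hki
      rw [← hη, ← mul_assoc, ← pow_succ'] at this
      simpa only [pow_succ', mul_assoc] using this
  set d : ℕ → ℝ≥0 := fun n => η ^ n * (μ⁻¹ ^ (n + 1) + (n + 1) * μ⁻¹ ^ (n + 2) * V * C₀)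
  have hρ : η * μ⁻¹ ≤ 1 / 2 := by
    rw [← NNReal.coe_le_coe]
    push_cast
    rw [hμ]
    calc (η : ℝ) * (2 * δ / 3)⁻¹ ≤ δ / 3 * (2 * δ / 3)⁻¹ := by gcongr
      _ = 1 / 2 := by field_simp
  have hd : Summable d := by
    have h1 : Summable fun n : ℕ => ((n : ℝ) ^ 1 * (1 / 2 : ℝ) ^ n) :=
      summable_pow_mul_geometric_of_norm_lt_one 1 (by norm_num)
    have h2 : Summable fun n : ℕ => ((1 / 2 : ℝ) ^ n) := summable_geometric_two
    have h3 : Summable fun n : ℕ => (μ⁻¹ * (1 / 2) ^ n +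
        ((n + 1) * (1 / 2) ^ n) * (μ⁻¹ ^ 2 * V * C₀) : ℝ≥0) := by
      rw [← NNReal.summable_coe]
      push_cast
      refine (h2.mul_left _).add (Summable.mul_right _ ?_)
      simpa [add_mul] using h1.add h2
    refine NNReal.summable_of_le (fun n => ?_) h3
    have e : d n = μ⁻¹ * (η * μ⁻¹) ^ n + ((n + 1) * (η * μ⁻¹) ^ n) * (μ⁻¹ ^ 2 * V * C₀) := by
      simp only [d]
      ring
    rw [e]
    gcongr
  have hratio : ∀ ξ, ‖-E ξ * (b ξ)⁻¹‖ ≤ 1 / 2 := by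
    intro ξ
    rw [norm_mul, norm_neg, norm_inv]
    calc ‖E ξ‖ * ‖b ξ‖⁻¹ ≤ δ / 3 * (2 * δ / 3)⁻¹ := by
          gcongr
          · exact hE ξ
          · rw [← hμ]; exact hbμ ξ
      _ = 1 / 2 := by field_simp
  have hb0 : ∀ ξ, b ξ ≠ 0 := fun ξ h0 => by
    have := hbμ ξ
    rw [h0, norm_zero, hμ] at this
    linarith
  have hsum_eq : ∀ N ξ, ∑ n ∈ Finset.range N, (-1) ^ n * (E ξ ^ n * ((b ξ)⁻¹) ^ (n + 1)) =
      (b ξ)⁻¹ * ∑ n ∈ Finset.range N, (-E ξ * (b ξ)⁻¹) ^ n := by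
    intro N ξ
    rw [Finset.mul_sum]
    refine Finset.sum_congr rfl fun n _ => ?_
    rw [mul_pow, neg_pow, pow_succ]
    ring
  -- The Neumann series (b + E)⁻¹ = Σ (-E)^n b^{-(n+1)}: its partial sums have multiplier norms at
  -- most the sum of `d`, and they converge pointwise and boundedly.
  refine ⟨∑' n, d n, MulBound.of_tendsto
    (f := fun N ξ => ∑ n ∈ Finset.range N, (-1) ^ n * (E ξ ^ n * ((b ξ)⁻¹) ^ (n + 1)))
    (B := (2 * δ / 3)⁻¹ * 2) (fun N => ?_) (fun N => .of_forall fun ξ => ?_) (.of_forall fun ξ => ?_)⟩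
  · have h1 := MulBound.sum hp.le (Finset.range N) fun n => (hterm n n).const_mul ((-1) ^ n)
    refine h1.mono ?_
    simp only [nnnorm_pow, nnnorm_neg, nnnorm_one, one_pow, one_mul]
    exact hd.sum_le_tsum (Finset.range N) (fun _ _ => zero_le)
  · rw [hsum_eq, norm_mul, norm_inv]
    have h1 : ‖∑ n ∈ Finset.range N, (-E ξ * (b ξ)⁻¹) ^ n‖ ≤ 2 := by
      refine (norm_sum_le _ _).trans ?_
      calc _ ≤ ∑ n ∈ Finset.range N, (1 / 2 : ℝ) ^ n := by
            refine Finset.sum_le_sum fun n _ => ?_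
            rw [norm_pow]
            gcongr
            exact hratio ξ
        _ ≤ 2 := by
            exact (summable_geometric_two.sum_le_tsum _ fun _ _ => by positivity).trans_eq
              tsum_geometric_two
    have h2 := hbμ ξ
    rw [hμ] at h2
    gcongr
  · simp only [hsum_eq]
    have h1 := (hasSum_geometric_of_norm_lt_one
      ((hratio ξ).trans_lt (by norm_num))).tendsto_sum_nat.const_mul ((b ξ)⁻¹)
    convert h1 using 2
    rw [hbE, ← mul_inv]
    congr 1
    have := hb0 ξ
    field_simp
    ring

lemma exists_mulBound_add_fourier {p : ℝ≥0∞} (hp : 1 < p) (hp' : p ≠ ∞) (c : ℂ) {k : ℝ → ℂ}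
    (hk : Integrable k) : ∃ C, MulBound p C (fun ξ => c + 𝓕 k ξ) :=
  ⟨_, (MulBound.const p c).add hp.le (MulBound.fourier hp hp' hk)⟩

section

/-! ### Wave packets and Lebesgue points -/

/-- A smooth bump function as a Schwartz function. -/
def schwartzBump (f : ContDiffBump (0 : ℝ)) : 𝓢(ℝ, ℂ) :=
  HasCompactSupport.toSchwartzMap (f := fun x => (f x : ℂ))
    (f.hasCompactSupport.comp_left Complex.ofReal_zero)
    (Complex.ofRealCLM.contDiff.comp f.contDiff)

lemma schwartzBump_apply (f : ContDiffBump (0 : ℝ)) (x : ℝ) : schwartzBump f x = (f x : ℂ) := rfl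

/-- A smooth bump supported in `[-1, 1]`. -/
def unitBump : ContDiffBump (0 : ℝ) := ⟨1 / 2, 1, by norm_num, by norm_num⟩

/-- `exp(2πixη) φ(εx)` -/
def packet (η : ℝ) {ε : ℝ} (hε : 0 < ε) (φ : 𝓢(ℝ, ℂ)) : 𝓢(ℝ, ℂ) :=
  modulate (-η) (dilation ε hε.ne' φ)

lemma fourier_packet (η : ℝ) {ε : ℝ} (hε : 0 < ε) (φ : 𝓢(ℝ, ℂ)) (ξ : ℝ) :
    𝓕 (packet η hε φ) ξ = (ε⁻¹ : ℝ) * 𝓕 φ ((ξ - η) / ε) := by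
  rw [packet, fourier_modulate, fourier_dilation, abs_of_pos (inv_pos.2 hε), sub_eq_add_neg]

lemma fourierInv_packet (η : ℝ) {ε : ℝ} (hε : 0 < ε) (φ : 𝓢(ℝ, ℂ)) (ξ : ℝ) :
    𝓕⁻ (packet (-η) hε φ) ξ = (ε⁻¹ : ℝ) * 𝓕⁻ φ ((ξ - η) / ε) := by
  rw [← IsBddSymbol.fourier_neg_eq, fourier_packet, ← IsBddSymbol.fourier_neg_eq]
  congr 2
  ring

lemma eLpNorm_packet {p : ℝ≥0∞} (hp : p ≠ ∞) (η : ℝ) {ε : ℝ} (hε : 0 < ε) (φ : 𝓢(ℝ, ℂ)) :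
    eLpNorm (packet η hε φ) p = ENNReal.ofReal ε⁻¹ ^ (1 / p).toReal * eLpNorm φ p := by
  have h := eLpNorm_comp_mul_left hp φ.continuous.aestronglyMeasurable hε.ne'
  rw [abs_of_pos (inv_pos.2 hε)] at h
  rw [← h, packet, eLpNorm_congr_norm_ae (.of_forall (norm_modulate _ _))]
  congr 1
  ext x
  simp

/-- Since 1/p + 1/q = 1, the product of norms scales like ε⁻¹ for every p, exactly as does the
pairing of two matching packets. -/
lemma eLpNorm_packet_mul {p q : ℝ≥0∞} [h : p.HolderConjugate q] (hp : p ≠ ∞) (hq : q ≠ ∞)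
    (η η' : ℝ) {ε : ℝ} (hε : 0 < ε) (φ ψ : 𝓢(ℝ, ℂ)) :
    (eLpNorm (packet η hε φ) p).toReal * (eLpNorm (packet η' hε ψ) q).toReal =
      ε⁻¹ * ((eLpNorm φ p).toReal * (eLpNorm ψ q).toReal) := by
  have h1 : (1 / p).toReal + (1 / q).toReal = 1 := by
    have h0 := ENNReal.HolderConjugate.inv_add_inv_eq_one p q
    have hp0 : p⁻¹ ≠ ∞ := fun h' => by simp [h'] at h0
    have hq0 : q⁻¹ ≠ ∞ := fun h' => by simp [h'] at h0
    rw [one_div, one_div, ← ENNReal.toReal_add hp0 hq0, h0, ENNReal.toReal_one]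
  rw [eLpNorm_packet hp, eLpNorm_packet hq, ENNReal.toReal_mul, ENNReal.toReal_mul,
    ← ENNReal.toReal_rpow, ← ENNReal.toReal_rpow, ENNReal.toReal_ofReal (inv_pos.2 hε).le,
    mul_mul_mul_comm, ← Real.rpow_add (inv_pos.2 hε), h1, Real.rpow_one]

/-- The `L_1` oscillation of `m` at a point. -/
lemma ae_tendsto_oscillation {m : ℝ → ℂ} (hm : LocallyIntegrable m) :
    ∀ᵐ η, Tendsto (fun ε => ε⁻¹ * ∫ ξ in Metric.closedBall η ε, ‖m ξ - m η‖) (𝓝[>] 0) (𝓝 0) := by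
  filter_upwards [(Besicovitch.vitaliFamily (volume : Measure ℝ)).ae_tendsto_average_norm_sub hm]
    with η hη
  -- The factor 2 turns the average over an interval of length 2ε into ε⁻¹ times the integral.
  have h := (hη.comp (Besicovitch.tendsto_filterAt volume η)).const_mul 2
  rw [mul_zero] at h
  refine h.congr' ?_
  filter_upwards [self_mem_nhdsWithin] with ε hε
  have hε' : (0 : ℝ) < ε := hε
  simp only [Function.comp, setAverage_eq, Measure.real, Real.volume_closedBall, smul_eq_mul]
  rw [ENNReal.toReal_ofReal (by linarith)]
  field_simp

lemma integral_mul_bump_le {m : ℝ → ℂ} (hm : LocallyIntegrable m) (η : ℝ) {ε : ℝ} (hε : 0 < ε)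
    {w : ℝ → ℝ} (hw : ∀ x, |w x| ≤ 1) (hw0 : ∀ x, 1 ≤ |x| → w x = 0) :
    ∫ ξ, ‖m ξ - m η‖ * |w ((ξ - η) / ε)| ≤ ∫ ξ in Metric.closedBall η ε, ‖m ξ - m η‖ := by
  rw [← integral_indicator Metric.isClosed_closedBall.measurableSet]
  refine integral_mono_of_nonneg (.of_forall fun ξ => by positivity) ?_ (.of_forall fun ξ => ?_)
  · refine (IntegrableOn.integrable_indicator ?_ Metric.isClosed_closedBall.measurableSet)
    exact ((hm.sub (locallyIntegrable_const _)).integrableOn_isCompact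
      (isCompact_closedBall η ε)).norm
  · by_cases h : ξ ∈ Metric.closedBall η ε
    · simp only [indicator_of_mem h]
      exact mul_le_of_le_one_right (norm_nonneg _) (hw _)
    · simp only [indicator_of_notMem h]
      rw [Metric.mem_closedBall, Real.dist_eq, not_le] at h
      rw [hw0, abs_zero, mul_zero]
      rw [abs_div, abs_of_pos hε, le_div_iff₀ hε]
      linarith

lemma integral_unitBump_sq_pos : 0 < ∫ x, unitBump x ^ 2 := by
  refine Continuous.integral_pos_of_hasCompactSupport_nonneg_nonzero (x := 0)
    (unitBump.continuous.pow 2) ?_ (fun x => sq_nonneg _) ?_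
  · exact unitBump.hasCompactSupport.comp_left (g := fun y : ℝ => y ^ 2) (by simp)
  · have : unitBump (0 : ℝ) = 1 := unitBump.one_of_mem_closedBall (by simp [unitBump])
    rw [this]
    norm_num

lemma unitBump_eq_zero {x : ℝ} (hx : 1 ≤ |x|) : unitBump x = 0 :=
  unitBump.zero_of_le_dist (by simpa [unitBump] using hx)

lemma abs_unitBump_le (x : ℝ) : |unitBump x| ≤ 1 := by
  rw [abs_of_nonneg unitBump.nonneg]
  exact unitBump.le_one

/-! ### Multiplier operators in `L_p(ℝ)` -/

lemma denseRange_toLp {p : ℝ≥0∞} [Fact (1 ≤ p)] (hp : p ≠ ∞) :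
    DenseRange fun φ : 𝓢(ℝ, ℂ) => φ.toLp p (volume : Measure ℝ) :=
  SchwartzMap.denseRange_toLpCLM hp

variable {p q : ℝ≥0∞} [Fact (1 ≤ p)] [Fact (1 ≤ q)]

/-- The operator `T` in `L_p(ℝ)` is the Fourier multiplier with the symbol `m`. -/
structure IsSymbol (T : Lp ℂ p (volume : Measure ℝ) →L[ℂ] Lp ℂ p (volume : Measure ℝ))
    (m : ℝ → ℂ) : Prop where
  integrable : ∀ φ ψ : 𝓢(ℝ, ℂ), Integrable fun ξ => m ξ * 𝓕 φ ξ * ψ ξ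
  integral_eq : ∀ φ ψ : 𝓢(ℝ, ℂ),
    ∫ x, T (φ.toLp p) x * 𝓕 ψ x = ∫ ξ, m ξ * 𝓕 φ ξ * ψ ξ

lemma MulBound.memLp {p : ℝ≥0∞} {C : ℝ≥0} {m : ℝ → ℂ} (h : MulBound p C m) (φ : 𝓢(ℝ, ℂ)) :
    MemLp (mulOp m φ) p := by
  have hφ : MemLp φ p := φ.memLp p volume
  exact ⟨(h.continuous_mulOp φ).aestronglyMeasurable,
    (h.bound φ).trans_lt (ENNReal.mul_lt_top ENNReal.coe_lt_top hφ.2)⟩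

/-- `W⁰_m φ` as an element of `L_p(ℝ)`. -/
def MulBound.toLp {p : ℝ≥0∞} {C : ℝ≥0} {m : ℝ → ℂ} (h : MulBound p C m) (φ : 𝓢(ℝ, ℂ)) :
    Lp ℂ p (volume : Measure ℝ) :=
  (h.memLp φ).toLp (mulOp m φ)

lemma MulBound.coeFn_toLp {p : ℝ≥0∞} {C : ℝ≥0} {m : ℝ → ℂ} (h : MulBound p C m) (φ : 𝓢(ℝ, ℂ)) :
    h.toLp φ =ᵐ[volume] mulOp m φ :=
  (h.memLp φ).coeFn_toLp

lemma MulBound.norm_toLp_le {p : ℝ≥0∞} {C : ℝ≥0} {m : ℝ → ℂ} (h : MulBound p C m) (φ : 𝓢(ℝ, ℂ)) :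
    ‖h.toLp φ‖ ≤ C * ‖φ.toLp p‖ := by
  have hφ : MemLp φ p := φ.memLp p volume
  rw [MulBound.toLp, Lp.norm_toLp, SchwartzMap.toLp, Lp.norm_toLp, ← ENNReal.coe_toReal,
    ← ENNReal.toReal_mul]
  exact ENNReal.toReal_mono (ENNReal.mul_lt_top ENNReal.coe_lt_top hφ.2).ne (h.bound φ)

lemma mulOp_add_right {m : ℝ → ℂ} (h : IsBddSymbol m) (φ ψ : 𝓢(ℝ, ℂ)) :
    mulOp m (φ + ψ) = mulOp m φ + mulOp m ψ := by
  have hi := fun (φ : 𝓢(ℝ, ℂ)) x => (Real.fourierIntegral_convergent_iff (μ := volume) (-x)).2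
    (h.integrable_mul (𝓕 φ).integrable)
  ext x
  simp only [mulOp, Pi.add_apply, Real.fourierInv_eq]
  rw [← integral_add]
  · simp [FourierTransform.fourier_add, mul_add]
  · simpa using hi φ x
  · simpa using hi ψ x

lemma mulOp_smul_right (m : ℝ → ℂ) (c : ℂ) (φ : 𝓢(ℝ, ℂ)) :
    mulOp m (c • φ) = c • mulOp m φ := by
  ext x
  simp only [mulOp, Pi.smul_apply, Real.fourierInv_eq]
  rw [← integral_smul]
  congr 1
  ext ξ
  simp only [FourierTransform.fourier_smul, _root_.smul_apply, Circle.smul_def, smul_eq_mul]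
  ring

/-- `W⁰_m` as a linear map from `𝓢(ℝ)` to `L_p(ℝ)`. -/
def MulBound.toLpₗ {C : ℝ≥0} {m : ℝ → ℂ} (h : MulBound p C m) :
    𝓢(ℝ, ℂ) →ₗ[ℂ] Lp ℂ p (volume : Measure ℝ) where
  toFun := h.toLp
  map_add' φ ψ := by
    rw [toLp, toLp, toLp, ← MemLp.toLp_add]
    exact MemLp.toLp_congr _ _ (.of_eq (mulOp_add_right h.toIsBddSymbol φ ψ))
  map_smul' c φ := by
    rw [toLp, toLp, RingHom.id_apply, ← MemLp.toLp_const_smul]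
    exact MemLp.toLp_congr _ _ (.of_eq (mulOp_smul_right m c φ))

lemma exists_isSymbol (hp : p ≠ ∞) {C : ℝ≥0} {m : ℝ → ℂ} (h : MulBound p C m) :
    ∃ T : Lp ℂ p (volume : Measure ℝ) →L[ℂ] Lp ℂ p (volume : Measure ℝ), IsSymbol T m := by
  have hb : ∃ C : ℝ, ∀ φ, ‖h.toLpₗ φ‖ ≤
      C * ‖(SchwartzMap.toLpCLM ℂ ℂ p (volume : Measure ℝ)).toLinearMap φ‖ :=
    ⟨C, h.norm_toLp_le⟩
  refine ⟨h.toLpₗ.extendOfNorm (SchwartzMap.toLpCLM ℂ ℂ p (volume : Measure ℝ)).toLinearMap,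
    fun φ ψ => ?_, fun φ ψ => ?_⟩
  · exact (h.memLp_mul (p := 2) ((𝓕 φ).memLp 2 volume)).integrable_mul (ψ.memLp 2 volume)
  · have h1 := LinearMap.extendOfNorm_eq (e := (SchwartzMap.toLpCLM ℂ ℂ p
      (volume : Measure ℝ)).toLinearMap) (denseRange_toLp hp) hb φ
    have h2 : (SchwartzMap.toLpCLM ℂ ℂ p (volume : Measure ℝ)).toLinearMap φ = φ.toLp p := rfl
    rw [h2] at h1
    rw [h1, ← h.integral_mulOp_mul_fourier]
    refine integral_congr_ae ?_
    filter_upwards [h.coeFn_toLp φ] with x hx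
    change h.toLp φ x * _ = _
    rw [hx]

namespace IsSymbol

variable {T : Lp ℂ p (volume : Measure ℝ) →L[ℂ] Lp ℂ p (volume : Measure ℝ)} {m : ℝ → ℂ}

/-- `IsSymbol` asks for no regularity of `m`; choosing both test functions so that their product
with `m` is `m` itself near a point yields measurability and local integrability. -/
lemma locallyIntegrable (h : IsSymbol T m) : LocallyIntegrable m := by
  intro x
  let f : ContDiffBump (0 : ℝ) := ⟨|x| + 1, |x| + 2, by positivity, by linarith⟩
  have h1 := h.integrable (𝓕⁻ (schwartzBump f)) (schwartzBump f)
  rw [FourierTransform.fourier_fourierInv_eq] at h1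
  refine ⟨Metric.ball 0 (|x| + 1), Metric.isOpen_ball.mem_nhds (by simp), ?_⟩
  refine h1.integrableOn.congr_fun (fun ξ hξ => ?_) Metric.isOpen_ball.measurableSet
  have : f ξ = 1 := f.one_of_mem_closedBall (Metric.ball_subset_closedBall hξ)
  simp [schwartzBump_apply, this]

lemma norm_integral_le [p.HolderConjugate q] (h : IsSymbol T m) (φ ψ : 𝓢(ℝ, ℂ)) :
    ‖∫ ξ, m ξ * 𝓕 φ ξ * 𝓕⁻ ψ ξ‖ ≤ ‖T‖ * ((eLpNorm φ p).toReal * (eLpNorm ψ q).toReal) := by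
  rw [← h.integral_eq, FourierTransform.fourier_fourierInv_eq]
  refine (norm_integral_mul_le (Lp.memLp _) (ψ.memLp q)).trans ?_
  rw [← Lp.norm_def, ← mul_assoc]
  refine mul_le_mul_of_nonneg_right ((T.le_opNorm _).trans_eq ?_) ENNReal.toReal_nonneg
  rw [SchwartzMap.toLp, Lp.norm_toLp]

/-- Packets at frequency η and width ε are paired through `T`. The pairing is ε⁻² ∫ m(ξ) θ((ξ-η)/ε)²
dξ with the bump θ, close to ε⁻¹ κ m(η) at a Lebesgue point, while the operator norm bounds it by A
ε⁻¹. Letting ε → 0 gives |m(η)| ≤ A/κ. -/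
lemma ae_norm_le (h : IsSymbol T m) (hp : 1 < p) (hp' : p ≠ ∞) : ∃ B : ℝ, ∀ᵐ ξ, ‖m ξ‖ ≤ B := by
  obtain ⟨q, hq, hq', hpq, -⟩ := exists_holderConjugate hp hp'
  have : Fact (1 ≤ q) := ⟨hq.le⟩
  set κ := ∫ x, unitBump x ^ 2
  have hκ : 0 < κ := integral_unitBump_sq_pos
  set Θ := schwartzBump unitBump
  set A := ‖T‖ * ((eLpNorm (𝓕⁻ Θ : 𝓢(ℝ, ℂ)) p).toReal * (eLpNorm (𝓕 Θ : 𝓢(ℝ, ℂ)) q).toReal)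
  refine ⟨A / κ, ?_⟩
  filter_upwards [ae_tendsto_oscillation h.locallyIntegrable] with η hη
  rw [le_div_iff₀ hκ]
  refine ge_of_tendsto (a := A + 0) (hη.const_add A) ?_ |>.trans_eq (add_zero A)
  filter_upwards [self_mem_nhdsWithin] with ε hε
  have hε' : (0 : ℝ) < ε := hε
  have h1 := h.norm_integral_le (q := q) (packet η hε' (𝓕⁻ Θ)) (packet (-η) hε' (𝓕 Θ))
  have hi := h.integrable (packet η hε' (𝓕⁻ Θ)) (𝓕⁻ (packet (-η) hε' (𝓕 Θ)))
  simp only [fourierInv_packet, fourier_packet, FourierTransform.fourier_fourierInv_eq,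
    FourierTransform.fourierInv_fourier_eq] at h1 hi
  rw [eLpNorm_packet_mul hp' hq'] at h1
  have e : ∀ ξ, m ξ * ((ε⁻¹ : ℝ) * Θ ((ξ - η) / ε)) * ((ε⁻¹ : ℝ) * Θ ((ξ - η) / ε)) =
      (ε⁻¹ : ℝ) ^ 2 * (m ξ * ((unitBump ((ξ - η) / ε) ^ 2 : ℝ) : ℂ)) := by
    intro ξ
    rw [show Θ ((ξ - η) / ε) = (unitBump ((ξ - η) / ε) : ℂ) from rfl]
    push_cast
    ring
  simp only [e] at h1 hi
  have hε2 : ((ε⁻¹ : ℝ) : ℂ) ^ 2 ≠ 0 := by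
    simp [hε'.ne']
  rw [integrable_const_mul_iff (Ne.isUnit hε2)] at hi
  rw [integral_const_mul, norm_mul, norm_pow, Complex.norm_real, Real.norm_of_nonneg
    (inv_pos.2 hε').le] at h1
  have h2 : ‖∫ ξ, m ξ * ((unitBump ((ξ - η) / ε) ^ 2 : ℝ) : ℂ)‖ ≤ A * ε := by
    have : ε⁻¹ ^ 2 * ‖∫ ξ, m ξ * ((unitBump ((ξ - η) / ε) ^ 2 : ℝ) : ℂ)‖ ≤ ε⁻¹ ^ 2 * (A * ε) := by
      refine h1.trans_eq ?_
      simp only [A]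
      field_simp
    exact le_of_mul_le_mul_left this (by positivity)
  have hw : ∫ ξ, unitBump ((ξ - η) / ε) ^ 2 = ε * κ := by
    rw [integral_sub_right_eq_self (fun ξ => unitBump (ξ / ε) ^ 2) η,
      Measure.integral_comp_div (fun ξ => unitBump ξ ^ 2) ε, abs_of_pos hε', smul_eq_mul]
  have hwi' : Integrable fun ξ => unitBump ((ξ - η) / ε) ^ 2 := by
    -- A non-integrable function has integral 0 by convention, which contradicts the positive value
    -- in `hw`.
    refine not_not.1 fun hn => ?_
    rw [integral_undef hn] at hw
    exact (mul_pos hε' hκ).ne hw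
  have hwi : Integrable fun ξ => ((unitBump ((ξ - η) / ε) ^ 2 : ℝ) : ℂ) := hwi'.ofReal
  have h3 : ‖∫ ξ, (m ξ - m η) * ((unitBump ((ξ - η) / ε) ^ 2 : ℝ) : ℂ)‖ ≤
      ∫ ξ in Metric.closedBall η ε, ‖m ξ - m η‖ := by
    refine (norm_integral_le_integral_norm _).trans ?_
    simp only [norm_mul, Complex.norm_real, Real.norm_eq_abs]
    refine integral_mul_bump_le h.locallyIntegrable η hε' (w := fun x => unitBump x ^ 2)
      (fun x => ?_) fun x hx => by rw [unitBump_eq_zero hx]; norm_num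
    rw [abs_pow]
    exact pow_le_one₀ (abs_nonneg _) (abs_unitBump_le x)
  simp only [sub_mul] at h3
  rw [integral_sub hi (hwi.const_mul _), integral_const_mul, integral_complex_ofReal, hw] at h3
  have h4 : ‖m η‖ * (ε * κ) ≤ A * ε + ∫ ξ in Metric.closedBall η ε, ‖m ξ - m η‖ := by
    have := norm_sub_norm_le (m η * ((ε * κ : ℝ) : ℂ))
      (∫ ξ, m ξ * ((unitBump ((ξ - η) / ε) ^ 2 : ℝ) : ℂ))
    rw [norm_sub_rev, norm_mul, Complex.norm_real, Real.norm_of_nonneg (by positivity)] at this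
    linarith
  calc ‖m η‖ * κ = ε⁻¹ * (‖m η‖ * (ε * κ)) := by field_simp
    _ ≤ ε⁻¹ * (A * ε + ∫ ξ in Metric.closedBall η ε, ‖m ξ - m η‖) := by gcongr
    _ = _ := by field_simp

lemma isBddSymbol (h : IsSymbol T m) (hp : 1 < p) (hp' : p ≠ ∞) : IsBddSymbol m :=
  ⟨h.locallyIntegrable.aestronglyMeasurable, h.ae_norm_le hp hp'⟩

lemma toLp_ae_eq (h : IsSymbol T m) (hp : 1 < p) (hp' : p ≠ ∞) (φ : 𝓢(ℝ, ℂ)) :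
    T (φ.toLp p) =ᵐ[volume] mulOp m φ := by
  have hm := h.isBddSymbol hp hp'
  refine ae_eq_of_forall_integral_mul_schwartz ((Lp.memLp _).locallyIntegrable hp.le)
    (hm.continuous_mulOp φ).locallyIntegrable fun ψ => ?_
  rw [hm.integral_mulOp_mul, ← h.integral_eq, FourierTransform.fourier_fourierInv_eq]

lemma mulBound (h : IsSymbol T m) (hp : 1 < p) (hp' : p ≠ ∞) : MulBound p ‖T‖₊ m := by
  refine ⟨h.isBddSymbol hp hp', fun φ => ?_⟩
  rw [← eLpNorm_congr_ae (h.toLp_ae_eq hp hp' φ), ← Lp.enorm_def]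
  have h1 : eLpNorm φ p = ‖φ.toLp p‖ₑ := by
    rw [SchwartzMap.toLp, Lp.enorm_toLp]
  rw [h1]
  exact T.le_opENorm _

/-- The transpose of `T` on Schwartz functions. -/
lemma pairing_eq [p.HolderConjugate q] (h : IsSymbol T m) (hp : 1 < p) (hp' : p ≠ ∞)
    {C : ℝ≥0} (hm : MulBound q C (fun ξ => m (-ξ))) (f : Lp ℂ p (volume : Measure ℝ))
    (ψ : 𝓢(ℝ, ℂ)) :
    pairing p q (T f) (ψ.toLp q) = pairing p q f (hm.toLp ψ) := by
  set A := ((pairing p q).flip (ψ.toLp q)) ∘L T with hA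
  set B := (pairing p q).flip (hm.toLp ψ) with hB
  have key : ∀ φ : 𝓢(ℝ, ℂ), A (φ.toLp p) = B (φ.toLp p) := by
    intro φ
    simp only [hA, hB, ContinuousLinearMap.comp_apply, ContinuousLinearMap.flip_apply]
    have h1 : pairing p q (φ.toLp p) (hm.toLp ψ) = ∫ x, φ x * mulOp _ ψ x :=
      pairing_toLp (φ.memLp p volume) (hm.memLp ψ)
    rw [h1, ← (h.isBddSymbol hp hp').integral_mulOp_mul_eq, pairing_apply]
    refine integral_congr_ae ?_
    filter_upwards [h.toLp_ae_eq hp hp' φ, ψ.coeFn_toLp q (volume : Measure ℝ)] with x h1 h2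
    rw [h1, h2]
  exact congrFun ((denseRange_toLp hp').equalizer A.continuous B.continuous (funext key)) f

/-- The function T'φ is only in L_p, so T(T'φ) is tested against ψ by moving `T` to ψ as a
transpose; Parseval then shows the product of the symbols. This is why a bound in the conjugate
space is required. -/
lemma comp_eq_id [p.HolderConjugate q] (h : IsSymbol T m) (hp : 1 < p) (hp' : p ≠ ∞)
    {C : ℝ≥0} (hm : MulBound q C (fun ξ => m (-ξ)))
    {T' : Lp ℂ p (volume : Measure ℝ) →L[ℂ] Lp ℂ p (volume : Measure ℝ)} {m' : ℝ → ℂ}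
    (h' : IsSymbol T' m') (hmm : ∀ᵐ ξ, m ξ * m' ξ = 1) : T ∘L T' = ContinuousLinearMap.id ℂ _ := by
  refine DFunLike.coe_injective ((denseRange_toLp hp').equalizer (T ∘L T').continuous continuous_id (funext fun φ => ?_))
  change T (T' (φ.toLp p)) = φ.toLp p
  refine Lp.ext ((ae_eq_of_forall_integral_mul_schwartz ((Lp.memLp _).locallyIntegrable hp.le)
    ((Lp.memLp _).locallyIntegrable hp.le)) fun ψ => ?_)
  have h1 := h.pairing_eq hp hp' hm (T' (φ.toLp p)) ψ
  rw [pairing_apply, pairing_apply] at h1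
  have e1 : ∫ x, T (T' (φ.toLp p)) x * ψ x = ∫ x, T (T' (φ.toLp p)) x * ψ.toLp q volume x := by
    refine integral_congr_ae ?_
    filter_upwards [ψ.coeFn_toLp q (volume : Measure ℝ)] with x hx
    rw [hx]
  have e2 : ∫ x, T' (φ.toLp p) x * hm.toLp ψ x = ∫ x, mulOp m' φ x * mulOp (fun ξ => m (-ξ)) ψ x := by
    refine integral_congr_ae ?_
    filter_upwards [h'.toLp_ae_eq hp hp' φ, hm.coeFn_toLp ψ] with x h1 h2
    rw [h1, h2]
  have e3 : ∫ x, φ.toLp p volume x * ψ x = ∫ x, φ x * ψ x := by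
    refine integral_congr_ae ?_
    filter_upwards [φ.coeFn_toLp p (volume : Measure ℝ)] with x hx
    rw [hx]
  have e4 : ∫ x, φ x * ψ x = ∫ ξ, 𝓕 φ ξ * 𝓕⁻ ψ ξ := by
    have := (IsBddSymbol.const 1).integral_mulOp_mul φ ψ
    simpa [mulOp_const] using this
  rw [e1, h1, e2, (h'.isBddSymbol hp hp').integral_mulOp_mul_mulOp hm.toIsBddSymbol, e3, e4]
  refine integral_congr_ae ?_
  filter_upwards [hmm] with ξ hξ
  rw [neg_neg]
  linear_combination (𝓕 φ ξ * 𝓕⁻ ψ ξ) * hξ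

end IsSymbol

end

section

/-! ### Finite rank operators and translations -/

/-- At each point at most one summand survives, so p-th powers of norms add and the sum grows like
N^{1/p} instead of N. -/
lemma eLpNorm_sum_le_of_disjoint {p : ℝ≥0∞} (hp : 1 ≤ p) (hp' : p ≠ ∞) {N : ℕ} {f : ℕ → ℝ → ℂ}
    (hf : ∀ i, AEStronglyMeasurable (f i)) (hd : ∀ x i j, f i x ≠ 0 → f j x ≠ 0 → i = j)
    {D : ℝ≥0∞} (hD : ∀ i, eLpNorm (f i) p ≤ D) :
    eLpNorm (fun x => ∑ i ∈ Finset.range N, f i x) p ≤ (N : ℝ≥0∞) ^ (1 / p.toReal) * D := by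
  have hp0 : p ≠ 0 := (zero_lt_one.trans_le hp).ne'
  have hr : 0 < p.toReal := ENNReal.toReal_pos hp0 hp'
  rw [eLpNorm_eq_lintegral_rpow_enorm_toReal hp0 hp']
  have h1 : ∀ x, ‖∑ i ∈ Finset.range N, f i x‖ₑ ^ p.toReal ≤
      ∑ i ∈ Finset.range N, ‖f i x‖ₑ ^ p.toReal := by
    intro x
    by_cases h : ∃ j ∈ Finset.range N, f j x ≠ 0
    · obtain ⟨j, hj, hjx⟩ := h
      rw [Finset.sum_eq_single_of_mem j hj fun i _ hij => not_not.1 fun hi => hij (hd x i j hi hjx)]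
      exact Finset.single_le_sum (f := fun i => ‖f i x‖ₑ ^ p.toReal) (fun _ _ => zero_le) hj
    · push Not at h
      rw [Finset.sum_eq_zero h, enorm_zero, ENNReal.zero_rpow_of_pos hr]
      exact zero_le
  have h2 : ∫⁻ x, ‖∑ i ∈ Finset.range N, f i x‖ₑ ^ p.toReal ≤ N * D ^ p.toReal := by
    refine (lintegral_mono h1).trans ?_
    rw [lintegral_finsetSum' _ fun i _ => ((hf i).enorm.pow_const _)]
    refine (Finset.sum_le_card_nsmul _ _ (D ^ p.toReal) fun i _ => ?_).trans_eq (by simp)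
    have h3 := ENNReal.rpow_le_rpow (hD i) hr.le
    rwa [eLpNorm_eq_lintegral_rpow_enorm_toReal hp0 hp', ← ENNReal.rpow_mul,
      one_div_mul_cancel hr.ne', ENNReal.rpow_one] at h3
  calc _ ≤ (N * D ^ p.toReal) ^ (1 / p.toReal) := by gcongr
    _ = _ := by
      rw [ENNReal.mul_rpow_of_nonneg _ _ (by positivity), ← ENNReal.rpow_mul,
        mul_one_div_cancel hr.ne', ENNReal.rpow_one]

variable {p q : ℝ≥0∞} [Fact (1 ≤ p)] [Fact (1 ≤ q)]

/-- The translation operator `f ↦ f(· - t)`. -/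
def translate (p : ℝ≥0∞) [Fact (1 ≤ p)] (t : ℝ) :
    Lp ℂ p (volume : Measure ℝ) →ₗᵢ[ℂ] Lp ℂ p (volume : Measure ℝ) :=
  Lp.compMeasurePreservingₗᵢ ℂ (fun x => x - t) (measurePreserving_sub_right volume t)

lemma coeFn_translate (t : ℝ) (f : Lp ℂ p (volume : Measure ℝ)) :
    translate p t f =ᵐ[volume] fun x => f (x - t) :=
  Lp.coeFn_compMeasurePreserving f (measurePreserving_sub_right volume t)

lemma translate_toLp (t : ℝ) (φ : 𝓢(ℝ, ℂ)) :
    translate p t (φ.toLp p) = (SchwartzMap.compSubConstCLM ℂ t φ).toLp p := by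
  refine Lp.ext ?_
  have h := (measurePreserving_sub_right (volume : Measure ℝ) t).quasiMeasurePreserving.ae_eq_comp
    (φ.coeFn_toLp p (volume : Measure ℝ))
  filter_upwards [coeFn_translate t (φ.toLp p), h,
    (SchwartzMap.compSubConstCLM ℂ t φ).coeFn_toLp p (volume : Measure ℝ)] with x h1 h2 h3
  rw [h1, h3]
  exact h2

lemma norm_sum_translate_le (hp : p ≠ ∞) {g : ℝ → ℂ} (hg : MemLp g p) {R : ℝ}
    (hR : ∀ x, R ≤ |x| → g x = 0) {t : ℕ → ℝ} (ht : ∀ i j, i ≠ j → 2 * R ≤ |t i - t j|) (N : ℕ) :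
    ‖∑ i ∈ Finset.range N, translate p (t i) (hg.toLp g)‖ ≤
      (N : ℝ) ^ (1 / p.toReal) * ‖hg.toLp g‖ := by
  have hc : ∀ i, translate p (t i) (hg.toLp g) =ᵐ[volume] fun x => g (x - t i) := fun i => by
    have h := (measurePreserving_sub_right (volume : Measure ℝ)
      (t i)).quasiMeasurePreserving.ae_eq_comp hg.coeFn_toLp
    filter_upwards [coeFn_translate (t i) (hg.toLp g), h] with x h1 h2
    rw [h1]
    exact h2
  have hm : ∀ i, MemLp (fun x => g (x - t i)) p := fun i =>
    hg.comp_measurePreserving (measurePreserving_sub_right volume (t i))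
  have e : (∑ i ∈ Finset.range N, translate p (t i) (hg.toLp g) : Lp ℂ p (volume : Measure ℝ))
      =ᵐ[volume] fun x => ∑ i ∈ Finset.range N, g (x - t i) := by
    filter_upwards [Lp.coeFn_finsetSum (Finset.range N) fun i => translate p (t i) (hg.toLp g),
      ae_all_iff.2 hc] with x h1 h2
    rw [h1, Finset.sum_apply]
    exact Finset.sum_congr rfl fun i _ => h2 i
  rw [Lp.norm_def, eLpNorm_congr_ae e]
  have hd : ∀ x i j, g (x - t i) ≠ 0 → g (x - t j) ≠ 0 → i = j := by
    intro x i j hi hj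
    by_contra hij
    have h1 : |x - t i| < R := not_le.1 fun h => hi (hR _ h)
    have h2 : |x - t j| < R := not_le.1 fun h => hj (hR _ h)
    have h3 := ht i j hij
    have h4 : |t i - t j| ≤ |x - t j| + |x - t i| := by
      rw [show t i - t j = (x - t j) - (x - t i) by ring]
      exact abs_sub _ _
    linarith
  have hD : ∀ i, eLpNorm (fun x => g (x - t i)) p ≤ eLpNorm g p := fun i =>
    (eLpNorm_comp_measurePreserving hg.1 (measurePreserving_sub_right volume (t i))).le
  have h := eLpNorm_sum_le_of_disjoint (N := N) (Fact.out : 1 ≤ p) hp (fun i => (hm i).1) hd hD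
  have hfin : (N : ℝ≥0∞) ^ (1 / p.toReal) * eLpNorm g p ≠ ∞ := ENNReal.mul_ne_top
    (ENNReal.rpow_lt_top_of_nonneg (by positivity) (ENNReal.natCast_ne_top N)).ne hg.2.ne
  have h2 := ENNReal.toReal_mono hfin h
  rwa [ENNReal.toReal_mul, ← ENNReal.toReal_rpow, ENNReal.toReal_natCast, ← Lp.norm_toLp g hg] at h2

/-- An operator of finite rank is small on suitable translates of a given function. -/
lemma exists_norm_translate_le_of_support (hp : 1 < p) (hp' : p ≠ ∞)
    (K : Lp ℂ p (volume : Measure ℝ) →L[ℂ] Lp ℂ p (volume : Measure ℝ))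
    (hK : FiniteDimensional ℂ (LinearMap.range K.toLinearMap)) {g : ℝ → ℂ} (hg : MemLp g p) {R : ℝ}
    (hR0 : 0 < R) (hR : ∀ x, R ≤ |x| → g x = 0) {ε : ℝ} (hε : 0 < ε) :
    ∃ t, ‖K (translate p t (hg.toLp g))‖ ≤ ε := by
  have hr : 1 < p.toReal := by
    rw [← ENNReal.toReal_one]; exact ENNReal.toReal_strict_mono hp' hp
  set F := hg.toLp g
  let V := LinearMap.range K.toLinearMap
  have : ProperSpace V := FiniteDimensional.proper ℂ V
  -- Translates by multiples of 2R of a function vanishing outside (-R, R) have disjoint supports;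
  -- their images form a bounded sequence in a finite-dimensional space, so a subsequence converges.
  let u : ℕ → V := fun n => ⟨K (translate p (2 * R * n) F), _, rfl⟩
  have hu : ∀ n, u n ∈ Metric.closedBall (0 : V) (‖K‖ * ‖F‖) := by
    intro n
    rw [mem_closedBall_zero_iff]
    change ‖K (translate p (2 * R * n) F)‖ ≤ _
    refine (K.le_opNorm _).trans_eq ?_
    rw [LinearIsometry.norm_map]
  obtain ⟨v, -, φ, hφ, hv⟩ := tendsto_subseq_of_bounded Metric.isBounded_closedBall hu
  have hv' : Tendsto (fun n => K (translate p (2 * R * φ n) F)) atTop (𝓝 (v : Lp ℂ p volume)) :=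
    (continuous_subtype_val.tendsto v).comp hv
  have hces := hv'.cesaro_smul
  -- By disjointness the Cesàro means are O(n^{1/p - 1}), which tends to 0 because p > 1. They also
  -- converge to the limit of the subsequence, so that limit is 0.
  have hzero : Tendsto (fun n : ℕ => (n⁻¹ : ℝ) •
      ∑ i ∈ Finset.range n, K (translate p (2 * R * φ i) F)) atTop (𝓝 0) := by
    have hlim : Tendsto (fun n : ℕ => ‖K‖ * ‖F‖ * (n : ℝ) ^ (-(1 - 1 / p.toReal))) atTop (𝓝 0) := by
      rw [← mul_zero (‖K‖ * ‖F‖)]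
      refine ((tendsto_rpow_neg_atTop ?_).comp tendsto_natCast_atTop_atTop).const_mul _
      rw [sub_pos, div_lt_one (by linarith)]
      exact hr
    refine squeeze_zero_norm' ?_ hlim
    filter_upwards [eventually_gt_atTop 0] with n hn
    have hn' : (0 : ℝ) < n := by exact_mod_cast hn
    rw [← map_sum, norm_smul, norm_inv, Real.norm_natCast]
    have h1 := norm_sum_translate_le hp' hg hR (t := fun i => 2 * R * φ i) (fun i j hij => by
      rw [← mul_sub, abs_mul, abs_of_pos (by positivity : 0 < 2 * R)]
      refine le_mul_of_one_le_right (by positivity) ?_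
      have : (φ i : ℤ) ≠ φ j := by exact_mod_cast hφ.injective.ne hij
      have h2 : (1 : ℤ) ≤ |(φ i : ℤ) - φ j| := Int.one_le_abs (sub_ne_zero.2 this)
      exact_mod_cast h2) n
    calc _ ≤ (n : ℝ)⁻¹ * (‖K‖ * ((n : ℝ) ^ (1 / p.toReal) * ‖F‖)) := by
          gcongr
          exact (K.le_opNorm _).trans (by gcongr)
      _ = ‖K‖ * ‖F‖ * ((n : ℝ) ^ (1 / p.toReal) * (n : ℝ)⁻¹) := by ring
      _ = _ := by
          rw [← Real.rpow_neg_one, ← Real.rpow_add hn']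
          congr 2
          ring
  have hv0 := tendsto_nhds_unique hces hzero
  rw [hv0] at hv'
  obtain ⟨n, hn⟩ := (hv'.norm.eventually (gt_mem_nhds (by simpa using hε))).exists
  exact ⟨_, hn.le⟩

/-- Approximation by compactly supported functions; translations are isometries, so the error passes
through K uniformly in t. -/
lemma exists_norm_translate_le (hp : 1 < p) (hp' : p ≠ ∞)
    (K : Lp ℂ p (volume : Measure ℝ) →L[ℂ] Lp ℂ p (volume : Measure ℝ))
    (hK : FiniteDimensional ℂ (LinearMap.range K.toLinearMap)) (f : Lp ℂ p (volume : Measure ℝ))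
    {ε : ℝ} (hε : 0 < ε) : ∃ t, ‖K (translate p t f)‖ ≤ ε := by
  have hδ : 0 < ε / 2 / (‖K‖ + 1) := by positivity
  obtain ⟨g, hgs, hfg, -, hg⟩ := (Lp.memLp f).exists_hasCompactSupport_eLpNorm_sub_le hp'
    (ENNReal.ofReal_pos.2 hδ).ne'
  obtain ⟨R, hR⟩ := hgs.isCompact.isBounded.subset_closedBall 0
  obtain ⟨t, ht⟩ := exists_norm_translate_le_of_support hp hp' K hK hg (R := |R| + 1)
    (by positivity) (fun x hx => by
      refine image_eq_zero_of_notMem_tsupport fun h => ?_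
      have h1 := hR h
      rw [mem_closedBall_zero_iff, Real.norm_eq_abs] at h1
      linarith [le_abs_self R]) (half_pos hε)
  refine ⟨t, ?_⟩
  have h1 : ‖f - hg.toLp g‖ ≤ ε / 2 / (‖K‖ + 1) := by
    rw [Lp.norm_def]
    refine ENNReal.toReal_le_of_le_ofReal hδ.le (le_trans (le_of_eq ?_) hfg)
    refine eLpNorm_congr_ae ?_
    filter_upwards [Lp.coeFn_sub f (hg.toLp g), hg.coeFn_toLp] with x h1 h2
    rw [h1, Pi.sub_apply, Pi.sub_apply, h2]
  have e : K (translate p t f) = K (translate p t (hg.toLp g)) + K (translate p t (f - hg.toLp g)) := by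
    rw [← map_add, ← map_add, add_sub_cancel]
  rw [e]
  have h2 : ‖K (translate p t (f - hg.toLp g))‖ ≤ ε / 2 := by
    refine (K.le_opNorm _).trans ?_
    rw [LinearIsometry.norm_map]
    calc ‖K‖ * ‖f - hg.toLp g‖ ≤ (‖K‖ + 1) * (ε / 2 / (‖K‖ + 1)) := by gcongr; linarith
      _ = ε / 2 := by field_simp
  exact (norm_add_le _ _).trans (by linarith)

/-! ### Multipliers act on wave packets almost like constants -/

lemma norm_fourier_compSubConst (t : ℝ) (φ : 𝓢(ℝ, ℂ)) (ξ : ℝ) :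
    ‖𝓕 (SchwartzMap.compSubConstCLM ℂ t φ) ξ‖ = ‖𝓕 φ ξ‖ := by
  have h : 𝓕 (SchwartzMap.compSubConstCLM ℂ t φ) ξ = 𝓕⁻ (fun x => φ (x - t)) (-ξ) := by
    rw [Real.fourierInv_eq_fourier_neg, neg_neg]
    rfl
  have h' : 𝓕 φ ξ = 𝓕⁻ (φ : ℝ → ℂ) (-ξ) := by
    rw [Real.fourierInv_eq_fourier_neg, neg_neg]
    rfl
  rw [h, h', fourierInv_comp_sub, Circle.norm_smul]

/-- A small L_1 norm of `F` bounds the transform in L^∞, and together with a sup bound it controls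
the L² norm through Plancherel; the L_q norm lies between. The total power δ^{1-1/q} is what makes
packets almost eigenfunctions. -/
lemma eLpNorm_fourierInv_le {q : ℝ≥0∞} (hq : 2 ≤ q) (hq' : q ≠ ∞) {F : ℝ → ℂ} (hF : Integrable F)
    {δ S : ℝ} (hδ : ∫ ξ, ‖F ξ‖ ≤ δ) (hS : ∀ᵐ ξ, ‖F ξ‖ ≤ S) :
    eLpNorm (𝓕⁻ F) q ≤ ENNReal.ofReal δ ^ (1 - 2 / q.toReal) *
      (ENNReal.ofReal S * ENNReal.ofReal δ) ^ (1 / q.toReal) := by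
  have hq2 : 2 ≤ q.toReal := by
    simpa using (ENNReal.toReal_le_toReal (by norm_num) hq').2 hq
  have h1 : ∫⁻ ξ, ‖F ξ‖ₑ ≤ ENNReal.ofReal δ := by
    rw [← ofReal_integral_norm_eq_lintegral_enorm hF]
    exact ENNReal.ofReal_le_ofReal hδ
  have h2 : ∫⁻ ξ, ‖F ξ‖ₑ ^ (2 : ℝ) ≤ ENNReal.ofReal S * ENNReal.ofReal δ := by
    refine le_trans ?_ (mul_le_mul_right h1 _)
    rw [← lintegral_const_mul'' _ hF.1.enorm]
    refine lintegral_mono_ae ?_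
    filter_upwards [hS] with ξ hξ
    rw [ENNReal.rpow_two, sq, ← ofReal_norm]
    gcongr
  have hF2 : eLpNorm F 2 ^ (2 / q.toReal) ≤
      (ENNReal.ofReal S * ENNReal.ofReal δ) ^ (1 / q.toReal) := by
    rw [eLpNorm_eq_lintegral_rpow_enorm_toReal (by norm_num) (by norm_num), ENNReal.toReal_ofNat,
      ← ENNReal.rpow_mul, show 1 / 2 * (2 / q.toReal) = 1 / q.toReal by ring]
    exact ENNReal.rpow_le_rpow h2 (by positivity)
  have hFm : MemLp F 2 := by
    refine ⟨hF.1, ?_⟩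
    rw [eLpNorm_eq_lintegral_rpow_enorm_toReal (by norm_num) (by norm_num), ENNReal.toReal_ofNat]
    exact ENNReal.rpow_lt_top_of_nonneg (by norm_num)
      (h2.trans_lt (ENNReal.mul_lt_top ENNReal.ofReal_lt_top ENNReal.ofReal_lt_top)).ne
  refine (eLpNorm_le_of_two_of_bound (D := δ.toNNReal) hq hq' fun x => ?_).trans ?_
  · rw [← ofReal_norm]
    exact ENNReal.ofReal_le_ofReal ((norm_fourierInv_le F x).trans hδ)
  · rw [eLpNorm_fourierInv_two hF hFm]
    exact mul_le_mul_right hF2 _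

/-- On the packet's frequency window m - m(η) has small mean at a Lebesgue point. The product with
the packet's transform has L_1 norm at most some δ → 0 and supremum at most 2B/ε, so the output is
at most ε^{-1/q} (2B)^{1/q} δ^{1-1/q}, small compared with the packet norm, of order ε^{-1/q}.
Translation changes the transform by a unimodular factor only, so ε can be fixed before t. -/
lemma ae_exists_packet {q : ℝ≥0∞} (hq : 2 ≤ q) (hq' : q ≠ ∞) {m : ℝ → ℂ} (hm : IsBddSymbol m)
    {φ : 𝓢(ℝ, ℂ)} (hφ : ∀ x, ‖𝓕 φ x‖ ≤ 1) (hφ0 : ∀ x, 1 ≤ |x| → 𝓕 φ x = 0) :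
    ∀ᵐ η, ∀ κ : ℝ, 0 < κ → ∃ (ε : ℝ) (hε : 0 < ε), ∀ t,
      eLpNorm (mulOp (fun ξ => m ξ + -m η) (SchwartzMap.compSubConstCLM ℂ t (packet η hε φ))) q ≤
        ENNReal.ofReal ε⁻¹ ^ (1 / q.toReal) * ENNReal.ofReal κ := by
  have hq2 : 2 ≤ q.toReal := by
    simpa using (ENNReal.toReal_le_toReal (by norm_num) hq').2 hq
  obtain ⟨B, hB⟩ := hm.bdd
  have hloc : LocallyIntegrable m := fun x =>
    ⟨Metric.ball x 1, Metric.ball_mem_nhds x one_pos, by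
      refine Measure.integrableOn_of_bounded (M := B) measure_ball_lt_top.ne hm.meas
        (ae_restrict_of_ae hB)⟩
  filter_upwards [ae_tendsto_oscillation hloc, hB] with η hη hBη κ hκ
  have hc : Tendsto (fun δ : ℝ => ENNReal.ofReal (2 * B) ^ (1 / q.toReal) *
      ENNReal.ofReal δ ^ (1 - 1 / q.toReal)) (𝓝 0) (𝓝 0) := by
    have hpos : 0 < 1 - 1 / q.toReal := by
      rw [sub_pos, div_lt_one (by linarith)]
      linarith
    have h1 : Tendsto (fun δ : ℝ => ENNReal.ofReal δ ^ (1 - 1 / q.toReal)) (𝓝 0) (𝓝 0) := by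
      have h2 : Tendsto (fun δ : ℝ => ENNReal.ofReal δ) (𝓝 0) (𝓝 0) := by
        simpa using (ENNReal.continuous_ofReal.tendsto 0)
      have h3 := (ENNReal.continuous_rpow_const (y := 1 - 1 / q.toReal)).tendsto 0
      rw [ENNReal.zero_rpow_of_pos hpos] at h3
      exact h3.comp h2
    have h4 := ENNReal.Tendsto.const_mul (a := ENNReal.ofReal (2 * B) ^ (1 / q.toReal)) h1
      (Or.inr (ENNReal.rpow_lt_top_of_nonneg (by positivity) ENNReal.ofReal_ne_top).ne)
    rwa [mul_zero] at h4
  obtain ⟨ε, hδκ, hε⟩ := (((hc.comp hη).eventually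
    (gt_mem_nhds (ENNReal.ofReal_pos.2 hκ))).and self_mem_nhdsWithin).exists
  have hε' : (0 : ℝ) < ε := hε
  refine ⟨ε, hε', fun t => ?_⟩
  set δ := ε⁻¹ * ∫ ξ in Metric.closedBall η ε, ‖m ξ - m η‖ with hδ
  set h := SchwartzMap.compSubConstCLM ℂ t (packet η hε' φ)
  have hF : ∀ ξ, ‖(m ξ + -m η) * 𝓕 h ξ‖ = ε⁻¹ * (‖m ξ - m η‖ * |‖𝓕 φ ((ξ - η) / ε)‖|) := by
    intro ξ
    rw [norm_mul, norm_fourier_compSubConst, fourier_packet, norm_mul, Complex.norm_real,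
      Real.norm_of_nonneg (inv_pos.2 hε').le, abs_norm, ← sub_eq_add_neg]
    ring
  have hi : Integrable fun ξ => (m ξ + -m η) * 𝓕 h ξ :=
    (hm.add (.const _)).integrable_mul (𝓕 h).integrable
  refine (eLpNorm_fourierInv_le hq hq' hi (δ := δ) (S := 2 * B * ε⁻¹) ?_ ?_).trans ?_
  · simp only [hF]
    rw [integral_const_mul]
    refine mul_le_mul_of_nonneg_left ?_ (inv_pos.2 hε').le
    refine integral_mul_bump_le hloc η hε' (w := fun x => ‖𝓕 φ x‖) (fun x => ?_) fun x hx => ?_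
    · rw [abs_norm]
      exact hφ x
    · rw [hφ0 x hx, norm_zero]
  · filter_upwards [hB] with ξ hξ
    rw [hF, abs_norm]
    have h1 : ‖m ξ - m η‖ ≤ 2 * B := (norm_sub_le _ _).trans (by linarith)
    have hB0 : 0 ≤ B := (norm_nonneg _).trans hξ
    calc _ ≤ ε⁻¹ * (2 * B * 1) := by gcongr; exact hφ _
      _ = _ := by ring
  · have hB0 : 0 ≤ B := (norm_nonneg _).trans hBη
    have h1 : 0 ≤ 1 - 2 / q.toReal := by
      rw [sub_nonneg, div_le_one (by linarith)]
      exact hq2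
    have h2 : ENNReal.ofReal δ ^ (1 - 2 / q.toReal) * ENNReal.ofReal δ ^ (1 / q.toReal) =
        ENNReal.ofReal δ ^ (1 - 1 / q.toReal) := by
      rw [← ENNReal.rpow_add_of_nonneg _ _ h1 (by positivity)]
      congr 1
      ring
    calc _ = ENNReal.ofReal ε⁻¹ ^ (1 / q.toReal) * (ENNReal.ofReal (2 * B) ^ (1 / q.toReal) *
        (ENNReal.ofReal δ ^ (1 - 2 / q.toReal) * ENNReal.ofReal δ ^ (1 / q.toReal))) := by
          rw [ENNReal.ofReal_mul (p := 2 * B) (by positivity),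
            ENNReal.mul_rpow_of_nonneg _ _ (by positivity),
            ENNReal.mul_rpow_of_nonneg _ _ (by positivity)]
          ring
      _ ≤ _ := by
          rw [h2]
          exact mul_le_mul_right hδκ.le _

end

section

/-! ### Fredholm multipliers are elliptic -/

variable {p q : ℝ≥0∞} [Fact (1 ≤ p)] [Fact (1 ≤ q)]

lemma norm_toLp_packet {p : ℝ≥0∞} (hp : p ≠ ∞) (η : ℝ) {ε : ℝ} (hε : 0 < ε) (φ : 𝓢(ℝ, ℂ)) :
    ‖(packet η hε φ).toLp p‖ = ε⁻¹ ^ (1 / p.toReal) * ‖φ.toLp p‖ := by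
  rw [SchwartzMap.toLp, Lp.norm_toLp, eLpNorm_packet hp, ENNReal.toReal_mul, ← ENNReal.toReal_rpow,
    ENNReal.toReal_ofReal (inv_pos.2 hε).le, SchwartzMap.toLp, Lp.norm_toLp, one_div, one_div,
    ENNReal.toReal_inv]

lemma norm_toLp_compSubConst (t : ℝ) (φ : 𝓢(ℝ, ℂ)) :
    ‖(SchwartzMap.compSubConstCLM ℂ t φ).toLp p‖ = ‖φ.toLp p‖ := by
  rw [← translate_toLp, LinearIsometry.norm_map]

lemma MulBound.norm_toLp_le_add {C : ℝ≥0} {m : ℝ → ℂ} (hm : MulBound p C m) (c : ℂ) (φ : 𝓢(ℝ, ℂ))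
    {D : ℝ≥0∞} (hD : D ≠ ∞) (h : eLpNorm (mulOp (fun ξ => m ξ + -c) φ) p ≤ D) :
    ‖hm.toLp φ‖ ≤ ‖c‖ * ‖φ.toLp p‖ + D.toReal := by
  have h1 : MulBound p (C + ‖-c‖₊) (fun ξ => m ξ + -c) := hm.add Fact.out (.const p _)
  have e : hm.toLp φ = c • φ.toLp p volume + h1.toLp φ := by
    refine Lp.ext ?_
    filter_upwards [hm.coeFn_toLp φ, Lp.coeFn_add (c • φ.toLp p volume) (h1.toLp φ),
      Lp.coeFn_smul c (φ.toLp p volume), φ.coeFn_toLp p (volume : Measure ℝ), h1.coeFn_toLp φ]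
      with x h1 h2 h3 h4 h5
    rw [h1, h2, Pi.add_apply, h3, Pi.smul_apply, h4, h5, mulOp_add hm.toIsBddSymbol (.const _),
      mulOp_const, Pi.add_apply, smul_eq_mul]
    ring
  rw [e]
  refine (norm_add_le _ _).trans (add_le_add (norm_smul_le _ _) ?_)
  rw [MulBound.toLp, Lp.norm_toLp]
  exact ENNReal.toReal_mono hD h

lemma integral_mul_eq_fourier (φ ψ : 𝓢(ℝ, ℂ)) : ∫ x, φ x * ψ x = ∫ ξ, 𝓕 φ ξ * 𝓕⁻ ψ ξ := by
  have := (IsBddSymbol.const 1).integral_mulOp_mul φ ψ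
  simpa [mulOp_const] using this

/-- The pairing is bilinear, hence the two packets carry opposite modulations. The value does not
depend on the common translation. -/
lemma pairing_packet [p.HolderConjugate q] (η : ℝ) {ε : ℝ} (hε : 0 < ε) (t : ℝ) :
    pairing p q
      ((SchwartzMap.compSubConstCLM ℂ t (packet (-η) hε (𝓕 (schwartzBump unitBump)))).toLp p)
      ((SchwartzMap.compSubConstCLM ℂ t (packet η hε (𝓕⁻ (schwartzBump unitBump)))).toLp q) =
    ((ε⁻¹ * ∫ x, unitBump x ^ 2 : ℝ) : ℂ) := by
  set Θ := schwartzBump unitBump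
  set f := packet (-η) hε (𝓕 Θ) with hf
  set g := packet η hε (𝓕⁻ Θ) with hg
  have e1 : pairing p q ((SchwartzMap.compSubConstCLM ℂ t f).toLp p)
      ((SchwartzMap.compSubConstCLM ℂ t g).toLp q) = ∫ x, f (x - t) * g (x - t) :=
    pairing_toLp ((SchwartzMap.compSubConstCLM ℂ t f).memLp p volume)
      ((SchwartzMap.compSubConstCLM ℂ t g).memLp q volume)
  rw [e1, integral_sub_right_eq_self (fun x => f x * g x) t]
  simp_rw [mul_comm (f _)]
  rw [integral_mul_eq_fourier]
  have e3 : ∀ ξ, 𝓕 g ξ * 𝓕⁻ f ξ = ((ε⁻¹ ^ 2 * unitBump ((ξ - η) / ε) ^ 2 : ℝ) : ℂ) := by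
    intro ξ
    rw [hf, hg, fourierInv_packet, fourier_packet, FourierTransform.fourier_fourierInv_eq,
      FourierTransform.fourierInv_fourier_eq, schwartzBump_apply]
    push_cast
    ring
  simp only [e3]
  rw [integral_complex_ofReal, integral_const_mul,
    integral_sub_right_eq_self (fun ξ => unitBump (ξ / ε) ^ 2) η,
    Measure.integral_comp_div (fun ξ => unitBump ξ ^ 2) ε, abs_of_pos hε, smul_eq_mul]
  congr 1
  field_simp

lemma exists_packet_norm_le (hp : 2 ≤ p) (hp' : p ≠ ∞) {C : ℝ≥0} {m : ℝ → ℂ}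
    (hm : MulBound p C m) :
    ∀ᵐ η, ∀ κ : ℝ, 0 < κ → ∃ (ε : ℝ) (hε : 0 < ε), ∀ t,
      ‖hm.toLp (SchwartzMap.compSubConstCLM ℂ t (packet η hε (𝓕⁻ (schwartzBump unitBump))))‖ ≤
        ε⁻¹ ^ (1 / p.toReal) *
          (‖m η‖ * ‖(𝓕⁻ (schwartzBump unitBump) : 𝓢(ℝ, ℂ)).toLp p‖ + κ) := by
  have h := ae_exists_packet hp hp' hm.toIsBddSymbol (φ := 𝓕⁻ (schwartzBump unitBump))
    (fun x => by
      rw [FourierTransform.fourier_fourierInv_eq, schwartzBump_apply, Complex.norm_real]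
      exact abs_unitBump_le x)
    (fun x hx => by
      rw [FourierTransform.fourier_fourierInv_eq, schwartzBump_apply, unitBump_eq_zero hx]
      rfl)
  filter_upwards [h] with η hη κ hκ
  obtain ⟨ε, hε, hε'⟩ := hη κ hκ
  refine ⟨ε, hε, fun t => ?_⟩
  have hfin : ENNReal.ofReal ε⁻¹ ^ (1 / p.toReal) * ENNReal.ofReal κ ≠ ∞ := ENNReal.mul_ne_top
    (ENNReal.rpow_lt_top_of_nonneg (by positivity) ENNReal.ofReal_ne_top).ne ENNReal.ofReal_ne_top
  refine (hm.norm_toLp_le_add (m η) _ hfin (hε' t)).trans_eq ?_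
  rw [norm_toLp_compSubConst, norm_toLp_packet hp', ENNReal.toReal_mul, ← ENNReal.toReal_rpow,
    ENNReal.toReal_ofReal (inv_pos.2 hε).le, ENNReal.toReal_ofReal hκ.le]
  ring

namespace IsSymbol

variable {T : Lp ℂ p (volume : Measure ℝ) →L[ℂ] Lp ℂ p (volume : Measure ℝ)} {m : ℝ → ℂ}

lemma apply_toLp (h : IsSymbol T m) (hp : 1 < p) (hp' : p ≠ ∞) {C : ℝ≥0} (hm : MulBound p C m)
    (φ : 𝓢(ℝ, ℂ)) : T (φ.toLp p) = hm.toLp φ :=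
  Lp.ext ((h.toLp_ae_eq hp hp' φ).trans (hm.coeFn_toLp φ).symm)

/-- With K = RT - I of finite rank, apply I = RT - K to a translated packet: T multiplies its norm
by about |m(η)| and K is negligible for a suitable translate, so 1 ≤ ‖R‖ |m(η)|. The
almost-eigenfunction estimate is available because p ≥ 2. -/
lemma exists_le_of_two_le (h : IsSymbol T m) (hp : 2 ≤ p) (hp' : p ≠ ∞)
    {R : Lp ℂ p (volume : Measure ℝ) →L[ℂ] Lp ℂ p (volume : Measure ℝ)}
    (hK : FiniteDimensional ℂ (LinearMap.range (R ∘L T - .id ℂ _).toLinearMap)) :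
    ∃ c : ℝ, 0 < c ∧ ∀ᵐ ξ, c ≤ ‖m ξ‖ := by
  have hp1 : 1 < p := lt_of_lt_of_le (by norm_num) hp
  have hm := h.mulBound hp1 hp'
  set φ : 𝓢(ℝ, ℂ) := 𝓕⁻ (schwartzBump unitBump)
  have hφ : 0 < ‖φ.toLp p‖ := by
    rw [norm_pos_iff]
    intro h0
    have h1 : φ = 0 := SchwartzMap.injective_toLp p (volume : Measure ℝ)
      (h0.trans (map_zero (SchwartzMap.toLpCLM ℂ ℂ p (volume : Measure ℝ))).symm)
    have h2 : 𝓕 φ = schwartzBump unitBump := FourierTransform.fourier_fourierInv_eq _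
    have h3 := DFunLike.congr_fun h2 0
    rw [h1, FourierTransform.fourier_zero] at h3
    rw [schwartzBump_apply, unitBump.one_of_mem_closedBall (by simp [unitBump])] at h3
    simp at h3
  refine ⟨(‖R‖ + 1)⁻¹, by positivity, ?_⟩
  filter_upwards [exists_packet_norm_le hp hp' hm] with η hη
  have key : ‖φ.toLp p‖ ≤ ‖R‖ * (‖m η‖ * ‖φ.toLp p‖) := by
    refine le_of_forall_pos_le_add fun κ' hκ' => ?_
    -- The error κ occurs twice: once in the packet estimate, magnified by ‖R‖, and once from the
    -- finite rank part.
    obtain ⟨κ, hκ, hκκ⟩ : ∃ κ : ℝ, 0 < κ ∧ (‖R‖ + 1) * κ ≤ κ' :=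
      ⟨κ' / (‖R‖ + 1), by positivity, by field_simp; rfl⟩
    obtain ⟨ε, hε, hεt⟩ := hη κ hκ
    set s := ε⁻¹ ^ (1 / p.toReal)
    have hs : 0 < s := Real.rpow_pos_of_pos (inv_pos.2 hε) _
    obtain ⟨t, ht⟩ := exists_norm_translate_le hp1 hp' _ hK ((packet η hε φ).toLp p)
      (mul_pos hs hκ)
    rw [translate_toLp] at ht
    set ψ := SchwartzMap.compSubConstCLM ℂ t (packet η hε φ)
    have h1 : ‖ψ.toLp p‖ = s * ‖φ.toLp p‖ := by
      rw [norm_toLp_compSubConst, norm_toLp_packet hp']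
    have h2 : ‖R (T (ψ.toLp p))‖ ≤ ‖R‖ * (s * (‖m η‖ * ‖φ.toLp p‖ + κ)) := by
      rw [h.apply_toLp hp1 hp' hm]
      exact (R.le_opNorm _).trans (by gcongr; exact hεt t)
    have h3 : ‖ψ.toLp p‖ ≤ ‖R (T (ψ.toLp p))‖ + s * κ := by
      have e : ψ.toLp p = R (T (ψ.toLp p)) - (R ∘L T - .id ℂ _) (ψ.toLp p) := by simp
      nth_rewrite 1 [e]
      exact (norm_sub_le _ _).trans (by gcongr)
    rw [h1] at h3
    have h4 : s * ‖φ.toLp p‖ ≤ s * (‖R‖ * (‖m η‖ * ‖φ.toLp p‖) + (‖R‖ + 1) * κ) := by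
      linarith
    exact (le_of_mul_le_mul_left h4 hs).trans (by linarith)
  have h1 : 1 ≤ ‖R‖ * ‖m η‖ := by
    rw [← mul_assoc] at key
    exact (le_mul_iff_one_le_left hφ).1 key
  rw [inv_le_iff_one_le_mul₀ (by positivity)]
  nlinarith [norm_nonneg (m η)]

/-- For p ≤ 2 the almost-eigenfunction estimate holds only in L_q, for the transpose of `T`. Hence
the right regularizer: pairing TRf with a packet g moves T onto g, where it acts almost as a scalar,
while the pairing of f and g is ε⁻¹ κ₀. -/
lemma exists_le_of_le_two (h : IsSymbol T m) (hp : 1 < p) (hp2 : p ≤ 2)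
    {R : Lp ℂ p (volume : Measure ℝ) →L[ℂ] Lp ℂ p (volume : Measure ℝ)}
    (hK : FiniteDimensional ℂ (LinearMap.range (T ∘L R - .id ℂ _).toLinearMap)) :
    ∃ c : ℝ, 0 < c ∧ ∀ᵐ ξ, c ≤ ‖m ξ‖ := by
  have hp' : p ≠ ∞ := (hp2.trans_lt (by norm_num)).ne
  obtain ⟨q, hq, hq', hpq, -, hq2⟩ := exists_holderConjugate hp hp'
  have : Fact (1 ≤ q) := ⟨hq.le⟩
  have hm := (h.mulBound hp hp').dual hp' (hq2 hp2) hq' (q := q)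
  set Θ := schwartzBump unitBump
  set φ : 𝓢(ℝ, ℂ) := 𝓕⁻ Θ
  set φ' : 𝓢(ℝ, ℂ) := 𝓕 Θ
  set κ₀ := ∫ x, unitBump x ^ 2
  have hκ₀ : 0 < κ₀ := integral_unitBump_sq_pos
  refine ⟨κ₀ / (‖R‖ * ‖φ'.toLp p‖ * ‖φ.toLp q‖ + 1), by positivity, ?_⟩
  -- The transpose carries the reflected symbol, so the bound first appears at -η; reflection
  -- preserves null sets.
  have hneg : ∀ᵐ η, κ₀ / (‖R‖ * ‖φ'.toLp p‖ * ‖φ.toLp q‖ + 1) ≤ ‖m (-η)‖ := by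
    filter_upwards [exists_packet_norm_le (hq2 hp2) hq' hm] with η hη
    have key : κ₀ ≤ ‖R‖ * ‖φ'.toLp p‖ * (‖m (-η)‖ * ‖φ.toLp q‖) := by
      refine le_of_forall_pos_le_add fun κ' hκ' => ?_
      set A := ‖R‖ * ‖φ'.toLp p‖ + ‖φ.toLp q‖ with hA
      obtain ⟨κ, hκ, hκκ⟩ : ∃ κ : ℝ, 0 < κ ∧ A * κ ≤ κ' := by
        refine ⟨κ' / (A + 1), by positivity, ?_⟩
        rw [mul_div_assoc', div_le_iff₀ (by positivity), mul_comm]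
        gcongr
        linarith
      obtain ⟨ε, hε, hεt⟩ := hη κ hκ
      set s := ε⁻¹ ^ (1 / p.toReal)
      set s' := ε⁻¹ ^ (1 / q.toReal)
      have hs : 0 < s := Real.rpow_pos_of_pos (inv_pos.2 hε) _
      have hs' : 0 < s' := Real.rpow_pos_of_pos (inv_pos.2 hε) _
      have hss : s * s' = ε⁻¹ := by
        rw [← Real.rpow_add (inv_pos.2 hε), one_div, one_div,
          (ENNReal.HolderConjugate.toReal_of_ne_top hp' hq').inv_add_inv_eq_one, Real.rpow_one]
      obtain ⟨t, ht⟩ := exists_norm_translate_le hp hp' _ hK ((packet (-η) hε φ').toLp p)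
        (mul_pos hs hκ)
      rw [translate_toLp] at ht
      set f := SchwartzMap.compSubConstCLM ℂ t (packet (-η) hε φ')
      set g := SchwartzMap.compSubConstCLM ℂ t (packet η hε φ)
      have hfn : ‖f.toLp p‖ = s * ‖φ'.toLp p‖ := by
        rw [norm_toLp_compSubConst, norm_toLp_packet hp']
      have hgn : ‖g.toLp q‖ = s' * ‖φ.toLp q‖ := by
        rw [norm_toLp_compSubConst, norm_toLp_packet hq']
      have hfg : pairing p q (f.toLp p) (g.toLp q) = ((ε⁻¹ * κ₀ : ℝ) : ℂ) :=
        pairing_packet η hε t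
      have e : f.toLp p = T (R (f.toLp p)) - (T ∘L R - .id ℂ _) (f.toLp p) := by simp
      have h1 : ‖pairing p q (T (R (f.toLp p))) (g.toLp q)‖ ≤
          ‖R‖ * (s * ‖φ'.toLp p‖) * (s' * (‖m (-η)‖ * ‖φ.toLp q‖ + κ)) := by
        rw [h.pairing_eq hp hp' hm]
        refine (norm_pairing_le _ _).trans (mul_le_mul ?_ (hεt t) (norm_nonneg _) (by positivity))
        rw [← hfn]
        exact R.le_opNorm _
      have h2 : ‖pairing p q ((T ∘L R - .id ℂ _) (f.toLp p)) (g.toLp q)‖ ≤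
          s * κ * (s' * ‖φ.toLp q‖) := by
        rw [← hgn]
        exact (norm_pairing_le _ _).trans (mul_le_mul_of_nonneg_right ht (norm_nonneg _))
      have h3 : ε⁻¹ * κ₀ ≤ ‖R‖ * (s * ‖φ'.toLp p‖) * (s' * (‖m (-η)‖ * ‖φ.toLp q‖ + κ)) +
          s * κ * (s' * ‖φ.toLp q‖) := by
        have h4 := congrArg norm hfg
        rw [Complex.norm_real, Real.norm_of_nonneg (by positivity), e, map_sub,
          _root_.sub_apply] at h4
        rw [← h4]
        exact (norm_sub_le _ _).trans (add_le_add h1 h2)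
      have h5 : ε⁻¹ * κ₀ ≤ ε⁻¹ * (‖R‖ * ‖φ'.toLp p‖ * (‖m (-η)‖ * ‖φ.toLp q‖) + A * κ) := by
        refine h3.trans_eq ?_
        rw [← hss, hA]
        ring
      exact (le_of_mul_le_mul_left h5 (inv_pos.2 hε)).trans (by linarith)
    rw [div_le_iff₀ (by positivity)]
    nlinarith [norm_nonneg (m (-η))]
  have := (Measure.measurePreserving_neg (volume : Measure ℝ)).quasiMeasurePreserving.ae hneg
  simpa using this

/-- The symbol of a Fredholm multiplier operator is bounded from below. -/
theorem exists_le_of_isFredholm (h : IsSymbol T m) (hp : 1 < p) (hp' : p ≠ ∞)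
    (hT : T.IsFredholm) : ∃ c : ℝ, 0 < c ∧ ∀ᵐ ξ, c ≤ ‖m ξ‖ := by
  obtain ⟨R, hR⟩ := hT.exists_isQuasiInverse
  rcases le_total 2 p with h2 | h2
  · refine h.exists_le_of_two_le h2 hp' (R := R) ?_
    have := LinearMap.FiniteRangeSetoid.equiv_iff_hasFiniteRange.1 hR.1
    exact (Module.finite_def.2 (Submodule.fg_top _ |>.2 this))
  · refine h.exists_le_of_le_two hp h2 (R := R) ?_
    have := LinearMap.FiniteRangeSetoid.equiv_iff_hasFiniteRange.1 hR.2
    exact (Module.finite_def.2 (Submodule.fg_top _ |>.2 this))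

end IsSymbol

end

section

/-! ### Change of the normalisation of the Fourier transform -/

/-- Replacing the test function by its dilate brings out the Jacobian |c⁻¹| on both sides, where it
cancels. -/
lemma forall_integral_dilation_iff (g : ℝ → ℂ) {c : ℝ} (hc : c ≠ 0) (f : ℝ → ℂ) :
    (∀ ψ : 𝓢(ℝ, ℂ), Integrable (fun ξ => f ξ * ψ ξ) ∧
      ∫ x, g x * dilation c hc (𝓕 ψ) x = ∫ ξ, f ξ * ψ ξ) ↔
    ∀ ψ : 𝓢(ℝ, ℂ), Integrable (fun ξ => f (ξ / c) * ψ ξ) ∧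
      ∫ x, g x * 𝓕 ψ x = ∫ ξ, f (ξ / c) * ψ ξ := by
  rw [(dilation c hc).surjective.forall]
  refine forall_congr' fun ψ => ?_
  have e1 : (fun ξ => f ξ * dilation c hc ψ ξ) = fun ξ => (fun η => f (η / c) * ψ η) (c * ξ) := by
    ext ξ
    simp [mul_div_cancel_left₀ _ hc]
  have e2 : ∀ x, g x * dilation c hc (𝓕 (dilation c hc ψ)) x =
      ((|c⁻¹| : ℝ) : ℂ) * (g x * 𝓕 ψ x) := by
    intro x
    rw [dilation_apply, fourier_dilation, mul_div_cancel_left₀ _ hc]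
    ring
  have hc' : ((|c⁻¹| : ℝ) : ℂ) ≠ 0 := by
    simpa using hc
  simp only [e2]
  rw [e1, integrable_comp_mul_left_iff (fun η => f (η / c) * ψ η) hc, integral_const_mul,
    Measure.integral_comp_mul_left (fun η => f (η / c) * ψ η) c, Complex.real_smul,
    mul_right_inj' hc']

variable {p : ℝ≥0∞} [Fact (1 ≤ p)]

lemma toTemperedDistributionCLM_apply_eq (f : Lp ℂ p (volume : Measure ℝ)) (ψ : 𝓢(ℝ, ℂ)) :
    Lp.toTemperedDistributionCLM ℂ volume p f ψ = ∫ x, f x * ψ x := by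
  refine (Lp.toTemperedDistribution_apply f ψ).trans ?_
  simp_rw [smul_eq_mul, mul_comm]

lemma isFunction_fourierDistR_iff (g : Lp ℂ p (volume : Measure ℝ)) (f : ℝ → ℂ) :
    IsFunction (fourierDistR (Lp.toTemperedDistributionCLM ℂ volume p g)) f ↔ ∀ ψ : 𝓢(ℝ, ℂ),
      Integrable (fun η => f (η / -(1 / (2 * Real.pi))) * ψ η) ∧
      ∫ x, g x * 𝓕 ψ x = ∫ η, f (η / -(1 / (2 * Real.pi))) * ψ η := by
  rw [← forall_integral_dilation_iff g neg_inv_two_pi_ne_zero]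
  have e : ∀ ψ, fourierDistR (Lp.toTemperedDistributionCLM ℂ volume p g) ψ =
      ∫ x, g x * dilation (-(1 / (2 * Real.pi))) neg_inv_two_pi_ne_zero (𝓕 ψ) x :=
    fun ψ => toTemperedDistributionCLM_apply_eq g (fourierR ψ)
  simp only [← e]
  rfl

lemma isSymbol_iff (T : Lp ℂ p (volume : Measure ℝ) →L[ℂ] Lp ℂ p (volume : Measure ℝ))
    (m : ℝ → ℂ) : IsSymbol T m ↔ ∀ φ ψ : 𝓢(ℝ, ℂ), Integrable (fun ξ => m ξ * 𝓕 φ ξ * ψ ξ) ∧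
      ∫ x, T (φ.toLp p) x * 𝓕 ψ x = ∫ ξ, m ξ * 𝓕 φ ξ * ψ ξ :=
  ⟨fun h φ ψ => ⟨h.integrable φ ψ, h.integral_eq φ ψ⟩,
    fun h => ⟨fun φ ψ => (h φ ψ).1, fun φ ψ => (h φ ψ).2⟩⟩

/-- Passing from the kernel exp(iξt) to exp(-2πiξt) dilates the symbol; once it is rewritten in this
way, membership is the existence of an operator satisfying `IsSymbol`. -/
lemma mem_multipliers_iff (hp : 1 < p) (hp' : p ≠ ∞) (a : ℝ → ℂ) :
    a ∈ multipliers p ↔ ∃ C, MulBound p C (fun η => a (η / -(1 / (2 * Real.pi)))) := by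
  have key : ∀ T : Lp ℂ p (volume : Measure ℝ) →L[ℂ] Lp ℂ p (volume : Measure ℝ),
      (∀ φ : 𝓢(ℝ, ℂ), IsFunction (fourierDistR (Lp.toTemperedDistributionCLM ℂ volume p
        (T (φ.toLp p)))) (fun ξ => a ξ * fourierR φ ξ)) ↔
      IsSymbol T (fun η => a (η / -(1 / (2 * Real.pi)))) := by
    intro T
    rw [isSymbol_iff]
    refine forall_congr' fun φ => ?_
    rw [isFunction_fourierDistR_iff]
    have e : ∀ η, fourierR φ (η / -(1 / (2 * Real.pi))) = 𝓕 φ η := by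
      intro η
      simp only [fourierR, ContinuousLinearEquiv.trans_apply, FourierTransform.fourierCLE_apply,
        dilation_apply]
      rw [mul_div_cancel₀ _ neg_inv_two_pi_ne_zero]
    simp only [e]
  constructor
  · rintro ⟨T, hT⟩
    exact ⟨_, ((key T).1 hT).mulBound hp hp'⟩
  · rintro ⟨C, hC⟩
    obtain ⟨T, hT⟩ := exists_isSymbol hp' hC
    exact ⟨T, (key T).2 hT⟩

/-! ### Transfer from the group to the line -/

lemma bracket_mul_bracket (r s ξ : ℝ) : bracket r ξ * bracket s ξ = bracket (r + s) ξ := by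
  rw [bracket, bracket, bracket, ← Real.rpow_add (by positivity), ← add_div]

lemma bracket_pos (r ξ : ℝ) : 0 < bracket r ξ := Real.rpow_pos_of_pos (by positivity) _

lemma bracket_neg (r ξ : ℝ) : bracket (-r) ξ = (bracket r ξ)⁻¹ := by
  rw [bracket, bracket, neg_div, Real.rpow_neg (by positivity)]

lemma mem_multipliersOfOrder_iff (r : ℝ) (a : ℝ → ℂ) :
    a ∈ multipliersOfOrder p r ↔ reduced r a ∈ multipliers p := by
  have h : ∀ b : ℝ → ℂ, (fun ξ => (bracket r ξ : ℂ) * reduced r b ξ) = b := by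
    intro b
    ext ξ
    have := (bracket_pos r ξ).ne'
    rw [reduced, bracket_neg, ← mul_assoc, ← Complex.ofReal_mul, mul_inv_cancel₀ this,
      Complex.ofReal_one, one_mul]
  constructor
  · rintro ⟨b, hb, rfl⟩
    convert hb using 1
    ext ξ
    have := (bracket_pos r ξ).ne'
    rw [reduced, bracket_neg, ← mul_assoc, ← Complex.ofReal_mul, inv_mul_cancel₀ this,
      Complex.ofReal_one, one_mul]
  · exact fun ha => ⟨_, ha, (h a).symm⟩

lemma IsFunction.smulLeft {F : 𝓢'(ℝ, ℂ)} {f : ℝ → ℂ} (h : IsFunction F f) (s : ℝ) :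
    IsFunction (TemperedDistribution.smulLeftCLM ℂ (fun ξ : ℝ => (bracket s ξ : ℂ)) F)
      (fun ξ => bracket s ξ * f ξ) := by
  intro ψ
  have h1 := h (SchwartzMap.smulLeftCLM ℂ (fun ξ : ℝ => (bracket s ξ : ℂ)) ψ)
  have e : ∀ ξ, f ξ * SchwartzMap.smulLeftCLM ℂ (fun ξ : ℝ => (bracket s ξ : ℂ)) ψ ξ =
      bracket s ξ * f ξ * ψ ξ := by
    intro ξ
    rw [SchwartzMap.smulLeftCLM_apply_apply (bracket_hasTemperateGrowth s), smul_eq_mul]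
    ring
  simp only [e] at h1
  rw [TemperedDistribution.smulLeftCLM_apply_apply]
  exact h1

lemma isFunction_fourierDistG_bessel_iff (s : ℝ) (F : DistG) (f : ℝ → ℂ) :
    IsFunction (fourierDistG (bessel s F)) (fun ξ => bracket s ξ * f ξ) ↔
      IsFunction (fourierDistG F) f := by
  have h : ∀ (s : ℝ) (F : DistG), fourierDistG (bessel s F) =
      TemperedDistribution.smulLeftCLM ℂ (fun ξ : ℝ => (bracket s ξ : ℂ)) (fourierDistG F) :=
    fun s F => by rw [bessel_apply, fourierDistG_fourierDistGInv]
  constructor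
  · intro h1
    have h2 := h1.smulLeft (-s)
    rw [← h, bessel_neg_bessel] at h2
    convert h2 using 2 with ξ
    have := (bracket_pos s ξ).ne'
    rw [bracket_neg, ← mul_assoc, ← Complex.ofReal_mul, inv_mul_cancel₀ this,
      Complex.ofReal_one, one_mul]
  · intro h1
    rw [h]
    exact h1.smulLeft s

lemma neg_inv_pi_ne_zero : -(1 / Real.pi) ≠ 0 := by
  have := Real.pi_pos
  exact neg_ne_zero.2 (by positivity)

/-- The characters of G are exp(2iξt) in the variable t, so the frequency scale is -1/π, twice the
-1/(2π) of the transform on the line. -/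
lemma dilation_two_fourierR (φ : 𝓢(ℝ, ℂ)) :
    dilation 2 two_ne_zero (fourierR φ) = dilation (-(1 / Real.pi)) neg_inv_pi_ne_zero (𝓕 φ) := by
  ext ξ
  simp only [fourierR, ContinuousLinearEquiv.trans_apply, FourierTransform.fourierCLE_apply,
    dilation_apply]
  congr 1
  field_simp

lemma isFunction_fourierDistG_lpToDist_iff (g : Lp ℂ p dG) (f : ℝ → ℂ) :
    IsFunction (fourierDistG (lpToDist p g)) f ↔ ∀ ψ : 𝓢(ℝ, ℂ),
      Integrable (fun η => f (η / -(1 / Real.pi)) * ψ η) ∧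
      ∫ x, xStarLp p g x * 𝓕 ψ x = ∫ η, f (η / -(1 / Real.pi)) * ψ η := by
  rw [← forall_integral_dilation_iff (xStarLp p g) neg_inv_pi_ne_zero]
  have e : ∀ ψ, fourierDistG (lpToDist p g) ψ =
      ∫ x, xStarLp p g x * dilation (-(1 / Real.pi)) neg_inv_pi_ne_zero (𝓕 ψ) x := by
    intro ψ
    rw [← dilation_two_fourierR]
    refine (toTemperedDistributionCLM_apply_eq (xStarLp p g) (xStar (fourierGTr ψ))).trans ?_
    have : xStar (fourierGTr ψ) = dilation 2 two_ne_zero (fourierR ψ) := tStar.symm_apply_apply _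
    rw [this]
  simp only [← e]
  rfl

lemma xStarLp_surjective : Function.Surjective (xStarLp p) := by
  intro f
  have ht : MeasurePreserving tG dG volume := MeasurePreserving.symm xEquiv measurePreserving_xG
  refine ⟨Lp.compMeasurePreserving tG ht f, ?_⟩
  change Lp.compMeasurePreserving xG measurePreserving_xG (Lp.compMeasurePreserving tG ht f) = f
  refine Lp.ext ?_
  have h1 := measurePreserving_xG.quasiMeasurePreserving.ae_eq_comp
    (Lp.coeFn_compMeasurePreserving f ht)
  filter_upwards [Lp.coeFn_compMeasurePreserving (Lp.compMeasurePreserving tG ht f)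
    measurePreserving_xG, h1] with t h2 h3
  rw [h2, h3]
  simp

variable (p) in
/-- The isometry `x_* Λ^s` of `H^s_p(G,dG)` onto `L_p(ℝ)`. -/
def besselEquiv (s : ℝ) : BesselSpace p s ≃ₗᵢ[ℂ] Lp ℂ p (volume : Measure ℝ) :=
  LinearIsometryEquiv.ofSurjective ((xStarLp p).comp ⟨potential p s, fun _ => rfl⟩)
    (xStarLp_surjective.comp (potential_surjective s))

lemma besselEquiv_apply {s : ℝ} (f : BesselSpace p s) :
    besselEquiv p s f = xStarLp p (potential p s f) := rfl

lemma besselEquiv_toH (s : ℝ) (u : SchwartzG) :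
    besselEquiv p s (u.toH p s) = (xStar (besselS s u)).toLp p := by
  obtain ⟨g, hg1, hg2⟩ := exists_lpToDist_eq_toDist p (besselS s u)
  rw [besselEquiv_apply, ← hg1]
  refine congrArg (xStarLp p) (lpToDist_injective p ?_)
  rw [hg2, ← bessel_toDist]
  exact lpToDist_potential _

lemma fourierG_eq (s : ℝ) (u : SchwartzG) (ξ : ℝ) :
    fourierG u ξ = bracket (-s) ξ * 𝓕 (xStar (besselS s u)) (-(1 / Real.pi) * ξ) := by
  have h1 : fourierG (besselS s u) ξ = bracket s ξ * fourierG u ξ := by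
    simp [besselS, SchwartzMap.smulLeftCLM_apply_apply (bracket_hasTemperateGrowth s)]
  have h2 : fourierG (besselS s u) ξ = 𝓕 (xStar (besselS s u)) (-(1 / Real.pi) * ξ) := by
    have := DFunLike.congr_fun (dilation_two_fourierR (xStar (besselS s u))) ξ
    rw [dilation_apply _ neg_inv_pi_ne_zero] at this
    exact this
  have := (bracket_pos s ξ).ne'
  rw [← h2, h1, bracket_neg, ← mul_assoc, ← Complex.ofReal_mul, inv_mul_cancel₀ this,
    Complex.ofReal_one, one_mul]

/-- The operator in `L_p(ℝ)` which corresponds to `T` under the isometries `besselEquiv`. -/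
def toLine {s σ : ℝ} (T : BesselSpace p s →L[ℂ] BesselSpace p σ) :
    Lp ℂ p (volume : Measure ℝ) →L[ℂ] Lp ℂ p (volume : Measure ℝ) :=
  (besselEquiv p σ).toContinuousLinearEquiv.toContinuousLinearMap ∘L T ∘L
    (besselEquiv p s).symm.toContinuousLinearEquiv.toContinuousLinearMap

/-- The inverse of `toLine`. -/
def ofLine (s σ : ℝ) (T : Lp ℂ p (volume : Measure ℝ) →L[ℂ] Lp ℂ p (volume : Measure ℝ)) :
    BesselSpace p s →L[ℂ] BesselSpace p σ :=
  (besselEquiv p σ).symm.toContinuousLinearEquiv.toContinuousLinearMap ∘L T ∘L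
    (besselEquiv p s).toContinuousLinearEquiv.toContinuousLinearMap

lemma toLine_apply {s σ : ℝ} (T : BesselSpace p s →L[ℂ] BesselSpace p σ)
    (f : Lp ℂ p (volume : Measure ℝ)) :
    toLine T f = besselEquiv p σ (T ((besselEquiv p s).symm f)) := rfl

lemma ofLine_apply (s σ : ℝ) (T : Lp ℂ p (volume : Measure ℝ) →L[ℂ] Lp ℂ p (volume : Measure ℝ))
    (f : BesselSpace p s) :
    ofLine s σ T f = (besselEquiv p σ).symm (T (besselEquiv p s f)) := rfl

lemma toLine_ofLine (s σ : ℝ)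
    (T : Lp ℂ p (volume : Measure ℝ) →L[ℂ] Lp ℂ p (volume : Measure ℝ)) :
    toLine (ofLine s σ T) = T := by
  ext1 f
  rw [toLine_apply, ofLine_apply, LinearIsometryEquiv.apply_symm_apply,
    LinearIsometryEquiv.apply_symm_apply]

/-- Conjugation by Bessel potentials turns `T` into Λ^σ T Λ^{-s}, which multiplies the symbol by
⟨ξ⟩^{σ-s}. The test functions match because Λ^s maps 𝕊(G) onto itself. -/
lemma isConvolution_iff {s σ : ℝ} (a : ℝ → ℂ) (T : BesselSpace p s →L[ℂ] BesselSpace p σ) :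
    IsConvolution a T ↔ IsSymbol (toLine T) (fun η => reduced (s - σ) a (η / -(1 / Real.pi))) := by
  have h : ∀ u : SchwartzG,
      IsFunction (fourierDistG (T (u.toH p s)).toDist) (fun ξ => a ξ * fourierG u ξ) ↔
      ∀ ψ : 𝓢(ℝ, ℂ), Integrable (fun η => reduced (s - σ) a (η / -(1 / Real.pi)) *
          𝓕 (xStar (besselS s u)) η * ψ η) ∧
        ∫ x, toLine T ((xStar (besselS s u)).toLp p) x * 𝓕 ψ x =
        ∫ η, reduced (s - σ) a (η / -(1 / Real.pi)) * 𝓕 (xStar (besselS s u)) η * ψ η := by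
    intro u
    rw [← isFunction_fourierDistG_bessel_iff σ, ← lpToDist_potential,
      isFunction_fourierDistG_lpToDist_iff, ← besselEquiv_apply]
    have e1 : toLine T ((xStar (besselS s u)).toLp p) = besselEquiv p σ (T (u.toH p s)) := by
      rw [← besselEquiv_toH, toLine_apply, LinearIsometryEquiv.symm_apply_apply]
    have e2 : ∀ η, bracket σ (η / -(1 / Real.pi)) * (a (η / -(1 / Real.pi)) *
        fourierG u (η / -(1 / Real.pi))) =
        reduced (s - σ) a (η / -(1 / Real.pi)) * 𝓕 (xStar (besselS s u)) η := by
      intro η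
      have hb := bracket_mul_bracket σ (-s) (η / -(1 / Real.pi))
      rw [fourierG_eq s, mul_div_cancel₀ _ neg_inv_pi_ne_zero, reduced,
        show -(s - σ) = σ + -s by ring, ← hb]
      push_cast
      ring
    simp only [e1, e2]
  have hs : ∀ φ : 𝓢(ℝ, ℂ), ∃ u, xStar (besselS s u) = φ := fun φ => by
    obtain ⟨u, hu⟩ := besselS_surjective s (xStar.symm φ)
    exact ⟨u, by rw [hu, ContinuousLinearEquiv.apply_symm_apply]⟩
  rw [isSymbol_iff]
  refine ⟨fun h' φ => ?_, fun h' u => (h u).2 (h' _)⟩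
  obtain ⟨u, rfl⟩ := hs φ
  exact (h u).1 (h' u)

lemma toLinearMap_toLine {s σ : ℝ} (T : BesselSpace p s →L[ℂ] BesselSpace p σ) :
    (toLine T).toLinearMap = (besselEquiv p σ).toLinearEquiv.toLinearMap ∘ₗ T.toLinearMap ∘ₗ
      (besselEquiv p s).toLinearEquiv.symm.toLinearMap :=
  LinearMap.ext fun f => toLine_apply T f

lemma isFredholm_toLine {s σ : ℝ} {T : BesselSpace p s →L[ℂ] BesselSpace p σ}
    (hT : T.IsFredholm) : (toLine T).IsFredholm := by
  obtain ⟨R, hR⟩ := hT.exists_isQuasiInverse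
  refine ContinuousLinearMap.IsFredholm.of_isQuasiInverse (v := toLine R) ?_
  have h1 := (besselEquiv p σ).toLinearEquiv.isQuasiInverse
  have h2 := (besselEquiv p s).toLinearEquiv.isQuasiInverse.symm
  have h3 := h2.comp (hR.comp h1)
  rw [LinearMap.comp_assoc] at h3
  rw [toLinearMap_toLine, toLinearMap_toLine]
  exact h3

end

section

/-! ### Boundedness, Fredholm property and invertibility of convolutions on the group -/

variable {p : ℝ≥0∞} [Fact (1 ≤ p)]

lemma MulBound.comp_mul_left_iff {p : ℝ≥0∞} (hp : p ≠ ∞) {m : ℝ → ℂ} {c : ℝ} (hc : c ≠ 0) :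
    (∃ C, MulBound p C fun ξ => m (c * ξ)) ↔ ∃ C, MulBound p C m := by
  refine ⟨fun ⟨C, h⟩ => ⟨C, ?_⟩, fun ⟨C, h⟩ => ⟨C, h.comp_mul_left hp hc⟩⟩
  simpa [mul_inv_cancel_left₀ hc] using h.comp_mul_left hp (inv_ne_zero hc)

lemma MulBound.comp_div_iff {p : ℝ≥0∞} (hp : p ≠ ∞) {m : ℝ → ℂ} {c : ℝ} (hc : c ≠ 0) :
    (∃ C, MulBound p C fun ξ => m (ξ / c)) ↔ ∃ C, MulBound p C m := by
  rw [← MulBound.comp_mul_left_iff hp (m := m) (inv_ne_zero hc)]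
  simp only [div_eq_inv_mul]

lemma exists_isConvolution_iff (hp : 1 < p) (hp' : p ≠ ∞) (s r : ℝ) (a : ℝ → ℂ) :
    (∃ T : BesselSpace p s →L[ℂ] BesselSpace p (s - r), IsConvolution a T) ↔
      ∃ C, MulBound p C (reduced r a) := by
  rw [← MulBound.comp_div_iff hp' neg_inv_pi_ne_zero]
  have hr : s - (s - r) = r := by ring
  constructor
  · rintro ⟨T, hT⟩
    have := ((isConvolution_iff a T).1 hT).mulBound hp hp'
    rw [hr] at this
    exact ⟨_, this⟩
  · rintro ⟨C, hC⟩
    obtain ⟨T, hT⟩ := exists_isSymbol hp' hC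
    refine ⟨ofLine s (s - r) T, (isConvolution_iff a _).2 ?_⟩
    rwa [toLine_ofLine, hr]

/-- The frequency scales of the group and of the line differ, but invariance under dilations makes
both conditions the same bound on the undilated symbol. -/
lemma mem_multipliersOfOrder_iff_mulBound (hp : 1 < p) (hp' : p ≠ ∞) (r : ℝ) (a : ℝ → ℂ) :
    a ∈ multipliersOfOrder p r ↔ ∃ C, MulBound p C (reduced r a) := by
  rw [mem_multipliersOfOrder_iff, mem_multipliers_iff hp hp',
    MulBound.comp_div_iff hp' neg_inv_two_pi_ne_zero]

lemma ae_comp_mul_left {P : ℝ → Prop} {c : ℝ} (hc : c ≠ 0) (h : ∀ᵐ ξ, P ξ) : ∀ᵐ ξ, P (c * ξ) := by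
  have hq : Measure.QuasiMeasurePreserving (fun ξ : ℝ => c * ξ) := by
    refine ⟨measurable_const_mul c, ?_⟩
    rw [Real.map_volume_mul_left hc]
    exact Measure.smul_absolutelyContinuous
  exact hq.ae h

lemma IsConvolution.isElliptic (hp : 1 < p) (hp' : p ≠ ∞) {s r : ℝ} {a : ℝ → ℂ}
    {T : BesselSpace p s →L[ℂ] BesselSpace p (s - r)} (h : IsConvolution a T)
    (hT : T.IsFredholm) : IsElliptic r a := by
  have hr : s - (s - r) = r := by ring
  have h1 := (isConvolution_iff a T).1 h
  rw [hr] at h1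
  obtain ⟨c, hc, h2⟩ := h1.exists_le_of_isFredholm hp hp' (isFredholm_toLine hT)
  refine ⟨c, hc, ?_⟩
  have h3 := ae_comp_mul_left neg_inv_pi_ne_zero h2
  simpa only [mul_div_cancel_left₀ _ neg_inv_pi_ne_zero] using h3

lemma exists_mulBound_of_mem_wienerClass {p : ℝ≥0∞} (hp : 1 < p) (hp' : p ≠ ∞) {b : ℝ → ℂ}
    (hb : b ∈ wienerClass) {δ : ℝ} (hδ : 0 < δ) (h : ∀ᵐ ξ, δ ≤ ‖b ξ‖) :
    (∃ C, MulBound p C b) ∧ ∃ C, MulBound p C (fun ξ => (b ξ)⁻¹) := by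
  obtain ⟨c, k, hk, hck⟩ := hb
  have e : ∀ η, b (η / -(1 / (2 * Real.pi))) = c + 𝓕 k η := by
    intro η
    rw [hck, Real.fourier_real_eq_integral_exp_smul]
    congr 2
    ext t
    rw [smul_eq_mul]
    congr 2
    have := Real.pi_ne_zero
    push_cast
    field_simp
  have hcont : Continuous (fun η => c + 𝓕 k η) := continuous_const.add
    (VectorFourier.fourierIntegral_continuous Real.continuous_fourierChar (by fun_prop) hk)
  have h1 : ∀ᵐ η, δ ≤ ‖c + 𝓕 k η‖ := by
    filter_upwards [ae_comp_mul_left (inv_ne_zero neg_inv_two_pi_ne_zero) h] with η hη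
    rwa [← div_eq_inv_mul, e] at hη
  -- Continuity upgrades the almost everywhere lower bound to every point, as the Neumann series
  -- argument requires.
  have h2 : ∀ η, δ ≤ ‖c + 𝓕 k η‖ := by
    have hcl : IsClosed {η | δ ≤ ‖c + 𝓕 k η‖} := isClosed_le continuous_const hcont.norm
    have hd := Measure.dense_of_ae h1
    intro η
    have := hd η
    rwa [hcl.closure_eq] at this
  rw [← MulBound.comp_div_iff hp' neg_inv_two_pi_ne_zero,
    ← MulBound.comp_div_iff hp' (m := fun ξ => (b ξ)⁻¹) neg_inv_two_pi_ne_zero]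
  simp only [e]
  exact ⟨exists_mulBound_add_fourier hp hp' c hk, exists_mulBound_inv_add_fourier hp hp' c hk hδ h2⟩

lemma exists_equiv_isConvolution (hp : 1 < p) (hp' : p ≠ ∞) (s r : ℝ) {a : ℝ → ℂ}
    (ha : BoundedVariationOn (reduced r a) univ ∨ reduced r a ∈ wienerClass)
    (hell : IsElliptic r a) :
    ∃ T : BesselSpace p s ≃L[ℂ] BesselSpace p (s - r),
      IsConvolution a (T : BesselSpace p s →L[ℂ] BesselSpace p (s - r)) ∧
      IsConvolution (fun ξ => (a ξ)⁻¹)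
        (T.symm : BesselSpace p (s - r) →L[ℂ] BesselSpace p s) := by
  obtain ⟨δ, hδ, hδa⟩ := hell
  -- The exponent is left free because inverting the operator in L_p also uses the transposed
  -- multipliers in the conjugate space.
  have hm : ∀ {q : ℝ≥0∞}, 1 < q → q ≠ ∞ → (∃ C, MulBound q C (reduced r a)) ∧
      ∃ C, MulBound q C (fun ξ => (reduced r a ξ)⁻¹) := by
    intro q hq hq'
    rcases ha with ha | ha
    · exact ⟨exists_mulBound_of_boundedVariation hq hq' ha,
        exists_mulBound_inv_of_boundedVariation hq hq' ha hδ hδa⟩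
    · exact exists_mulBound_of_mem_wienerClass hq hq' ha hδ hδa
  -- This holds also at zeros of `a`, where both sides vanish by the convention 0⁻¹ = 0.
  have hinv : reduced (-r) (fun ξ => (a ξ)⁻¹) = fun ξ => (reduced r a ξ)⁻¹ := by
    ext ξ
    simp only [reduced]
    rw [neg_neg, bracket_neg, mul_inv, Complex.ofReal_inv, inv_inv]
  obtain ⟨q, hq, hq', hpq, -⟩ := exists_holderConjugate hp hp'
  have : Fact (1 ≤ q) := ⟨hq.le⟩
  set d := -(1 / Real.pi)
  have hd : d ≠ 0 := neg_inv_pi_ne_zero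
  set m : ℝ → ℂ := fun η => reduced r a (η / d) with hmdef
  set m' : ℝ → ℂ := fun η => (reduced r a (η / d))⁻¹
  obtain ⟨C₁, h₁⟩ := (MulBound.comp_div_iff hp' hd).2 (hm hp hp').1
  obtain ⟨C₂, h₂⟩ := (MulBound.comp_div_iff hp' hd).2 (hm hp hp').2
  obtain ⟨C₃, h₃⟩ := (MulBound.comp_div_iff hq' hd).2 (hm hq hq').1
  obtain ⟨C₄, h₄⟩ := (MulBound.comp_div_iff hq' hd).2 (hm hq hq').2
  obtain ⟨T, hT⟩ := exists_isSymbol hp' h₁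
  obtain ⟨T', hT'⟩ := exists_isSymbol hp' h₂
  have hne : ∀ᵐ η, m η ≠ 0 := by
    filter_upwards [ae_comp_mul_left (inv_ne_zero hd) hδa] with η hη h0
    rw [← div_eq_inv_mul] at hη
    simp only [hmdef] at h0
    rw [h0, norm_zero] at hη
    exact absurd hη (not_le.2 hδ)
  have hTT' : T ∘L T' = .id ℂ _ := hT.comp_eq_id hp hp' (h₃.comp_neg hq') hT' (by
    filter_upwards [hne] with η hη using mul_inv_cancel₀ hη)
  have hT'T : T' ∘L T = .id ℂ _ := hT'.comp_eq_id hp hp' (h₄.comp_neg hq') hT (by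
    filter_upwards [hne] with η hη using inv_mul_cancel₀ hη)
  let E : BesselSpace p s ≃L[ℂ] BesselSpace p (s - r) :=
    ContinuousLinearEquiv.equivOfInverse (ofLine s (s - r) T) (ofLine (s - r) s T')
      (fun f => by
        rw [ofLine_apply, ofLine_apply, LinearIsometryEquiv.apply_symm_apply]
        have := DFunLike.congr_fun hT'T (besselEquiv p s f)
        rw [ContinuousLinearMap.comp_apply, ContinuousLinearMap.id_apply] at this
        rw [this, LinearIsometryEquiv.symm_apply_apply])
      (fun f => by
        rw [ofLine_apply, ofLine_apply, LinearIsometryEquiv.apply_symm_apply]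
        have := DFunLike.congr_fun hTT' (besselEquiv p (s - r) f)
        rw [ContinuousLinearMap.comp_apply, ContinuousLinearMap.id_apply] at this
        rw [this, LinearIsometryEquiv.symm_apply_apply])
  have e1 : (E : BesselSpace p s →L[ℂ] BesselSpace p (s - r)) = ofLine s (s - r) T := rfl
  have e2 : (E.symm : BesselSpace p (s - r) →L[ℂ] BesselSpace p s) = ofLine (s - r) s T' := rfl
  refine ⟨E, ?_, ?_⟩
  · rw [e1, isConvolution_iff, toLine_ofLine, sub_sub_cancel]
    exact hT
  · rw [e2, isConvolution_iff, toLine_ofLine, show s - r - s = -r by ring, hinv]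
    exact hT'

end

end LieConv

end

theorem theorem3p5 (p : ℝ≥0∞) [Fact (1 ≤ p)] (hp₁ : 1 < p) (hp₂ : p ≠ ∞) (s r : ℝ)
    (a : ℝ → ℂ) :
    ((∃ T : BesselSpace p s →L[ℂ] BesselSpace p (s - r), IsConvolution a T) ↔
      a ∈ multipliersOfOrder p r) ∧
    (∀ T : BesselSpace p s →L[ℂ] BesselSpace p (s - r), IsConvolution a T → T.IsFredholm →
      IsElliptic r a) ∧
    (BoundedVariationOn (reduced r a) univ ∨ reduced r a ∈ wienerClass → IsElliptic r a →
      ∃ T : BesselSpace p s ≃L[ℂ] BesselSpace p (s - r),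
        IsConvolution a (T : BesselSpace p s →L[ℂ] BesselSpace p (s - r)) ∧
        IsConvolution (fun ξ => (a ξ)⁻¹) (T.symm : BesselSpace p (s - r) →L[ℂ] BesselSpace p s)) := by
  exact ⟨(exists_isConvolution_iff hp₁ hp₂ s r a).trans
      (mem_multipliersOfOrder_iff_mulBound hp₁ hp₂ r a).symm,
    fun _ hT hF => hT.isElliptic hp₁ hp₂ hF,
    fun ha hell => exists_equiv_isConvolution hp₁ hp₂ s r ha hell⟩
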